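/- Let $\lambda\ge 0$, $1\le p<\infty$, $0<T\le\infty$, $\frac1p+\frac1{p'}=1$ (with $p'=\infty$ if $p=1$), and $\mathbb{R}^+=(0,\infty)$. Let $\Delta_\lambda=-\frac{d^2}{dx^2}-\frac{2\lambda}{x}\frac{d}{dx}$ be the Bessel operator on $\mathbb{R}^+$ and $d\mu_\lambda(y)=y^{2\lambda}\,dy$. For $t,x,y>0$ let $$W_t^\lambda(x,y)=\frac{(xy)^{-\lambda+\frac12}}{2t}\,e^{-\frac{x^2+y^2}{4t}}\,I_{\lambda-\frac12}\!\left(\frac{xy}{2t}\right),\qquad P_t^\lambda(x,y)=\frac{t}{\sqrt{4\pi}}\int_0^\infty e^{-\frac{t^2}{4s}}\,W_s^\lambda(x,y)\,\frac{ds}{s^{3/2}}$$ be the heat and Poisson kernels of $\Delta_\lambda$, where $I_\nu(z)=\sum_{k\ge0}\frac{(z/2)^{2k+\nu}}{k!\,\Gamma(k+\nu+1)}$ is the modified Bessel function of the first kind, and put $$\phi_t^\lambda(y)=y^\lambda\left(\frac{y}{y+1}\right)^\lambda e^{-\frac{y^2}{4t}},\qquad \phi^\lambda(y)=\frac{y^{2\lambda}}{(y^2+1)^{\lambda+1}}.$$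 A weight is a measurable function $v:\mathbb{R}^+\to\mathbb{R}^+$. Let $D_p^{heat}(\Delta_\lambda)$ be the class of all weights $v$ such that for every real-valued $f\in L^p(\mathbb{R}^+,v\,dy)$ the integral $u(t,x)=\int_0^\infty W_t^\lambda(x,y)f(y)\,d\mu_\lambda(y)$ converges absolutely for all $t\in(0,T)$ and $x>0$, $u\in C^\infty((0,T)\times\mathbb{R}^+)$, $u_t=-\Delta_\lambda u$ on $(0,T)\times\mathbb{R}^+$, and $\lim_{t\to0^+}u(t,x)=f(x)$ for a.e. $x>0$. Let $D_p^{Poisson}(\Delta_\lambda)$ be the class defined in the same way with $P_t^\lambda$ in place of $W_t^\lambda$ and the equation $u_{tt}=\Delta_\lambda u$ in place of $u_t=-\Delta_\lambda u$. Then, for every weight $v$: 1. $v\in D_p^{heat}(\Delta_\lambda)$ if and only if $v^{-1/p}\phi_t^\lambda\in L^{p'}(\mathbb{R}^+,dy)$ for every $t\in(0,T)$; 2. $v\in D_p^{Poisson}(\Delta_\lambda)$ if and only if $v^{-1/p}\phi^\lambda\in L^{p'}(\mathbb{R}^+,dy)$. In particular, the second class does not depend on $T$; the case $T=\infty$ is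 the Poisson problem on $(0,\infty)\times\mathbb{R}^+$. -/

import Mathlib

open MeasureTheory Filter Set Topology
open scoped ENNReal ContDiff

noncomputable section

namespace Bessel

/-- The modified Bessel function of the first kind `I_ν(z)`, for `z > 0` and `ν > -1`. -/
def besselI (ν z : ℝ) : ℝ :=
  ∑' k : ℕ, (z / 2) ^ (2 * (k : ℝ) + ν) / ((k.factorial : ℝ) * Real.Gamma ((k : ℝ) + ν + 1))

/-- The Bessel operator `Δ_λ g = -g'' - (2λ/x) g'`. -/
def besselOp (lam : ℝ) (g : ℝ → ℝ) (x : ℝ) : ℝ :=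
  -(deriv (deriv g) x) - 2 * lam / x * deriv g x

/-- The heat kernel `W_t^λ(x, y)` of `Δ_λ`, for `t, x, y > 0`. -/
def heatKernel (lam t x y : ℝ) : ℝ :=
  (x * y) ^ (-lam + 1 / 2) / (2 * t) * Real.exp (-(x ^ 2 + y ^ 2) / (4 * t)) *
    besselI (lam - 1 / 2) (x * y / (2 * t))

/-- The Poisson kernel `P_t^λ(x, y)` of `Δ_λ`, for `t, x, y > 0`, that is, the kernel of
`exp (-t √Δ_λ)`, obtained from the heat kernel by subordination. -/
def poissonKernel (lam t x y : ℝ) : ℝ :=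
  t / √(4 * Real.pi) *
    ∫ s in Ioi (0 : ℝ), Real.exp (-t ^ 2 / (4 * s)) * heatKernel lam s x y / s ^ (3 / 2 : ℝ)

/-- The integral of `f` against a kernel `K_t(x, y)` with respect to `dμ_λ(y) = y^{2λ} dy`
on `(0, ∞)`. -/
def kernelIntegral (lam : ℝ) (K : ℝ → ℝ → ℝ → ℝ) (f : ℝ → ℝ) (t x : ℝ) : ℝ :=
  ∫ y in Ioi (0 : ℝ), K t x y * f y * y ^ (2 * lam)

/-- The time interval `(0, T)`, with `T = ⊤` allowed. -/
def timeInterval (T : EReal) : Set ℝ := {t | 0 < t ∧ (t : EReal) < T}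

/-- The integral of `f` against `K` converges absolutely at every point of `(0, T) × (0, ∞)`. -/
def AbsConv (lam : ℝ) (K : ℝ → ℝ → ℝ → ℝ) (T : EReal) (f : ℝ → ℝ) : Prop :=
  ∀ t ∈ timeInterval T, ∀ x : ℝ, 0 < x →
    IntegrableOn (fun y => K t x y * f y * y ^ (2 * lam)) (Ioi 0)

/-- `u` is `C^∞` on `(0, T) × (0, ∞)`. -/
def SmoothOn (T : EReal) (u : ℝ → ℝ → ℝ) : Prop :=
  ContDiffOn ℝ ∞ (fun q : ℝ × ℝ => u q.1 q.2) (timeInterval T ×ˢ Ioi (0 : ℝ))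

/-- `u` satisfies `u_t = -Δ_λ u` on `(0, T) × (0, ∞)`. -/
def HeatEq (lam : ℝ) (T : EReal) (u : ℝ → ℝ → ℝ) : Prop :=
  ∀ t ∈ timeInterval T, ∀ x : ℝ, 0 < x →
    deriv (fun s => u s x) t = -besselOp lam (u t) x

/-- `u` satisfies `u_tt = Δ_λ u` on `(0, T) × (0, ∞)`. -/
def PoissonEq (lam : ℝ) (T : EReal) (u : ℝ → ℝ → ℝ) : Prop :=
  ∀ t ∈ timeInterval T, ∀ x : ℝ, 0 < x →
    deriv (deriv (fun s => u s x)) t = besselOp lam (u t) x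

/-- `u(t, x) → f(x)` as `t → 0⁺`, for a.e. `x > 0`. -/
def HasInitialData (u : ℝ → ℝ → ℝ) (f : ℝ → ℝ) : Prop :=
  ∀ᵐ x ∂(volume.restrict (Ioi (0 : ℝ))), Tendsto (fun t => u t x) (𝓝[>] 0) (𝓝 (f x))

/-- A weight: a measurable function from `(0, ∞)` to `(0, ∞)`. Only the values on `(0, ∞)`
matter. -/
def IsWeight (v : ℝ → ℝ) : Prop :=
  AEMeasurable v (volume.restrict (Ioi (0 : ℝ))) ∧ ∀ y : ℝ, 0 < y → 0 < v y

/-- The measure `v(y) dy` on `(0, ∞)`. -/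
def weightMeasure (v : ℝ → ℝ) : Measure ℝ :=
  (volume.restrict (Ioi (0 : ℝ))).withDensity (fun y => ENNReal.ofReal (v y))

/-- The class `D_p^heat(Δ_λ)` on the time interval `(0, T)`. -/
def heatClass (lam : ℝ) (T : EReal) (p : ℝ≥0∞) : Set (ℝ → ℝ) :=
  {v | IsWeight v ∧ ∀ f : ℝ → ℝ, MemLp f p (weightMeasure v) →
    AbsConv lam (heatKernel lam) T f ∧
    SmoothOn T (kernelIntegral lam (heatKernel lam) f) ∧
    HeatEq lam T (kernelIntegral lam (heatKernel lam) f) ∧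
    HasInitialData (kernelIntegral lam (heatKernel lam) f) f}

/-- The class `D_p^Poisson(Δ_λ)` on the time interval `(0, T)`. -/
def poissonClass (lam : ℝ) (T : EReal) (p : ℝ≥0∞) : Set (ℝ → ℝ) :=
  {v | IsWeight v ∧ ∀ f : ℝ → ℝ, MemLp f p (weightMeasure v) →
    AbsConv lam (poissonKernel lam) T f ∧
    SmoothOn T (kernelIntegral lam (poissonKernel lam) f) ∧
    PoissonEq lam T (kernelIntegral lam (poissonKernel lam) f) ∧
    HasInitialData (kernelIntegral lam (poissonKernel lam) f) f}

/-- The integrability factor `φ_t^λ` of the heat problem. -/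
def heatFactor (lam t y : ℝ) : ℝ :=
  y ^ lam * (y / (y + 1)) ^ lam * Real.exp (-y ^ 2 / (4 * t))

/-- The integrability factor `φ^λ` of the Poisson problem. -/
def poissonFactor (lam y : ℝ) : ℝ :=
  y ^ (2 * lam) / (y ^ 2 + 1) ^ (lam + 1)

end Bessel

end

/-!
The Poisson integral representation writes `I_{λ-1/2}` as an average of `e^{zs}` over a probability
measure on `[-1, 1]`. It turns both kernels into averages over `s` of explicit functions: an
exponential `e^{-a y² + b s y}` for the heat kernel, and, after integrating in the time of the
subordination, a power `(a + y² - b s y)^{-λ-1}` for the Poisson kernel, where `(a, b)` depends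
smoothly on `(t, x)`. Two-sided kernel bounds follow, and they show that absolute convergence of the
integral is equivalent to integrability of `f` against `φ_t^λ`, respectively `φ^λ`. Conversely, that
integrability dominates all `(a, b)`-derivatives, so that the extension is smooth; the equation
reduces to an integration by parts in `s`, and the initial data is attained at every Lebesgue point
of `f`. By the duality of `L^p` and `L^{p'}`, integrability for all `f ∈ L^p(v)` is the condition on
`v^{-1/p} φ`.
-/

namespace Bessel

section PartialDerivFamily

/-- `G j k` is the mixed partial derivative `∂₁ʲ ∂₂ᵏ (G 0 0)` on `U`, for all `j` and `k`. The
condition is recorded as total differentiability of each `G j k`, with partial derivatives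
`G (j + 1) k` and `G j (k + 1)`. -/
def IsPartialDerivFamily (G : ℕ → ℕ → ℝ × ℝ → ℝ) (U : Set (ℝ × ℝ)) : Prop :=
  ∀ j k, ∀ q ∈ U, HasFDerivAt (G j k)
    (G (j + 1) k q • ContinuousLinearMap.fst ℝ ℝ ℝ
      + G j (k + 1) q • ContinuousLinearMap.snd ℝ ℝ ℝ) q

variable {U : Set (ℝ × ℝ)}

theorem IsPartialDerivFamily.contDiffOn {G : ℕ → ℕ → ℝ × ℝ → ℝ} (hG : IsPartialDerivFamily G U)
    (hU : IsOpen U) (j k : ℕ) : ContDiffOn ℝ ∞ (G j k) U := by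
  rw [contDiffOn_infty]
  intro n
  induction n generalizing j k with
  | zero => exact contDiffOn_zero.2 fun q hq => (hG j k q hq).continuousAt.continuousWithinAt
  | succ n ih =>
    push_cast
    rw [contDiffOn_succ_iff_fderiv_of_isOpen hU]
    refine ⟨fun q hq => (hG j k q hq).differentiableAt.differentiableWithinAt, by simp, ?_⟩
    exact (((ih _ _).smul contDiffOn_const).add ((ih _ _).smul contDiffOn_const)).congr
      fun q hq => (hG j k q hq).fderiv

theorem IsPartialDerivFamily.hasDerivAt_comp {G : ℕ → ℕ → ℝ × ℝ → ℝ}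
    (hG : IsPartialDerivFamily G U) (j k : ℕ) {a b : ℝ → ℝ} {a' b' t : ℝ} (hU : (a t, b t) ∈ U)
    (ha : HasDerivAt a a' t) (hb : HasDerivAt b b' t) :
    HasDerivAt (fun t => G j k (a t, b t))
      (G (j + 1) k (a t, b t) * a' + G j (k + 1) (a t, b t) * b') t :=
  ((hG j k _ hU).comp_hasDerivAt t (ha.prodMk hb)).congr_deriv (by simp)

theorem norm_smul_fst_add_smul_snd_le (a b : ℝ) :
    ‖a • ContinuousLinearMap.fst ℝ ℝ ℝ + b • ContinuousLinearMap.snd ℝ ℝ ℝ‖ ≤ |a| + |b| := by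
  refine (norm_add_le _ _).trans (add_le_add ?_ ?_) <;> rw [norm_smul, Real.norm_eq_abs]
  · exact mul_le_of_le_one_right (abs_nonneg a) (ContinuousLinearMap.norm_fst_le ℝ ℝ ℝ)
  · exact mul_le_of_le_one_right (abs_nonneg b) (ContinuousLinearMap.norm_snd_le ℝ ℝ ℝ)

theorem isPartialDerivFamily_integral {Ω : Type*} [MeasurableSpace Ω] {μ : Measure Ω}
    (hU : IsOpen U) {F : Ω → ℕ → ℕ → ℝ × ℝ → ℝ}
    (hmeas : ∀ j k, ∀ q ∈ U, AEStronglyMeasurable (fun w => F w j k q) μ)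
    (hderiv : ∀ᵐ w ∂μ, IsPartialDerivFamily (F w) U)
    (hdom : ∀ j k, ∀ q ∈ U, ∃ V ∈ 𝓝 q, ∃ bound : Ω → ℝ, Integrable bound μ ∧
      ∀ᵐ w ∂μ, ∀ q' ∈ V, |F w j k q'| ≤ bound w) :
    IsPartialDerivFamily (fun j k q => ∫ w, F w j k q ∂μ) U := by
  intro j k q hq
  have hint (j k : ℕ) : Integrable (fun w => F w j k q) μ := by
    obtain ⟨V, hV, bound, hbound, hle⟩ := hdom j k q hq
    refine hbound.mono' (hmeas j k q hq) ?_
    filter_upwards [hle] with w hw using hw q (mem_of_mem_nhds hV)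
  have hint₁ := (hint (j + 1) k).smul_const (ContinuousLinearMap.fst ℝ ℝ ℝ)
  have hint₂ := (hint j (k + 1)).smul_const (ContinuousLinearMap.snd ℝ ℝ ℝ)
  obtain ⟨V₁, hV₁, bound₁, hbound₁, hle₁⟩ := hdom (j + 1) k q hq
  obtain ⟨V₂, hV₂, bound₂, hbound₂, hle₂⟩ := hdom j (k + 1) q hq
  refine (hasFDerivAt_integral_of_dominated_of_fderiv_le
    (F' := fun q w => F w (j + 1) k q • ContinuousLinearMap.fst ℝ ℝ ℝ
      + F w j (k + 1) q • ContinuousLinearMap.snd ℝ ℝ ℝ)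
    (s := V₁ ∩ V₂ ∩ U) (bound := fun w => bound₁ w + bound₂ w)
    (inter_mem (inter_mem hV₁ hV₂) (hU.mem_nhds hq))
    (by filter_upwards [hU.mem_nhds hq] with q' hq' using hmeas j k q' hq')
    (hint j k) (hint₁.add hint₂).aestronglyMeasurable ?_ (hbound₁.add hbound₂) ?_).congr_fderiv
    ((integral_add hint₁ hint₂).trans
      (congrArg₂ _ (integral_smul_const _ _) (integral_smul_const _ _)))
  · filter_upwards [hle₁, hle₂] with w hw₁ hw₂ q' hq'
    exact (norm_smul_fst_add_smul_snd_le _ _).trans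
      (add_le_add (hw₁ q' hq'.1.1) (hw₂ q' hq'.1.2))
  · filter_upwards [hderiv] with w hw q' hq' using hw j k q' hq'.2

end PartialDerivFamily

section HolderConverse

theorem rpow_inv_le_of_le_mul_rpow_inv {a b A C : ℝ} (hab : a.HolderConjugate b) (hA : 0 ≤ A)
    (hC : 0 ≤ C) (h : A ≤ C * A ^ a⁻¹) : A ^ b⁻¹ ≤ C := by
  rcases hA.eq_or_lt with rfl | hA
  · rwa [Real.zero_rpow (inv_ne_zero hab.symm.ne_zero)]
  · refine le_of_mul_le_mul_right ?_ (Real.rpow_pos_of_pos hA a⁻¹)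
    rwa [← Real.rpow_add hA, add_comm, hab.inv_add_inv_eq_one, Real.rpow_one]

variable {α : Type*} [MeasurableSpace α] {μ : Measure α} {p q : ℝ≥0∞} {g : α → ℝ} {C : ℝ}

theorem ae_le_of_forall_integral_mul_le [IsFiniteMeasure μ] (hg : Integrable g μ)
    (hC : ∀ f : α → ℝ, MemLp f 1 μ → ∫ x, g x * f x ∂μ ≤ C * (eLpNorm f 1 μ).toReal) :
    ∀ᵐ x ∂μ, g x ≤ C := by
  refine ae_le_of_forall_setIntegral_le hg (integrable_const C) fun s hs _ => ?_
  have hind := hC (s.indicator 1) (memLp_indicator_const 1 hs 1 (Or.inr (measure_ne_top _ _)))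
  have hleft : ∫ x, g x * s.indicator 1 x ∂μ = ∫ x in s, g x ∂μ := by
    rw [← integral_indicator hs]
    congr 1 with x
    by_cases hx : x ∈ s <;> simp [hx]
  have hright : (eLpNorm (s.indicator (1 : α → ℝ)) 1 μ).toReal = μ.real s := by
    rw [Pi.one_def, eLpNorm_indicator_const hs one_ne_zero ENNReal.one_ne_top]
    simp [measureReal_def]
  rwa [hleft, hright, mul_comm, ← smul_eq_mul, ← setIntegral_const] at hind

/-- The extremal test function in Hölder's inequality for `g` is `g ^ (q - 1)`. -/
theorem eLpNorm_le_of_forall_integral_mul_le_of_ne_top [IsFiniteMeasure μ]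
    [p.HolderConjugate q] (hp : p ≠ ⊤) (hq : q ≠ ⊤) (hg : Measurable g) (hg0 : ∀ x, 0 ≤ g x)
    {N : ℝ} (hN : ∀ᵐ x ∂μ, g x ≤ N) (hC0 : 0 ≤ C)
    (hC : ∀ f : α → ℝ, MemLp f p μ → ∫ x, g x * f x ∂μ ≤ C * (eLpNorm f p μ).toReal) :
    eLpNorm g q μ ≤ ENNReal.ofReal C := by
  have hpq := ENNReal.HolderConjugate.toReal_of_ne_top (p := p) (q := q) hp hq
  set a := p.toReal with ha
  set b := q.toReal with hb
  have hg_norm (x : α) (r : ℝ) : ‖g x ^ r‖ = g x ^ r :=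
    Real.norm_of_nonneg (Real.rpow_nonneg (hg0 x) r)
  have htest : MemLp (fun x => g x ^ (b - 1)) p μ := by
    refine MemLp.of_bound (hg.pow_const _).aestronglyMeasurable (N ^ (b - 1)) ?_
    filter_upwards [hN] with x hx
    rw [hg_norm]
    exact Real.rpow_le_rpow (hg0 x) hx hpq.symm.sub_one_pos.le
  have hg_memLp : MemLp g q μ := by
    refine MemLp.of_bound hg.aestronglyMeasurable N ?_
    filter_upwards [hN] with x hx
    rwa [Real.norm_of_nonneg (hg0 x)]
  have hpairing : ∫ x, g x * g x ^ (b - 1) ∂μ = ∫ x, g x ^ b ∂μ := by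
    congr 1 with x
    rw [mul_comm, ← Real.rpow_add_one' (hg0 x) (by simpa using hpq.symm.ne_zero), sub_add_cancel]
  have htest_norm : (eLpNorm (fun x => g x ^ (b - 1)) p μ).toReal = (∫ x, g x ^ b ∂μ) ^ a⁻¹ := by
    rw [htest.eLpNorm_eq_integral_rpow_norm (ENNReal.HolderConjugate.ne_zero p q) hp,
      ENNReal.toReal_ofReal (by positivity)]
    simp only [hg_norm, ← Real.rpow_mul (hg0 _), ← ha, hpq.symm.sub_one_mul_conj]
  rw [hg_memLp.eLpNorm_eq_integral_rpow_norm (ENNReal.HolderConjugate.ne_zero q p) hq, ← hb]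
  simp only [Real.norm_of_nonneg (hg0 _)]
  refine ENNReal.ofReal_le_ofReal (rpow_inv_le_of_le_mul_rpow_inv hpq
    (integral_nonneg fun x => Real.rpow_nonneg (hg0 x) b) hC0 ?_)
  simpa only [hpairing, htest_norm] using hC _ htest

theorem eLpNorm_le_of_forall_integral_mul_le [IsFiniteMeasure μ] [p.HolderConjugate q]
    (hp : p ≠ ⊤) (hg : Measurable g) (hg0 : ∀ x, 0 ≤ g x) {N : ℝ} (hN : ∀ᵐ x ∂μ, g x ≤ N)
    (hC0 : 0 ≤ C)
    (hC : ∀ f : α → ℝ, MemLp f p μ → ∫ x, g x * f x ∂μ ≤ C * (eLpNorm f p μ).toReal) :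
    eLpNorm g q μ ≤ ENNReal.ofReal C := by
  by_cases hq : q = ⊤
  · obtain rfl : p = 1 := (ENNReal.HolderConjugate.eq_top_iff_eq_one q p).1 hq
    subst hq
    have hg_int : Integrable g μ := by
      refine Integrable.of_bound hg.aestronglyMeasurable N ?_
      filter_upwards [hN] with x hx
      rwa [Real.norm_of_nonneg (hg0 x)]
    rw [eLpNorm_exponent_top]
    refine eLpNormEssSup_le_of_ae_bound ?_
    filter_upwards [ae_le_of_forall_integral_mul_le hg_int hC] with x hx
    rwa [Real.norm_of_nonneg (hg0 x)]
  · exact eLpNorm_le_of_forall_integral_mul_le_of_ne_top hp hq hg hg0 hN hC0 hC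

/-- The sets on which `g` is truncated: there `g` is at most `n`, and the measure is finite. They
increase to the whole space. -/
def truncationSet (μ : Measure α) [SigmaFinite μ] (g : α → ℝ) (n : ℕ) : Set α :=
  {x | g x ≤ n} ∩ spanningSets μ n

variable [SigmaFinite μ]

theorem measurableSet_truncationSet (hg : Measurable g) (n : ℕ) :
    MeasurableSet (truncationSet μ g n) :=
  (measurableSet_le hg measurable_const).inter (measurableSet_spanningSets μ n)

theorem isFiniteMeasure_restrict_truncationSet (n : ℕ) :
    IsFiniteMeasure (μ.restrict (truncationSet μ g n)) :=
  ⟨by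
    rw [Measure.restrict_apply_univ]
    exact (measure_mono inter_subset_right).trans_lt (measure_spanningSets_lt_top μ n)⟩

theorem eventually_mem_truncationSet (μ : Measure α) [SigmaFinite μ] (g : α → ℝ) (x : α) :
    ∀ᶠ n in atTop, x ∈ truncationSet μ g n := by
  obtain ⟨k, hk⟩ := exists_nat_ge (g x)
  filter_upwards [eventually_ge_atTop k, eventually_ge_atTop (spanningSetsIndex μ x)]
    with n hkn hn
  exact ⟨hk.trans (by exact_mod_cast hkn), mem_spanningSets_of_index_le μ x hn⟩

theorem memLp_indicator_truncationSet (hg : Measurable g) (hg0 : ∀ x, 0 ≤ g x) (n : ℕ) :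
    MemLp ((truncationSet μ g n).indicator g) q μ := by
  have := isFiniteMeasure_restrict_truncationSet (μ := μ) (g := g) n
  rw [memLp_indicator_iff_restrict (measurableSet_truncationSet hg n)]
  refine MemLp.of_bound hg.aestronglyMeasurable n ?_
  filter_upwards [ae_restrict_mem (measurableSet_truncationSet hg n)] with x hx
  rw [Real.norm_of_nonneg (hg0 x)]
  exact hx.1

theorem eLpNorm_le_of_forall_eLpNorm_indicator_truncationSet_le (hg : Measurable g) {B : ℝ≥0∞}
    (hB : ∀ n, eLpNorm ((truncationSet μ g n).indicator g) q μ ≤ B) : eLpNorm g q μ ≤ B := by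
  have hlim (x : α) :
      Tendsto (fun n => (truncationSet μ g n).indicator g x) atTop (𝓝 (g x)) := by
    refine tendsto_const_nhds.congr' ?_
    filter_upwards [eventually_mem_truncationSet μ g x] with n hn
    rw [indicator_of_mem hn]
  refine (Lp.eLpNorm_lim_le_liminf_eLpNorm
    (fun n => (hg.indicator (measurableSet_truncationSet hg n)).aestronglyMeasurable) g
    (Eventually.of_forall hlim)).trans ?_
  exact liminf_le_of_le (by isBoundedDefault) fun b hb =>
    hb.exists.elim fun n hn => hn.trans (hB n)

/-- Banach–Steinhaus, applied to the functionals `f ↦ ∫ g f` over the truncation sets. -/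
theorem exists_forall_setIntegral_truncationSet_mul_le [p.HolderConjugate q] (hg : Measurable g)
    (hg0 : ∀ x, 0 ≤ g x) (h : ∀ f : α → ℝ, MemLp f p μ → Integrable (fun x => g x * f x) μ) :
    ∃ C, 0 ≤ C ∧ ∀ n (f : α → ℝ), MemLp f p μ →
      ∫ x in truncationSet μ g n, g x * f x ∂μ ≤ C * (eLpNorm f p μ).toReal := by
  have : Fact (1 ≤ p) := ⟨ENNReal.HolderConjugate.one_le p q⟩
  have : Fact (1 ≤ q) := ⟨ENNReal.HolderConjugate.one_le q p⟩
  have hgn (n : ℕ) := memLp_indicator_truncationSet (μ := μ) (q := q) hg hg0 n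
  let pairing (n : ℕ) : Lp ℝ p μ →L[ℝ] ℝ :=
    (ContinuousLinearMap.mul ℝ ℝ).lpPairing μ q p (hgn n).toLp
  have pairing_apply (n : ℕ) (f : Lp ℝ p μ) :
      pairing n f = ∫ x in truncationSet μ g n, g x * f x ∂μ := by
    rw [ContinuousLinearMap.lpPairing_eq_integral,
      ← integral_indicator (measurableSet_truncationSet hg n)]
    refine integral_congr_ae ?_
    filter_upwards [(hgn n).coeFn_toLp] with x hx
    by_cases hxn : x ∈ truncationSet μ g n <;> simp [hx, hxn]
  obtain ⟨C, hC⟩ := banach_steinhaus (g := pairing) fun f =>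
    ⟨∫ x, |g x * f x| ∂μ, fun n => by
      rw [pairing_apply, Real.norm_eq_abs]
      exact abs_integral_le_integral_abs.trans (setIntegral_le_integral (h f (Lp.memLp f)).abs
        (Eventually.of_forall fun x => abs_nonneg _))⟩
  refine ⟨C, (norm_nonneg _).trans (hC 0), fun n f hf => ?_⟩
  calc ∫ x in truncationSet μ g n, g x * f x ∂μ = pairing n hf.toLp := by
        rw [pairing_apply]
        refine integral_congr_ae ?_
        filter_upwards [ae_restrict_of_ae hf.coeFn_toLp] with x hx
        rw [hx]
    _ ≤ ‖pairing n‖ * ‖hf.toLp‖ := (le_abs_self _).trans ((pairing n).le_opNorm _)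
    _ ≤ C * (eLpNorm f p μ).toReal := by
        rw [Lp.norm_toLp]
        exact mul_le_mul_of_nonneg_right (hC n) ENNReal.toReal_nonneg

theorem memLp_of_forall_integrable_mul_of_nonneg [p.HolderConjugate q] (hp : p ≠ ⊤)
    (hg : Measurable g) (hg0 : ∀ x, 0 ≤ g x)
    (h : ∀ f : α → ℝ, MemLp f p μ → Integrable (fun x => g x * f x) μ) : MemLp g q μ := by
  obtain ⟨C, hC0, hC⟩ := exists_forall_setIntegral_truncationSet_mul_le (q := q) hg hg0 h
  refine ⟨hg.aestronglyMeasurable, lt_of_le_of_lt ?_ (ENNReal.ofReal_lt_top (r := C))⟩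
  refine eLpNorm_le_of_forall_eLpNorm_indicator_truncationSet_le hg fun n => ?_
  have hE := measurableSet_truncationSet (μ := μ) hg n
  have := isFiniteMeasure_restrict_truncationSet (μ := μ) (g := g) n
  rw [eLpNorm_indicator_eq_eLpNorm_restrict hE]
  refine eLpNorm_le_of_forall_integral_mul_le (N := n) hp hg hg0 ?_ hC0 fun f hf => ?_
  · filter_upwards [ae_restrict_mem hE] with x hx using hx.1
  · have hind := hC n _ ((memLp_indicator_iff_restrict hE).2 hf)
    rw [eLpNorm_indicator_eq_eLpNorm_restrict hE] at hind
    refine (setIntegral_congr_fun hE fun x hx => ?_).trans_le hind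
    simp only [indicator_of_mem hx]

theorem memLp_of_forall_integrable_mul [p.HolderConjugate q] (hp : p ≠ ⊤)
    (hg : AEStronglyMeasurable g μ)
    (h : ∀ f : α → ℝ, MemLp f p μ → Integrable (fun x => g x * f x) μ) : MemLp g q μ := by
  obtain ⟨g', hg', hgg'⟩ := hg
  refine (memLp_congr_ae hgg').2 ?_
  suffices habs : MemLp (fun x => |g' x|) q μ from
    habs.of_le hg'.aestronglyMeasurable (Eventually.of_forall fun x => by simp)
  refine memLp_of_forall_integrable_mul_of_nonneg hp hg'.measurable.norm (fun x => abs_nonneg _)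
    fun f hf => (h f hf).norm.mono' (hg'.norm.aestronglyMeasurable.mul hf.1) ?_
  filter_upwards [hgg'] with x hx
  simp [hx]

end HolderConverse

section Weight

variable {v : ℝ → ℝ} {p : ℝ≥0∞}

theorem aestronglyMeasurable_weightMeasure_iff (hv : IsWeight v) {f : ℝ → ℝ} :
    AEStronglyMeasurable f (weightMeasure v) ↔
      AEStronglyMeasurable f (volume.restrict (Ioi (0 : ℝ))) := by
  refine ⟨fun h => h.mono_ac ?_, fun h => h.mono_ac (withDensity_absolutelyContinuous _ _)⟩
  refine withDensity_absolutelyContinuous' hv.1.ennreal_ofReal ?_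
  filter_upwards [ae_restrict_mem measurableSet_Ioi] with y hy
  simpa using hv.2 y hy

theorem aestronglyMeasurable_weight_rpow (hv : IsWeight v) (a : ℝ) :
    AEStronglyMeasurable (fun y => v y ^ a) (volume.restrict (Ioi (0 : ℝ))) :=
  (hv.1.pow_const a).aestronglyMeasurable

theorem eLpNorm_weightMeasure (hv : IsWeight v) (hp0 : p ≠ 0) (hp : p ≠ ⊤) {f : ℝ → ℝ}
    (hf : AEStronglyMeasurable f (volume.restrict (Ioi (0 : ℝ)))) :
    eLpNorm f p (weightMeasure v) =
      eLpNorm (fun y => v y ^ (1 / p.toReal) * f y) p (volume.restrict (Ioi (0 : ℝ))) := by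
  have hP : 0 < p.toReal := ENNReal.toReal_pos hp0 hp
  rw [eLpNorm_eq_lintegral_rpow_enorm_toReal hp0 hp, eLpNorm_eq_lintegral_rpow_enorm_toReal hp0 hp,
    weightMeasure, lintegral_withDensity_eq_lintegral_mul₀ hv.1.ennreal_ofReal
      (hf.enorm.pow_const _)]
  congr 1
  refine setLIntegral_congr_fun measurableSet_Ioi fun y hy => ?_
  have hvy := hv.2 y hy
  have hvy_rpow : 0 < v y ^ (1 / p.toReal) := Real.rpow_pos_of_pos hvy _
  rw [Pi.mul_apply, enorm_mul, ENNReal.mul_rpow_of_nonneg _ _ hP.le,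
    Real.enorm_of_nonneg hvy_rpow.le, ENNReal.ofReal_rpow_of_nonneg hvy_rpow.le hP.le,
    ← Real.rpow_mul hvy.le, one_div_mul_cancel hP.ne', Real.rpow_one]

theorem memLp_weightMeasure_iff (hv : IsWeight v) (hp0 : p ≠ 0) (hp : p ≠ ⊤) {f : ℝ → ℝ}
    (hf : AEStronglyMeasurable f (volume.restrict (Ioi (0 : ℝ)))) :
    MemLp f p (weightMeasure v) ↔
      MemLp (fun y => v y ^ (1 / p.toReal) * f y) p (volume.restrict (Ioi (0 : ℝ))) := by
  rw [MemLp, MemLp, eLpNorm_weightMeasure hv hp0 hp hf, aestronglyMeasurable_weightMeasure_iff hv]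
  exact and_congr_left fun _ =>
    ⟨fun _ => (aestronglyMeasurable_weight_rpow hv _).mul hf, fun _ => hf⟩

theorem memLp_weight_rpow_neg_mul_iff (hv : IsWeight v) (hp1 : 1 ≤ p) (hp : p ≠ ⊤) {φ : ℝ → ℝ}
    (hφ : AEStronglyMeasurable φ (volume.restrict (Ioi (0 : ℝ)))) :
    MemLp (fun y => v y ^ (-(1 / p.toReal)) * φ y) p.conjExponent
        (volume.restrict (Ioi (0 : ℝ))) ↔
      ∀ f, MemLp f p (weightMeasure v) → IntegrableOn (fun y => φ y * f y) (Ioi 0) := by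
  have hp0 : p ≠ 0 := (one_pos.trans_le hp1).ne'
  have := ENNReal.HolderConjugate.conjExponent hp1
  have hweight := aestronglyMeasurable_weight_rpow hv (-(1 / p.toReal))
  have hcancel : ∀ y ∈ Ioi (0 : ℝ), v y ^ (1 / p.toReal) * v y ^ (-(1 / p.toReal)) = 1 :=
    fun y hy => by rw [← Real.rpow_add (hv.2 y hy), add_neg_cancel, Real.rpow_zero]
  constructor
  · intro hφv f hf
    have hfv := (memLp_weightMeasure_iff hv hp0 hp
      ((aestronglyMeasurable_weightMeasure_iff hv).1 hf.1)).1 hf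
    refine IntegrableOn.congr_fun (s := Ioi 0) (hfv.integrable_mul hφv) (fun y hy => ?_)
      measurableSet_Ioi
    simp only [Pi.mul_apply]
    linear_combination (f y * φ y) * hcancel y hy
  · intro h
    refine memLp_of_forall_integrable_mul hp (hweight.mul hφ) fun g hg => ?_
    have hgv : MemLp (fun y => v y ^ (-(1 / p.toReal)) * g y) p (weightMeasure v) := by
      refine (memLp_weightMeasure_iff hv hp0 hp (hweight.mul hg.1)).2 (hg.ae_eq ?_)
      filter_upwards [ae_restrict_mem measurableSet_Ioi] with y hy
      rw [Pi.mul_apply, ← mul_assoc, hcancel y hy, one_mul]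
    refine (h _ hgv).congr_fun (fun y _ => ?_) measurableSet_Ioi
    simp only
    ring

end Weight

/-- The Poisson kernel `τ / (τ² + r²)` of the half-plane, not normalised. It majorises the kernels
treated here near the diagonal. -/
noncomputable def poissonProfile (τ r : ℝ) : ℝ :=
  τ / (τ ^ 2 + r ^ 2)

theorem poissonProfile_le_inv {τ : ℝ} (hτ : 0 < τ) (r : ℝ) : poissonProfile τ r ≤ 1 / τ := by
  rw [poissonProfile, div_le_div_iff₀ (by positivity) hτ]
  nlinarith [sq_nonneg r]

theorem poissonProfile_le_of_two_pow_mul_le {τ r : ℝ} (hτ : 0 < τ) {k : ℕ} (hr : 2 ^ k * τ ≤ r) :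
    poissonProfile τ r ≤ (1 / 4) ^ k / τ := by
  have hr_sq : 4 ^ k * τ ^ 2 ≤ r ^ 2 := by
    calc (4 : ℝ) ^ k * τ ^ 2 = (2 ^ k * τ) ^ 2 := by
          rw [mul_pow, ← pow_mul, mul_comm k 2, pow_mul]; norm_num
      _ ≤ r ^ 2 := by gcongr
  rw [poissonProfile, one_div_pow, div_div, div_le_div_iff₀ (by positivity) (by positivity)]
  nlinarith [sq_nonneg τ]

theorem poissonProfile_le_tsum {τ : ℝ} (hτ : 0 < τ) (r : ℝ) :
    ENNReal.ofReal (poissonProfile τ r) ≤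
      ∑' k : ℕ, ENNReal.ofReal (4 * (1 / 4) ^ k / τ) * (Iic (2 ^ k * τ)).indicator 1 r := by
  suffices ∃ k : ℕ, r ∈ Iic (2 ^ k * τ) ∧ poissonProfile τ r ≤ 4 * (1 / 4) ^ k / τ by
    obtain ⟨k, hrk, hle⟩ := this
    refine le_trans ?_ (ENNReal.le_tsum k)
    rw [indicator_of_mem hrk, Pi.one_apply, mul_one]
    exact ENNReal.ofReal_le_ofReal hle
  rcases le_or_gt r τ with hrτ | hτr
  · refine ⟨0, by simpa using hrτ, (poissonProfile_le_inv hτ r).trans ?_⟩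
    gcongr
    norm_num
  · obtain ⟨k, hkr, hrk⟩ := exists_nat_pow_near ((one_le_div hτ).2 hτr.le) one_lt_two
    rw [le_div_iff₀ hτ] at hkr
    rw [div_lt_iff₀ hτ] at hrk
    refine ⟨k + 1, hrk.le, (poissonProfile_le_of_two_pow_mul_le hτ hkr).trans_eq ?_⟩
    ring

theorem setLIntegral_closedBall_indicator_le {h : ℝ → ℝ≥0∞} {x δ ε r : ℝ} (hδ : 0 < δ)
    (hε : 0 ≤ ε) (hr : 0 < r)
    (hle : ∀ r, 0 < r → r ≤ δ → ∫⁻ y in Metric.closedBall x r, h y ≤ ENNReal.ofReal (ε * r)) :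
    ∫⁻ y in Metric.closedBall x δ, h y * (Iic r).indicator 1 |y - x| ≤ ENNReal.ofReal (ε * r) := by
  have hball := Metric.isClosed_closedBall (x := x) (ε := r).measurableSet
  calc ∫⁻ y in Metric.closedBall x δ, h y * (Iic r).indicator 1 |y - x|
      = ∫⁻ y in Metric.closedBall x δ, (Metric.closedBall x r).indicator h y := by
        refine lintegral_congr fun y => ?_
        classical simp [indicator_apply, Metric.mem_closedBall, Real.dist_eq]
    _ = ∫⁻ y in Metric.closedBall x (min r δ), h y := by
        rw [lintegral_indicator hball, Measure.restrict_restrict hball]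
        congr 2
        ext y
        simp [Metric.mem_closedBall]
    _ ≤ ENNReal.ofReal (ε * r) := by
        refine (hle _ (lt_min hr hδ) (min_le_right _ _)).trans ?_
        gcongr
        exact min_le_left _ _

/- The profile is split over the dyadic balls of radius `2 ^ k * τ`, whose contributions decay
geometrically. -/
theorem setLIntegral_closedBall_mul_poissonProfile_le {h : ℝ → ℝ≥0∞} {x δ ε τ : ℝ}
    (hδ : 0 < δ) (hε : 0 ≤ ε) (hτ : 0 < τ)
    (hh : AEMeasurable h (volume.restrict (Metric.closedBall x δ)))
    (hle : ∀ r, 0 < r → r ≤ δ → ∫⁻ y in Metric.closedBall x r, h y ≤ ENNReal.ofReal (ε * r)) :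
    ∫⁻ y in Metric.closedBall x δ, h y * ENNReal.ofReal (poissonProfile τ (y - x)) ≤
      ENNReal.ofReal (8 * ε) := by
  have hmeas : ∀ k : ℕ, Measurable fun y : ℝ =>
      (Iic (2 ^ k * τ)).indicator (1 : ℝ → ℝ≥0∞) |y - x| := fun k =>
    (measurable_one.indicator measurableSet_Iic).comp
      (measurable_norm.comp (measurable_sub_const x))
  calc ∫⁻ y in Metric.closedBall x δ, h y * ENNReal.ofReal (poissonProfile τ (y - x))
      ≤ ∫⁻ y in Metric.closedBall x δ, ∑' k : ℕ, ENNReal.ofReal (4 * (1 / 4) ^ k / τ) *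
          (h y * (Iic (2 ^ k * τ)).indicator 1 |y - x|) := by
        refine lintegral_mono fun y => ?_
        simp only [mul_left_comm _ (h y)]
        rw [ENNReal.tsum_mul_left, poissonProfile, ← sq_abs (y - x)]
        gcongr
        exact poissonProfile_le_tsum hτ _
    _ = ∑' k : ℕ, ENNReal.ofReal (4 * (1 / 4) ^ k / τ) *
          ∫⁻ y in Metric.closedBall x δ, h y * (Iic (2 ^ k * τ)).indicator 1 |y - x| := by
        rw [lintegral_tsum fun k =>
          (show AEMeasurable (fun y => h y * _) _ from hh.mul (hmeas k).aemeasurable).const_mul _]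
        simp only [lintegral_const_mul' _ _ ENNReal.ofReal_ne_top]
    _ ≤ ∑' k : ℕ, ENNReal.ofReal (4 * (1 / 4) ^ k / τ) * ENNReal.ofReal (ε * (2 ^ k * τ)) := by
        gcongr with k
        exact setLIntegral_closedBall_indicator_le hδ hε (by positivity) hle
    _ = ∑' k : ℕ, ENNReal.ofReal (4 * ε * (1 / 2) ^ k) := by
        refine tsum_congr fun k => ?_
        have hpow : (1 / 4 : ℝ) ^ k * 2 ^ k = (1 / 2) ^ k := by rw [← mul_pow]; norm_num
        rw [← ENNReal.ofReal_mul (by positivity), ← hpow]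
        congr 1
        field_simp
    _ = ENNReal.ofReal (8 * ε) := by
        rw [← ENNReal.ofReal_tsum_of_nonneg (fun k => by positivity)
          (summable_geometric_two.mul_left _), tsum_mul_left, tsum_geometric_two]
        ring_nf

/-- `x` is a Lebesgue point of `f`: the averages of `|f - f x|` over the balls centred at `x`
tend to `0` with the radius. -/
def IsLebesguePoint (f : ℝ → ℝ) (x : ℝ) : Prop :=
  ∀ ε > 0, ∀ᶠ r in 𝓝[>] (0 : ℝ),
    ∫⁻ y in Metric.closedBall x r, ‖f y - f x‖ₑ ≤ ENNReal.ofReal (ε * r)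

theorem IsLebesguePoint.congr {f g : ℝ → ℝ} {x : ℝ} (hf : IsLebesguePoint f x)
    (hfg : f =ᶠ[𝓝 x] g) : IsLebesguePoint g x := by
  intro ε hε
  obtain ⟨δ, hδ, hball⟩ := Metric.nhds_basis_closedBall.mem_iff.1 hfg
  filter_upwards [hf ε hε, Ioc_mem_nhdsGT hδ] with r hr hrδ
  refine (setLIntegral_congr_fun Metric.isClosed_closedBall.measurableSet
    fun y hy => ?_).trans_le hr
  have hfgy : f y = g y := hball (Metric.closedBall_subset_closedBall hrδ.2 hy)
  simp only [hfgy, hfg.eq_of_nhds]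

theorem ae_isLebesguePoint {f : ℝ → ℝ} (hf : LocallyIntegrable f) :
    ∀ᵐ x, IsLebesguePoint f x := by
  filter_upwards [IsUnifLocDoublingMeasure.ae_tendsto_average_norm_sub volume hf 1] with x hx ε hε
  have haverage := hx (fun _ : ℝ => x) id tendsto_id (by
    filter_upwards [self_mem_nhdsWithin] with r hr
    simpa using le_of_lt hr)
  filter_upwards [haverage.eventually_lt_const (half_pos hε), self_mem_nhdsWithin] with r hr hr0
  have hr0 : 0 < r := hr0
  have hint : IntegrableOn (fun y => f y - f x) (Metric.closedBall x r) :=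
    (hf.integrableOn_isCompact (isCompact_closedBall x r)).sub
      (integrableOn_const measure_closedBall_lt_top.ne)
  rw [← ofReal_integral_norm_eq_lintegral_enorm hint]
  refine ENNReal.ofReal_le_ofReal ?_
  rw [id, setAverage_eq, measureReal_def, Real.volume_closedBall,
    ENNReal.toReal_ofReal (by positivity), smul_eq_mul, inv_mul_lt_iff₀ (by positivity)] at hr
  linarith

theorem ae_restrict_isLebesguePoint {f : ℝ → ℝ} {U : Set ℝ} (hU : IsOpen U)
    (hf : LocallyIntegrableOn f U) : ∀ᵐ x ∂(volume.restrict U), IsLebesguePoint f x := by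
  obtain ⟨V, hV, hUV, hfV⟩ := hf.exists_nat_integrableOn
  have hlebesgue : ∀ᵐ x, ∀ n, IsLebesguePoint ((V n ∩ U).indicator f) x := ae_all_iff.2 fun n =>
    ae_isLebesguePoint (integrable_indicator_iff
      ((hV n).inter hU).measurableSet |>.2 (hfV n)).locallyIntegrable
  filter_upwards [ae_restrict_of_ae hlebesgue, ae_restrict_mem hU.measurableSet] with x hx hxU
  obtain ⟨n, hn⟩ := mem_iUnion.1 (hUV hxU)
  refine (hx n).congr ?_
  filter_upwards [((hV n).inter hU).mem_nhds ⟨hn, hxU⟩] with y hy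
  exact indicator_of_mem hy f

section ApproximateIdentity

variable {ι : Type*} {l : Filter ι} {K : ι → ℝ → ℝ} {h : ℝ → ℝ}

theorem setLIntegral_closedBall_enorm_mul_le {k : ℝ → ℝ} {x C δ ε τ : ℝ} (hC : 0 ≤ C)
    (hδ : 0 < δ) (hε : 0 ≤ ε) (hτ : 0 < τ)
    (hh : AEStronglyMeasurable h (volume.restrict (Metric.closedBall x δ)))
    (hle : ∀ r, 0 < r → r ≤ δ → ∫⁻ y in Metric.closedBall x r, ‖h y‖ₑ ≤ ENNReal.ofReal (ε * r))
    (hk : ∀ y ∈ Metric.closedBall x δ, |k y| ≤ C * poissonProfile τ (y - x)) :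
    ∫⁻ y in Metric.closedBall x δ, ‖k y * h y‖ₑ ≤ ENNReal.ofReal (8 * C * ε) := by
  calc ∫⁻ y in Metric.closedBall x δ, ‖k y * h y‖ₑ
      ≤ ∫⁻ y in Metric.closedBall x δ, ENNReal.ofReal C *
          (‖h y‖ₑ * ENNReal.ofReal (poissonProfile τ (y - x))) := by
        refine setLIntegral_mono' Metric.isClosed_closedBall.measurableSet fun y hy => ?_
        rw [enorm_mul, mul_left_comm, ← ENNReal.ofReal_mul hC, mul_comm,
          Real.enorm_eq_ofReal_abs (k y)]
        gcongr
        exact hk y hy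
    _ ≤ ENNReal.ofReal C * ENNReal.ofReal (8 * ε) := by
        rw [lintegral_const_mul' _ _ ENNReal.ofReal_ne_top]
        gcongr
        exact setLIntegral_closedBall_mul_poissonProfile_le hδ hε hτ hh.enorm hle
    _ = ENNReal.ofReal (8 * C * ε) := by
        rw [← ENNReal.ofReal_mul hC]
        ring_nf

theorem tendsto_setLIntegral_enorm_mul_zero {S : Set ℝ} (hS : MeasurableSet S) {η : ι → ℝ}
    {Φ : ℝ → ℝ} (hη : Tendsto η l (𝓝 0)) (hΦ : IntegrableOn (fun y => Φ y * h y) S)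
    (hK : ∀ᶠ t in l, ∀ y ∈ S, |K t y| ≤ η t * Φ y) :
    Tendsto (fun t => ∫⁻ y in S, ‖K t y * h y‖ₑ) l (𝓝 0) := by
  have hlim : Tendsto (fun t => ‖η t‖ₑ * ∫⁻ y in S, ‖Φ y * h y‖ₑ) l (𝓝 0) := by
    simpa using ENNReal.Tendsto.mul_const hη.enorm (Or.inr hΦ.2.ne)
  refine tendsto_of_tendsto_of_tendsto_of_le_of_le' tendsto_const_nhds hlim
    (Eventually.of_forall fun _ => bot_le) ?_
  filter_upwards [hK] with t hKt
  rw [← lintegral_const_mul' _ _ enorm_ne_top]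
  refine setLIntegral_mono' hS fun y hy => ?_
  rw [← enorm_mul, ← mul_assoc, enorm_mul, enorm_mul (η t * Φ y)]
  gcongr
  rw [enorm_le_iff_norm_le]
  exact (hKt y hy).trans (le_abs_self _)

theorem tendsto_setLIntegral_enorm_mul_sub_of_isLebesguePoint {f : ℝ → ℝ} {x : ℝ} {U : Set ℝ}
    (hU : MeasurableSet U) (hf : AEStronglyMeasurable f (volume.restrict U))
    (hfx : IsLebesguePoint f x) {τ : ι → ℝ} {C ρ : ℝ} (hC : 0 < C) (hρ : 0 < ρ)
    (hρU : Metric.closedBall x ρ ⊆ U) (hτ : ∀ᶠ t in l, 0 < τ t)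
    (hnear : ∀ᶠ t in l, ∀ y ∈ Metric.closedBall x ρ, |K t y| ≤ C * poissonProfile (τ t) (y - x))
    (hfar : ∀ δ > 0, ∃ (η : ι → ℝ) (Φ : ℝ → ℝ), Tendsto η l (𝓝 0) ∧
      IntegrableOn Φ U ∧ IntegrableOn (fun y => Φ y * f y) U ∧
      ∀ᶠ t in l, ∀ y ∈ U, δ < |y - x| → |K t y| ≤ η t * Φ y) :
    Tendsto (fun t => ∫⁻ y in U, ‖K t y * (f y - f x)‖ₑ) l (𝓝 0) := by
  rw [ENNReal.tendsto_nhds_zero]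
  intro ε hε
  obtain ⟨e, he, heε⟩ := ENNReal.lt_iff_exists_nnreal_btwn.1 hε
  have he : (0 : ℝ) < e := by exact_mod_cast he
  obtain ⟨δ, hδ, hδ_average⟩ := mem_nhdsGT_iff_exists_Ioc_subset.1
    (inter_mem (hfx (e / (16 * C)) (by positivity)) (Ioc_mem_nhdsGT hρ))
  have hδρ : δ ≤ ρ := (hδ_average (right_mem_Ioc.2 hδ)).2.2
  have hball : MeasurableSet (Metric.closedBall x δ) := Metric.isClosed_closedBall.measurableSet
  have hδU : Metric.closedBall x δ ⊆ U := (Metric.closedBall_subset_closedBall hδρ).trans hρU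
  obtain ⟨η, Φ, hη, hΦ, hΦf, hfar⟩ := hfar δ hδ
  have hΦ_sub : IntegrableOn (fun y => Φ y * (f y - f x)) (U \ Metric.closedBall x δ) := by
    simp_rw [mul_sub]
    exact (hΦf.sub (hΦ.mul_const _)).mono_set sdiff_subset
  have hfar_lim := tendsto_setLIntegral_enorm_mul_zero (K := K) (hU.diff hball) hη hΦ_sub <| by
    filter_upwards [hfar] with t ht y hy
    exact ht y hy.1 (by simpa [Real.dist_eq] using hy.2)
  have hhalf : 0 < ENNReal.ofReal (e / 2) := by simpa using he
  filter_upwards [hτ, hnear, ENNReal.tendsto_nhds_zero.1 hfar_lim _ hhalf] with t hτt hnear hfar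
  have hnear_le := setLIntegral_closedBall_enorm_mul_le (k := K t) (h := fun y => f y - f x) hC.le
    hδ (by positivity) hτt
    ((hf.mono_measure (Measure.restrict_mono hδU le_rfl)).sub aestronglyMeasurable_const)
    (fun r hr hrδ => (hδ_average ⟨hr, hrδ⟩).1)
    fun y hy => hnear y (Metric.closedBall_subset_closedBall hδρ hy)
  rw [← lintegral_inter_add_sdiff _ U hball, inter_eq_self_of_subset_right hδU]
  calc _ ≤ ENNReal.ofReal (e / 2) + ENNReal.ofReal (e / 2) := by
        refine add_le_add (hnear_le.trans_eq ?_) hfar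
        congr 1
        field_simp
        norm_num
    _ = e := by
        rw [← ENNReal.ofReal_add (by positivity) (by positivity), add_halves,
          ENNReal.ofReal_coe_nnreal]
    _ ≤ ε := heε.le

theorem tendsto_setIntegral_mul_of_tendsto_setLIntegral_enorm {f : ℝ → ℝ} {U : Set ℝ} {a : ℝ}
    (hKf : ∀ᶠ t in l, IntegrableOn (fun y => K t y * f y) U)
    (hK : ∀ᶠ t in l, ∫ y in U, K t y = 1)
    (hlim : Tendsto (fun t => ∫⁻ y in U, ‖K t y * (f y - a)‖ₑ) l (𝓝 0)) :
    Tendsto (fun t => ∫ y in U, K t y * f y) l (𝓝 a) := by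
  rw [tendsto_iff_edist_tendsto_0]
  refine tendsto_of_tendsto_of_tendsto_of_le_of_le' tendsto_const_nhds hlim
    (Eventually.of_forall fun _ => bot_le) ?_
  filter_upwards [hKf, hK] with t hKft hKt
  have hint : IntegrableOn (K t) U :=
    Integrable.of_integral_ne_zero (by rw [hKt]; exact one_ne_zero)
  have hdiff : (∫ y in U, K t y * f y) - a = ∫ y in U, K t y * (f y - a) := by
    simp_rw [mul_sub]
    rw [integral_sub hKft (hint.mul_const _), integral_mul_const, hKt, one_mul]
  rw [edist_eq_enorm_sub, hdiff]
  exact enorm_integral_le_lintegral_enorm _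

end ApproximateIdentity

/-- The probability measure on `[-1, 1]` with density proportional to `(1 - s²)^{λ-1}`, or
`(δ₁ + δ₋₁) / 2` for `λ = 0`. It is the measure of the Poisson integral representation
of `I_{λ-1/2}`; the two cases are treated together through the properties listed here. -/
structure IsAngularMeasure (lam : ℝ) (m : Measure ℝ) : Prop where
  prob : IsProbabilityMeasure m
  mem : ∀ᵐ s ∂m, s ∈ Icc (-1 : ℝ) 1
  odd : ∫ s, s ∂m = 0
  ibp : ∀ g g' : ℝ → ℝ, (∀ s ∈ Icc (-1 : ℝ) 1, HasDerivAt g (g' s) s) →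
    ContinuousOn g' (Icc (-1 : ℝ) 1) →
    ∫ s, (1 - s ^ 2) * g' s ∂m = 2 * lam * ∫ s, s * g s ∂m
  decay : ∃ C, 0 < C ∧ ∀ z, 0 < z → ∫ s, Real.exp (-(z * (1 - s))) ∂m ≤ C * z ^ (-lam)

section AngularMeasureZero

theorem integral_half_smul_dirac_add_dirac (h : ℝ → ℝ) :
    ∫ s, h s ∂((2⁻¹ : ℝ≥0∞) • (Measure.dirac (1 : ℝ) + Measure.dirac (-1))) =
      2⁻¹ * (h 1 + h (-1)) := by
  rw [integral_smul_measure, integral_add_measure (integrable_dirac (by simp))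
    (integrable_dirac (by simp))]
  simp

theorem isAngularMeasure_zero :
    IsAngularMeasure 0 ((2⁻¹ : ℝ≥0∞) • (Measure.dirac (1 : ℝ) + Measure.dirac (-1))) where
  prob := ⟨by
    simp only [Measure.smul_apply, Measure.add_apply, measure_univ, smul_eq_mul]
    rw [one_add_one_eq_two, ENNReal.inv_mul_cancel (by simp) (by simp)]⟩
  mem := by
    refine Measure.ae_smul_measure (ae_add_measure_iff.2 ⟨?_, ?_⟩) _ <;>
      simp [ae_dirac_eq]
  odd := by rw [integral_half_smul_dirac_add_dirac]; norm_num
  ibp g g' _ _ := by rw [integral_half_smul_dirac_add_dirac]; simp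
  decay := by
    refine ⟨1, zero_lt_one, fun z hz => ?_⟩
    have hexp_le : Real.exp (-(z * (1 - -1))) ≤ 1 := Real.exp_le_one_iff.2 (by nlinarith)
    rw [integral_half_smul_dirac_add_dirac, neg_zero, Real.rpow_zero, sub_self, mul_zero, neg_zero,
      Real.exp_zero]
    norm_num only at hexp_le ⊢
    linarith

end AngularMeasureZero

section AngularDensity

variable {lam : ℝ}

/-- The density `(1 - s²)^{λ-1}` of the angular measure for `λ > 0`, not normalised. -/
noncomputable def angularDensity (lam s : ℝ) : ℝ :=
  (1 - s ^ 2) ^ (lam - 1)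

theorem measurable_angularDensity (lam : ℝ) : Measurable (angularDensity lam) := by
  unfold angularDensity
  fun_prop

theorem angularDensity_pos {s : ℝ} (hs : s ∈ Ioo (-1 : ℝ) 1) : 0 < angularDensity lam s :=
  Real.rpow_pos_of_pos (by nlinarith [hs.1, hs.2]) _

theorem angularDensity_neg (lam s : ℝ) : angularDensity lam (-s) = angularDensity lam s := by
  rw [angularDensity, neg_sq, angularDensity]

theorem angularDensity_le_of_nonneg {s : ℝ} (hlam : 0 < lam) (hs0 : 0 ≤ s) (hs1 : s < 1) :
    angularDensity lam s ≤ 2 ^ lam * (1 - s) ^ (lam - 1) := by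
  have hfactor : angularDensity lam s = (1 + s) ^ (lam - 1) * (1 - s) ^ (lam - 1) := by
    rw [angularDensity, ← Real.mul_rpow (by linarith) (by linarith)]
    ring_nf
  have hle : (1 + s) ^ (lam - 1) ≤ 2 ^ lam :=
    (Real.rpow_le_rpow_of_exponent_le (by linarith) (by linarith)).trans
      (Real.rpow_le_rpow (by linarith) (by linarith) hlam.le)
  have : 0 ≤ (1 - s) ^ (lam - 1) := Real.rpow_nonneg (by linarith) _
  rw [hfactor]
  gcongr

theorem angularDensity_mul_exp_le {z s : ℝ} (hlam : 0 < lam) (hz : 0 ≤ z)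
    (hs : s ∈ Ioo (-1 : ℝ) 1) :
    angularDensity lam s * Real.exp (-(z * (1 - s))) ≤
      2 ^ lam * ((1 - s) ^ (lam - 1) * Real.exp (-(z * (1 - s)))
        + (s + 1) ^ (lam - 1) * Real.exp (-(z * (s + 1)))) := by
  have hminus : 0 ≤ (1 - s) ^ (lam - 1) := Real.rpow_nonneg (by linarith [hs.2]) _
  have hplus : 0 ≤ (s + 1) ^ (lam - 1) := Real.rpow_nonneg (by linarith [hs.1]) _
  rcases le_or_gt 0 s with h | h
  · calc _ ≤ 2 ^ lam * (1 - s) ^ (lam - 1) * Real.exp (-(z * (1 - s))) := by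
          gcongr
          exact angularDensity_le_of_nonneg hlam h hs.2
      _ ≤ _ := by
          rw [mul_assoc]
          gcongr
          exact le_add_of_nonneg_right (by positivity)
  · have hle := angularDensity_le_of_nonneg hlam (neg_nonneg.2 h.le) (by linarith [hs.1])
    rw [angularDensity_neg, sub_neg_eq_add, add_comm 1] at hle
    calc _ ≤ 2 ^ lam * (s + 1) ^ (lam - 1) * Real.exp (-(z * (s + 1))) := by
          gcongr
          linarith
      _ ≤ _ := by
          rw [mul_assoc]
          gcongr
          exact le_add_of_nonneg_left (by positivity)

theorem intervalIntegrable_rpow_mul_exp (hlam : 0 < lam) (z : ℝ) :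
    IntervalIntegrable (fun r => r ^ (lam - 1) * Real.exp (-(z * r))) volume 0 2 :=
  (intervalIntegral.intervalIntegrable_rpow' (by linarith)).mul_continuousOn (by fun_prop)

theorem intervalIntegrable_one_sub_rpow_mul_exp (hlam : 0 < lam) (z : ℝ) :
    IntervalIntegrable (fun s => (1 - s) ^ (lam - 1) * Real.exp (-(z * (1 - s))))
      volume (-1) 1 := by
  convert ((intervalIntegrable_rpow_mul_exp hlam z).comp_sub_left 1).symm using 1 <;> norm_num

theorem intervalIntegrable_add_one_rpow_mul_exp (hlam : 0 < lam) (z : ℝ) :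
    IntervalIntegrable (fun s => (s + 1) ^ (lam - 1) * Real.exp (-(z * (s + 1))))
      volume (-1) 1 := by
  convert (intervalIntegrable_rpow_mul_exp hlam z).comp_add_right 1 using 1 <;> norm_num

theorem intervalIntegrable_angularDensity (hlam : 0 < lam) :
    IntervalIntegrable (angularDensity lam) volume (-1) 1 := by
  have hmajorant := ((intervalIntegrable_one_sub_rpow_mul_exp hlam 0).add
    (intervalIntegrable_add_one_rpow_mul_exp hlam 0)).const_mul (2 ^ lam)
  rw [intervalIntegrable_iff_integrableOn_Ioo_of_le (by norm_num)] at hmajorant ⊢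
  refine hmajorant.mono' (measurable_angularDensity lam).aestronglyMeasurable ?_
  filter_upwards [ae_restrict_mem measurableSet_Ioo] with s hs
  rw [Real.norm_of_nonneg (angularDensity_pos hs).le]
  simpa using angularDensity_mul_exp_le hlam le_rfl hs

theorem integral_rpow_mul_exp_le {z : ℝ} (hlam : 0 < lam) (hz : 0 < z) :
    ∫ r in (0 : ℝ)..2, r ^ (lam - 1) * Real.exp (-(z * r)) ≤ Real.Gamma lam * z ^ (-lam) := by
  have hgamma := Real.integral_rpow_mul_exp_neg_mul_Ioi hlam hz
  rw [one_div, Real.inv_rpow hz.le, ← Real.rpow_neg hz.le, mul_comm] at hgamma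
  rw [← hgamma, intervalIntegral.integral_of_le (by norm_num)]
  have hint : IntegrableOn (fun r => r ^ (lam - 1) * Real.exp (-(z * r))) (Ioi 0) := by
    simpa [neg_mul] using integrableOn_rpow_mul_exp_neg_mul_rpow (p := 1) (s := lam - 1) (b := z)
      (by linarith) one_pos hz
  refine setIntegral_mono_set hint ?_ Ioc_subset_Ioi_self.eventuallyLE
  filter_upwards [ae_restrict_mem measurableSet_Ioi] with r hr
  have hr : 0 < r := hr
  positivity

theorem integral_angularDensity_mul_exp_le {z : ℝ} (hlam : 0 < lam) (hz : 0 < z) :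
    ∫ s in (-1 : ℝ)..1, angularDensity lam s * Real.exp (-(z * (1 - s))) ≤
      2 ^ lam * (2 * Real.Gamma lam) * z ^ (-lam) := by
  have hminus := intervalIntegrable_one_sub_rpow_mul_exp hlam z
  have hplus := intervalIntegrable_add_one_rpow_mul_exp hlam z
  calc _ ≤ ∫ s in (-1 : ℝ)..1, 2 ^ lam * ((1 - s) ^ (lam - 1) * Real.exp (-(z * (1 - s)))
        + (s + 1) ^ (lam - 1) * Real.exp (-(z * (s + 1)))) :=
        intervalIntegral.integral_mono_on_of_le_Ioo (by norm_num)
          ((intervalIntegrable_angularDensity hlam).mul_continuousOn (by fun_prop))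
          ((hminus.add hplus).const_mul (2 ^ lam))
          fun s hs => angularDensity_mul_exp_le hlam hz.le hs
    _ = 2 ^ lam * (2 * ∫ r in (0 : ℝ)..2, r ^ (lam - 1) * Real.exp (-(z * r))) := by
        rw [intervalIntegral.integral_const_mul, intervalIntegral.integral_add hminus hplus,
          intervalIntegral.integral_comp_sub_left
            (fun r => r ^ (lam - 1) * Real.exp (-(z * r))) 1,
          intervalIntegral.integral_comp_add_right
            (fun r => r ^ (lam - 1) * Real.exp (-(z * r))) 1]
        norm_num [two_mul]
    _ ≤ 2 ^ lam * (2 * (Real.Gamma lam * z ^ (-lam))) := by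
        gcongr
        exact integral_rpow_mul_exp_le hlam hz
    _ = _ := by ring

theorem hasDerivAt_one_sub_sq_rpow_mul {g : ℝ → ℝ} {g' s : ℝ} (hs : s ∈ Ioo (-1 : ℝ) 1)
    (hg : HasDerivAt g g' s) :
    HasDerivAt (fun s => (1 - s ^ 2) ^ lam * g s)
      (angularDensity lam s * ((1 - s ^ 2) * g') - 2 * lam * (angularDensity lam s * (s * g s)))
      s := by
  have hpos : 0 < 1 - s ^ 2 := by nlinarith [hs.1, hs.2]
  have hbase : HasDerivAt (fun s : ℝ => 1 - s ^ 2) (-(2 * s)) s := by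
    simpa using (hasDerivAt_pow 2 s).const_sub 1
  refine ((hbase.rpow_const (p := lam) (Or.inl hpos.ne')).mul hg).congr_deriv ?_
  rw [angularDensity, Real.rpow_sub_one hpos.ne']
  field_simp
  ring

theorem integral_angularDensity_mul_one_sub_sq_mul (hlam : 0 < lam) {g g' : ℝ → ℝ}
    (hg : ∀ s ∈ Icc (-1 : ℝ) 1, HasDerivAt g (g' s) s) (hg' : ContinuousOn g' (Icc (-1 : ℝ) 1)) :
    ∫ s in (-1 : ℝ)..1, angularDensity lam s * ((1 - s ^ 2) * g' s) =
      2 * lam * ∫ s in (-1 : ℝ)..1, angularDensity lam s * (s * g s) := by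
  have hdensity := intervalIntegrable_angularDensity hlam
  have huIcc : uIcc (-1 : ℝ) 1 = Icc (-1) 1 := uIcc_of_le (by norm_num)
  have hgc : ContinuousOn g (Icc (-1 : ℝ) 1) := fun s hs =>
    (hg s hs).continuousAt.continuousWithinAt
  have hint_left := hdensity.mul_continuousOn (g := fun s => (1 - s ^ 2) * g' s)
    (by rw [huIcc]; fun_prop)
  have hint_right := (hdensity.mul_continuousOn (g := fun s => s * g s)
    (by rw [huIcc]; fun_prop)).const_mul (2 * lam)
  have hboundary := intervalIntegral.integral_eq_sub_of_hasDerivAt_of_le (by norm_num)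
    ((ContinuousOn.rpow_const (by fun_prop) fun s _ => Or.inr hlam.le).mul hgc)
    (fun s hs => hasDerivAt_one_sub_sq_rpow_mul hs (hg s (Ioo_subset_Icc_self hs)))
    (hint_left.sub hint_right)
  rw [intervalIntegral.integral_sub hint_left hint_right, intervalIntegral.integral_const_mul]
    at hboundary
  norm_num [Real.zero_rpow hlam.ne'] at hboundary
  linarith

/-- The angular measure for `λ > 0`. -/
noncomputable def angularMeasure (lam : ℝ) : Measure ℝ :=
  (volume.restrict (Ioo (-1 : ℝ) 1)).withDensity fun s =>
    ENNReal.ofReal (angularDensity lam s / ∫ s in (-1 : ℝ)..1, angularDensity lam s)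

theorem integral_angularDensity_pos (hlam : 0 < lam) :
    0 < ∫ s in (-1 : ℝ)..1, angularDensity lam s :=
  intervalIntegral.intervalIntegral_pos_of_pos_on (intervalIntegrable_angularDensity hlam)
    (fun _ => angularDensity_pos) (by norm_num)

theorem integral_angularMeasure (hlam : 0 < lam) (h : ℝ → ℝ) :
    ∫ s, h s ∂(angularMeasure lam) =
      (∫ s in (-1 : ℝ)..1, angularDensity lam s)⁻¹ *
        ∫ s in (-1 : ℝ)..1, angularDensity lam s * h s := by
  rw [angularMeasure, integral_withDensity_eq_integral_toReal_smul
      ((measurable_angularDensity lam).div_const _).ennreal_ofReal (by simp),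
    intervalIntegral.integral_of_le (μ := volume) (f := fun s => angularDensity lam s * h s)
      (by norm_num), integral_Ioc_eq_integral_Ioo, ← integral_const_mul]
  refine setIntegral_congr_fun measurableSet_Ioo fun s hs => ?_
  have hdensity := angularDensity_pos (lam := lam) hs
  have hmass := integral_angularDensity_pos hlam
  simp only [smul_eq_mul]
  rw [ENNReal.toReal_ofReal (by positivity)]
  field_simp

theorem isProbabilityMeasure_angularMeasure (hlam : 0 < lam) :
    IsProbabilityMeasure (angularMeasure lam) := by
  have hmass := integral_angularDensity_pos hlam
  have hint : IntegrableOn (angularDensity lam) (Ioo (-1) 1) :=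
    (intervalIntegrable_iff_integrableOn_Ioo_of_le (by norm_num)).1
      (intervalIntegrable_angularDensity hlam)
  refine ⟨?_⟩
  rw [angularMeasure, withDensity_apply _ MeasurableSet.univ, Measure.restrict_univ,
    ← ofReal_integral_eq_lintegral_ofReal (hint.div_const _)]
  · rw [integral_div, ← integral_Ioc_eq_integral_Ioo,
      ← intervalIntegral.integral_of_le (by norm_num), div_self hmass.ne', ENNReal.ofReal_one]
  · filter_upwards [ae_restrict_mem measurableSet_Ioo] with s hs
    exact div_nonneg (angularDensity_pos hs).le hmass.le

theorem integral_angularDensity_mul_id (hlam : 0 < lam) :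
    ∫ s in (-1 : ℝ)..1, angularDensity lam s * s = 0 := by
  have hibp := integral_angularDensity_mul_one_sub_sq_mul hlam (g := fun _ => 1)
    (g' := fun _ => 0) (fun s _ => hasDerivAt_const s 1) continuousOn_const
  simp only [mul_zero, intervalIntegral.integral_zero, mul_one] at hibp
  exact (mul_eq_zero.1 hibp.symm).resolve_left (by positivity)

theorem isAngularMeasure_angularMeasure (hlam : 0 < lam) :
    IsAngularMeasure lam (angularMeasure lam) where
  prob := isProbabilityMeasure_angularMeasure hlam
  mem := by
    refine (withDensity_absolutelyContinuous _ _).ae_le ?_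
    filter_upwards [ae_restrict_mem measurableSet_Ioo] with s hs using Ioo_subset_Icc_self hs
  odd := by
    rw [integral_angularMeasure hlam, integral_angularDensity_mul_id hlam, mul_zero]
  ibp g g' hg hg' := by
    rw [integral_angularMeasure hlam, integral_angularMeasure hlam,
      integral_angularDensity_mul_one_sub_sq_mul hlam hg hg']
    ring
  decay := by
    have hmass := integral_angularDensity_pos hlam
    have := Real.Gamma_pos_of_pos hlam
    refine ⟨(∫ s in (-1 : ℝ)..1, angularDensity lam s)⁻¹ * (2 ^ lam * (2 * Real.Gamma lam)),
      by positivity, fun z hz => ?_⟩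
    rw [integral_angularMeasure hlam, mul_assoc]
    gcongr
    exact integral_angularDensity_mul_exp_le hlam hz

theorem exists_isAngularMeasure (hlam : 0 ≤ lam) : ∃ m, IsAngularMeasure lam m := by
  rcases hlam.eq_or_lt with rfl | hlam
  · exact ⟨_, isAngularMeasure_zero⟩
  · exact ⟨_, isAngularMeasure_angularMeasure hlam⟩

end AngularDensity

namespace IsAngularMeasure

variable {lam : ℝ} {m : Measure ℝ}

theorem integrable (hm : IsAngularMeasure lam m) {g : ℝ → ℝ}
    (hg : ContinuousOn g (Icc (-1 : ℝ) 1)) : Integrable g m := by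
  have := hm.prob
  rw [← Measure.restrict_eq_self_of_ae_mem hm.mem]
  exact hg.integrableOn_compact isCompact_Icc

theorem moment_add_two (hm : IsAngularMeasure lam m) (n : ℕ) :
    (n + 1 + 2 * lam) * ∫ s, s ^ (n + 2) ∂m = (n + 1) * ∫ s, s ^ n ∂m := by
  have hibp := hm.ibp (fun s => s ^ (n + 1)) (fun s => (n + 1) * s ^ n)
    (fun s _ => by simpa using hasDerivAt_pow (n + 1) s) (by fun_prop)
  have hleft : ∀ s : ℝ, (1 - s ^ 2) * ((n + 1) * s ^ n) =
      (n + 1) * s ^ n - (n + 1) * s ^ (n + 2) := fun s => by ring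
  have hright : ∀ s : ℝ, s * s ^ (n + 1) = s ^ (n + 2) := fun s => by ring
  simp_rw [hleft, hright] at hibp
  rw [integral_sub ((hm.integrable (by fun_prop)).const_mul _)
    ((hm.integrable (by fun_prop)).const_mul _), integral_const_mul, integral_const_mul] at hibp
  linarith

theorem moment_odd (hm : IsAngularMeasure lam m) (hlam : 0 ≤ lam) (k : ℕ) :
    ∫ s, s ^ (2 * k + 1) ∂m = 0 := by
  induction k with
  | zero => simpa using hm.odd
  | succ k ih =>
    have hrec := hm.moment_add_two (2 * k + 1)
    rw [ih, mul_zero] at hrec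
    exact (mul_eq_zero.1 hrec).resolve_left (by positivity)

theorem moment_even (hm : IsAngularMeasure lam m) (hlam : 0 ≤ lam) (k : ℕ) :
    (∫ s, s ^ (2 * k) ∂m) / (2 * k).factorial =
      Real.Gamma (lam + 1 / 2) / (4 ^ k * k.factorial * Real.Gamma (k + lam + 1 / 2)) := by
  have := hm.prob
  induction k with
  | zero => simp [(Real.Gamma_pos_of_pos (s := lam + 2⁻¹) (by positivity)).ne']
  | succ k ih =>
    have hGamma_succ : Real.Gamma ((k + 1 : ℕ) + lam + 1 / 2) =
        (k + lam + 1 / 2) * Real.Gamma (k + lam + 1 / 2) := by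
      rw [← Real.Gamma_add_one (by positivity)]
      congr 1
      push_cast
      ring
    have hmoment : ∫ s, s ^ (2 * k + 1 + 1) ∂m =
        (2 * k + 1) / (2 * k + 1 + 2 * lam) * ∫ s, s ^ (2 * k) ∂m := by
      rw [div_mul_eq_mul_div, eq_div_iff (by positivity), mul_comm]
      exact_mod_cast hm.moment_add_two (2 * k)
    have hGamma_pos : 0 < Real.Gamma (k + lam + 1 / 2) := Real.Gamma_pos_of_pos (by positivity)
    rw [div_eq_iff (by positivity)] at ih
    rw [hGamma_succ, show 2 * (k + 1) = 2 * k + 1 + 1 by ring, Nat.factorial_succ,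
      Nat.factorial_succ, Nat.factorial_succ, hmoment, ih]
    push_cast
    field_simp
    ring

theorem integral_norm_mul_pow_div_factorial_le (hm : IsAngularMeasure lam m) (z : ℝ) (n : ℕ) :
    ∫ s, ‖(z * s) ^ n / (n.factorial : ℝ)‖ ∂m ≤ |z| ^ n / n.factorial := by
  have := hm.prob
  calc ∫ s, ‖(z * s) ^ n / (n.factorial : ℝ)‖ ∂m ≤ ∫ _, |z| ^ n / n.factorial ∂m := by
        refine integral_mono_ae (hm.integrable (by fun_prop)) (integrable_const _) ?_
        filter_upwards [hm.mem] with s hs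
        rw [norm_div, norm_pow, norm_mul, Real.norm_eq_abs, Real.norm_eq_abs,
          Real.norm_of_nonneg (Nat.cast_nonneg _)]
        gcongr
        exact mul_le_of_le_one_right (abs_nonneg _) (abs_le.2 hs)
    _ = |z| ^ n / n.factorial := by simp

theorem hasSum_integral_pow (hm : IsAngularMeasure lam m) (z : ℝ) :
    HasSum (fun n : ℕ => z ^ n * ((∫ s, s ^ n ∂m) / n.factorial)) (∫ s, Real.exp (z * s) ∂m) := by
  have hsum := hasSum_integral_of_summable_integral_norm (μ := m)
    (F := fun (n : ℕ) s => (z * s) ^ n / n.factorial)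
    (fun n => hm.integrable (by fun_prop))
    (Summable.of_nonneg_of_le (fun n => integral_nonneg fun _ => norm_nonneg _)
      (hm.integral_norm_mul_pow_div_factorial_le z) (Real.summable_pow_div_factorial |z|))
  simp_rw [integral_div, mul_pow, integral_const_mul, ← mul_pow, mul_div_assoc] at hsum
  simpa only [Real.exp_eq_exp_ℝ, NormedSpace.exp_eq_tsum_div] using hsum

theorem hasSum_integral_exp (hm : IsAngularMeasure lam m) (hlam : 0 ≤ lam) (z : ℝ) :
    HasSum (fun k : ℕ => Real.Gamma (lam + 1 / 2) /
      (4 ^ k * k.factorial * Real.Gamma (k + lam + 1 / 2)) * z ^ (2 * k))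
      (∫ s, Real.exp (z * s) ∂m) := by
  have heven : Function.Injective fun k : ℕ => 2 * k := mul_right_injective₀ two_ne_zero
  have hsum := hm.hasSum_integral_pow z
  rw [← heven.hasSum_iff] at hsum
  · simpa only [Function.comp_def, hm.moment_even hlam, mul_comm (z ^ _)] using hsum
  · intro n hn
    obtain ⟨k, rfl⟩ : Odd n := by
      rw [← Nat.not_even_iff_odd]
      rintro ⟨k, rfl⟩
      exact hn ⟨k, two_mul k⟩
    rw [hm.moment_odd hlam, zero_div, mul_zero]

theorem besselI_eq (hm : IsAngularMeasure lam m) (hlam : 0 ≤ lam) {z : ℝ} (hz : 0 < z) :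
    besselI (lam - 1 / 2) z =
      (z / 2) ^ (lam - 1 / 2) / Real.Gamma (lam + 1 / 2) * ∫ s, Real.exp (z * s) ∂m := by
  rw [← (hm.hasSum_integral_exp hlam z).tsum_eq, besselI, ← tsum_mul_left]
  refine tsum_congr fun k => ?_
  have : 0 < Real.Gamma (lam + 1 / 2) := Real.Gamma_pos_of_pos (by positivity)
  have : 0 < Real.Gamma (k + lam + 1 / 2) := Real.Gamma_pos_of_pos (by positivity)
  have hpow : (z / 2) ^ (2 * (k : ℝ) + (lam - 1 / 2)) =
      (z / 2) ^ (lam - 1 / 2) * (z ^ (2 * k) / 4 ^ k) := by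
    rw [add_comm, Real.rpow_add (by positivity),
      show 2 * (k : ℝ) = ((2 * k : ℕ) : ℝ) by push_cast; ring, Real.rpow_natCast, div_pow,
      pow_mul 2 2 k]
    norm_num
  rw [show (k : ℝ) + (lam - 1 / 2) + 1 = k + lam + 1 / 2 by ring, hpow]
  field_simp

end IsAngularMeasure

section HeatConst

/-- The normalizing constant `4^{-λ} / Γ(λ + 1/2)` of the heat kernel. -/
noncomputable def heatConst (lam : ℝ) : ℝ := 4 ^ (-lam) / Real.Gamma (lam + 1 / 2)

theorem heatConst_pos {lam : ℝ} (hlam : 0 ≤ lam) : 0 < heatConst lam :=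
  div_pos (by positivity) (Real.Gamma_pos_of_pos (by positivity))

theorem four_rpow_one_half : (4 : ℝ) ^ (1 / 2 : ℝ) = 2 := by
  rw [← Real.sqrt_eq_rpow, show (4 : ℝ) = 2 ^ 2 by norm_num, Real.sqrt_sq two_pos.le]

theorem heatKernel_prefactor_eq (lam : ℝ) {r t : ℝ} (hr : 0 < r) (ht : 0 < t) :
    r ^ (-lam + 1 / 2) / (2 * t) * (r / (2 * t) / 2) ^ (lam - 1 / 2) =
      4 ^ (-lam) * t ^ (-lam - 1 / 2) := by
  have hfour : (4 : ℝ) ^ (lam - 1 / 2) * 2 = 4 ^ lam := by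
    rw [Real.rpow_sub four_pos, four_rpow_one_half, div_mul_cancel₀ _ two_ne_zero]
  have ht_pow : t ^ (lam - 1 / 2) * t = t ^ (lam + 1 / 2) := by
    rw [← Real.rpow_add_one ht.ne']
    ring_nf
  have : 0 < r ^ (lam - 1 / 2) := by positivity
  rw [div_div, show 2 * t * 2 = 4 * t by ring, Real.div_rpow hr.le (by positivity),
    Real.mul_rpow four_pos.le ht.le, show -lam + 1 / 2 = -(lam - 1 / 2) by ring,
    show -lam - 1 / 2 = -(lam + 1 / 2) by ring, Real.rpow_neg hr.le, Real.rpow_neg four_pos.le,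
    Real.rpow_neg ht.le, ← hfour, ← ht_pow]
  field_simp

end HeatConst

theorem rpow_neg_half_mul_exp_le_poissonProfile {t : ℝ} (ht : 0 < t) (r : ℝ) :
    t ^ (-(1 / 2) : ℝ) * Real.exp (-r ^ 2 / (4 * t)) ≤ 4 * poissonProfile (√t) r := by
  have hexp : Real.exp (-r ^ 2 / (4 * t)) ≤ 4 * t / (t + r ^ 2) := by
    rw [neg_div, Real.exp_neg, ← inv_div (t + r ^ 2)]
    gcongr
    calc (t + r ^ 2) / (4 * t) ≤ r ^ 2 / (4 * t) + 1 := by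
          field_simp
          linarith
      _ ≤ Real.exp (r ^ 2 / (4 * t)) := Real.add_one_le_exp _
  have hsqrt : t ^ (-(1 / 2) : ℝ) = (√t)⁻¹ := by rw [Real.rpow_neg ht.le, Real.sqrt_eq_rpow]
  calc t ^ (-(1 / 2) : ℝ) * Real.exp (-r ^ 2 / (4 * t))
      ≤ (√t)⁻¹ * (4 * t / (t + r ^ 2)) := by rw [hsqrt]; gcongr
    _ = 4 * poissonProfile (√t) r := by
        have : 0 < √t := by positivity
        rw [poissonProfile, Real.sq_sqrt ht.le]
        field_simp
        rw [Real.sq_sqrt ht.le]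

namespace IsAngularMeasure

variable {lam : ℝ} {m : Measure ℝ} {t x y : ℝ}

theorem heatKernel_eq_exp_mul (hm : IsAngularMeasure lam m) (hlam : 0 ≤ lam)
    (ht : 0 < t) (hx : 0 < x) (hy : 0 < y) :
    heatKernel lam t x y = heatConst lam * t ^ (-lam - 1 / 2) *
      Real.exp (-(x ^ 2 + y ^ 2) / (4 * t)) * ∫ s, Real.exp (x * y / (2 * t) * s) ∂m := by
  rw [heatKernel, hm.besselI_eq hlam (by positivity), heatConst, div_mul_eq_mul_div (4 ^ (-lam)),
    ← heatKernel_prefactor_eq lam (mul_pos hx hy) ht]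
  ring

theorem heatKernel_eq (hm : IsAngularMeasure lam m) (hlam : 0 ≤ lam)
    (ht : 0 < t) (hx : 0 < x) (hy : 0 < y) :
    heatKernel lam t x y = heatConst lam * t ^ (-lam - 1 / 2) *
      ∫ s, Real.exp (-(x ^ 2 + y ^ 2 - 2 * x * y * s) / (4 * t)) ∂m := by
  rw [hm.heatKernel_eq_exp_mul hlam ht hx hy, mul_assoc, ← integral_const_mul]
  congr 2
  ext s
  rw [← Real.exp_add]
  congr 1
  field_simp
  ring

theorem heatKernel_eq_exp_sub_sq (hm : IsAngularMeasure lam m) (hlam : 0 ≤ lam)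
    (ht : 0 < t) (hx : 0 < x) (hy : 0 < y) :
    heatKernel lam t x y = heatConst lam * t ^ (-lam - 1 / 2) *
      Real.exp (-(y - x) ^ 2 / (4 * t)) * ∫ s, Real.exp (-(x * y / (2 * t) * (1 - s))) ∂m := by
  rw [hm.heatKernel_eq hlam ht hx hy, mul_assoc _ (Real.exp _), ← integral_const_mul (Real.exp _)]
  congr 2
  ext s
  rw [← Real.exp_add]
  congr 1
  field_simp
  ring

theorem le_heatKernel (hm : IsAngularMeasure lam m) (hlam : 0 ≤ lam)
    (ht : 0 < t) (hx : 0 < x) (hy : 0 < y) :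
    heatConst lam * t ^ (-lam - 1 / 2) * Real.exp (-(x ^ 2 + y ^ 2) / (4 * t)) ≤
      heatKernel lam t x y := by
  have := hm.prob
  have := heatConst_pos hlam
  rw [hm.heatKernel_eq_exp_mul hlam ht hx hy]
  refine le_mul_of_one_le_right (by positivity) ?_
  calc (1 : ℝ) = ∫ s, (x * y / (2 * t) * s + 1) ∂m := by
        rw [integral_add ((hm.integrable (by fun_prop)).const_mul _) (integrable_const _),
          integral_const_mul, hm.odd]
        simp
    _ ≤ ∫ s, Real.exp (x * y / (2 * t) * s) ∂m :=
        integral_mono (hm.integrable (by fun_prop)) (hm.integrable (by fun_prop))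
          fun _ => Real.add_one_le_exp _

theorem heatKernel_nonneg (hm : IsAngularMeasure lam m) (hlam : 0 ≤ lam)
    (ht : 0 < t) (hx : 0 < x) (hy : 0 < y) : 0 ≤ heatKernel lam t x y := by
  have := heatConst_pos hlam
  exact le_trans (by positivity) (hm.le_heatKernel hlam ht hx hy)

theorem heatKernel_le (hm : IsAngularMeasure lam m) (hlam : 0 ≤ lam)
    (ht : 0 < t) (hx : 0 < x) (hy : 0 < y) :
    heatKernel lam t x y ≤ heatConst lam * t ^ (-lam - 1 / 2) *
      Real.exp (-(y - x) ^ 2 / (4 * t)) := by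
  have := hm.prob
  have := heatConst_pos hlam
  rw [hm.heatKernel_eq_exp_sub_sq hlam ht hx hy]
  refine mul_le_of_le_one_right (by positivity) ?_
  calc ∫ s, Real.exp (-(x * y / (2 * t) * (1 - s))) ∂m ≤ ∫ _, (1 : ℝ) ∂m := by
        refine integral_mono_ae (hm.integrable (by fun_prop)) (integrable_const _) ?_
        filter_upwards [hm.mem] with s hs
        exact Real.exp_le_one_iff.2
          (neg_nonpos.2 (mul_nonneg (by positivity) (sub_nonneg.2 hs.2)))
    _ = 1 := by simp

theorem exists_heatKernel_mul_le (hm : IsAngularMeasure lam m) (hlam : 0 ≤ lam) :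
    ∃ C, 0 < C ∧ ∀ t x y, 0 < t → 0 < x → 0 < y → y ≤ 2 * x →
      heatKernel lam t x y * y ^ (2 * lam) ≤
        C * (t ^ (-(1 / 2) : ℝ) * Real.exp (-(y - x) ^ 2 / (4 * t))) := by
  obtain ⟨C, hC, hdecay⟩ := hm.decay
  have := heatConst_pos hlam
  refine ⟨heatConst lam * C * 2 ^ lam * 2 ^ lam, by positivity, ?_⟩
  intro t x y ht hx hy hyx
  have hz : 0 < x * y / (2 * t) := by positivity
  have hpow : (x * y / (2 * t)) ^ (-lam) * y ^ (2 * lam) * t ^ (-lam - 1 / 2) =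
      2 ^ lam * (y / x) ^ lam * t ^ (-(1 / 2) : ℝ) := by
    rw [Real.rpow_neg hz.le, Real.div_rpow (by positivity) (by positivity),
      Real.mul_rpow hx.le hy.le, Real.mul_rpow two_pos.le ht.le, Real.div_rpow hy.le hx.le,
      two_mul lam, Real.rpow_add hy, sub_eq_add_neg, Real.rpow_add ht, Real.rpow_neg ht.le lam]
    field_simp
  rw [hm.heatKernel_eq_exp_sub_sq hlam ht hx hy]
  calc heatConst lam * t ^ (-lam - 1 / 2) * Real.exp (-(y - x) ^ 2 / (4 * t)) *
          (∫ s, Real.exp (-(x * y / (2 * t) * (1 - s))) ∂m) * y ^ (2 * lam)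
      ≤ heatConst lam * t ^ (-lam - 1 / 2) * Real.exp (-(y - x) ^ 2 / (4 * t)) *
          (C * (x * y / (2 * t)) ^ (-lam)) * y ^ (2 * lam) := by
        gcongr
        exact hdecay _ hz
    _ = heatConst lam * C * Real.exp (-(y - x) ^ 2 / (4 * t)) *
          ((x * y / (2 * t)) ^ (-lam) * y ^ (2 * lam) * t ^ (-lam - 1 / 2)) := by ring
    _ = heatConst lam * C * 2 ^ lam * (y / x) ^ lam *
          (t ^ (-(1 / 2) : ℝ) * Real.exp (-(y - x) ^ 2 / (4 * t))) := by rw [hpow]; ring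
    _ ≤ heatConst lam * C * 2 ^ lam * 2 ^ lam *
          (t ^ (-(1 / 2) : ℝ) * Real.exp (-(y - x) ^ 2 / (4 * t))) := by
        gcongr
        exact (div_le_iff₀ hx).2 hyx

theorem exists_heatKernel_mul_le_poissonProfile (hm : IsAngularMeasure lam m) (hlam : 0 ≤ lam) :
    ∃ C, 0 < C ∧ ∀ t x y, 0 < t → 0 < x → 0 < y → y ≤ 2 * x →
      heatKernel lam t x y * y ^ (2 * lam) ≤ C * poissonProfile (√t) (y - x) := by
  obtain ⟨C, hC, hle⟩ := hm.exists_heatKernel_mul_le hlam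
  refine ⟨C * 4, by positivity, fun t x y ht hx hy hyx => (hle t x y ht hx hy hyx).trans ?_⟩
  rw [mul_assoc]
  exact mul_le_mul_of_nonneg_left (rpow_neg_half_mul_exp_le_poissonProfile ht _) hC.le

end IsAngularMeasure

section HeatSeries

variable {lam t x y : ℝ}

/-- The `k`-th term of the expansion of `W_t^λ(x, y) y^{2λ}` in powers of `y`. -/
noncomputable def heatSeriesTerm (lam t x : ℝ) (k : ℕ) (y : ℝ) : ℝ :=
  heatConst lam * t ^ (-lam - 1 / 2) * Real.exp (-x ^ 2 / (4 * t)) *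
    (Real.Gamma (lam + 1 / 2) / (4 ^ k * k.factorial * Real.Gamma (k + lam + 1 / 2)) *
      (x / (2 * t)) ^ (2 * k)) *
    (y ^ (2 * (k : ℝ) + 2 * lam) * Real.exp (-(1 / (4 * t)) * y ^ (2 : ℝ)))

theorem integrableOn_heatSeriesTerm (hlam : 0 ≤ lam) (ht : 0 < t) (x : ℝ) (k : ℕ) :
    IntegrableOn (heatSeriesTerm lam t x k) (Ioi 0) :=
  (integrableOn_rpow_mul_exp_neg_mul_rpow (lt_of_lt_of_le (by norm_num)
    (by positivity : (0 : ℝ) ≤ 2 * k + 2 * lam)) two_pos (by positivity)).const_mul _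

theorem heatSeriesTerm_nonneg (hlam : 0 ≤ lam) (ht : 0 < t) (x : ℝ) (k : ℕ) (hy : 0 < y) :
    0 ≤ heatSeriesTerm lam t x k y := by
  have := heatConst_pos hlam
  have : 0 < Real.Gamma (lam + 1 / 2) := Real.Gamma_pos_of_pos (by positivity)
  have : 0 < Real.Gamma (k + lam + 1 / 2) := Real.Gamma_pos_of_pos (by positivity)
  have : 0 ≤ (x / (2 * t)) ^ (2 * k) := (even_two_mul k).pow_nonneg _
  unfold heatSeriesTerm
  positivity

theorem integral_heatSeriesTerm (hlam : 0 ≤ lam) (ht : 0 < t) (x : ℝ) (k : ℕ) :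
    ∫ y in Ioi (0 : ℝ), heatSeriesTerm lam t x k y =
      Real.exp (-x ^ 2 / (4 * t)) * ((x ^ 2 / (4 * t)) ^ k / k.factorial) := by
  have : 0 < Real.Gamma (lam + 1 / 2) := Real.Gamma_pos_of_pos (by positivity)
  have : 0 < Real.Gamma (k + lam + 1 / 2) := Real.Gamma_pos_of_pos (by positivity)
  have hpow : (1 / (4 * t)) ^ (-(2 * (k : ℝ) + 2 * lam + 1) / 2) =
      4 ^ k * t ^ k * 4 ^ lam * 2 * (t ^ (-lam - 1 / 2))⁻¹ := by
    rw [one_div, Real.inv_rpow (by positivity), ← Real.rpow_neg (by positivity),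
      show -(-(2 * (k : ℝ) + 2 * lam + 1) / 2) = k + (lam + 1 / 2) by ring,
      Real.rpow_add (by positivity), Real.rpow_natCast, Real.mul_rpow four_pos.le ht.le,
      Real.rpow_add four_pos, four_rpow_one_half, mul_pow, ← Real.rpow_neg ht.le, neg_sub,
      sub_neg_eq_add, add_comm (1 / 2) lam]
    ring
  have hbase : (x / (2 * t)) ^ (2 * k) = (x ^ 2 / (4 * t)) ^ k / t ^ k := by
    rw [pow_mul, ← div_pow]
    congr 1
    field_simp
    norm_num
  simp only [heatSeriesTerm]
  rw [integral_const_mul, integral_rpow_mul_exp_neg_mul_rpow two_pos (lt_of_lt_of_le (by norm_num)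
    (by positivity : (0 : ℝ) ≤ 2 * k + 2 * lam)) (by positivity), hpow, hbase, heatConst,
    show (2 * (k : ℝ) + 2 * lam + 1) / 2 = k + lam + 1 / 2 by ring, Real.rpow_neg four_pos.le]
  field_simp

theorem hasSum_integral_heatSeriesTerm (hlam : 0 ≤ lam) (ht : 0 < t) (x : ℝ) :
    HasSum (fun k => ∫ y in Ioi (0 : ℝ), heatSeriesTerm lam t x k y) 1 := by
  simp_rw [integral_heatSeriesTerm hlam ht x]
  have hexp := NormedSpace.expSeries_div_hasSum_exp (𝔸 := ℝ) (x ^ 2 / (4 * t))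
  rw [← Real.exp_eq_exp_ℝ] at hexp
  have hone : Real.exp (-x ^ 2 / (4 * t)) * Real.exp (x ^ 2 / (4 * t)) = 1 := by
    rw [neg_div, ← Real.exp_add, neg_add_cancel, Real.exp_zero]
  exact hone ▸ hexp.mul_left (Real.exp (-x ^ 2 / (4 * t)))

theorem IsAngularMeasure.hasSum_heatSeriesTerm {m : Measure ℝ} (hm : IsAngularMeasure lam m)
    (hlam : 0 ≤ lam) (ht : 0 < t) (hx : 0 < x) (hy : 0 < y) :
    HasSum (fun k => heatSeriesTerm lam t x k y) (heatKernel lam t x y * y ^ (2 * lam)) := by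
  have hsum := ((hm.hasSum_integral_exp hlam (x * y / (2 * t))).mul_left (heatConst lam *
    t ^ (-lam - 1 / 2) * Real.exp (-(x ^ 2 + y ^ 2) / (4 * t)))).mul_right (y ^ (2 * lam))
  rw [← hm.heatKernel_eq_exp_mul hlam ht hx hy] at hsum
  refine hsum.congr_fun fun k => ?_
  have hexp : Real.exp (-(x ^ 2 + y ^ 2) / (4 * t)) =
      Real.exp (-x ^ 2 / (4 * t)) * Real.exp (-(1 / (4 * t)) * y ^ (2 : ℝ)) := by
    rw [← Real.exp_add, Real.rpow_two]
    ring_nf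
  have hpow : y ^ (2 * (k : ℝ) + 2 * lam) = y ^ (2 * k) * y ^ (2 * lam) := by
    rw [Real.rpow_add hy, ← Real.rpow_natCast]
    push_cast
    rfl
  rw [heatSeriesTerm, hexp, hpow, mul_div_right_comm, mul_pow]
  ring

theorem IsAngularMeasure.integral_heatKernel {m : Measure ℝ} (hm : IsAngularMeasure lam m)
    (hlam : 0 ≤ lam) (ht : 0 < t) (hx : 0 < x) :
    ∫ y in Ioi (0 : ℝ), heatKernel lam t x y * y ^ (2 * lam) = 1 := by
  have htsum : EqOn (fun y => ∑' k, heatSeriesTerm lam t x k y)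
      (fun y => heatKernel lam t x y * y ^ (2 * lam)) (Ioi 0) :=
    fun y hy => (hm.hasSum_heatSeriesTerm hlam ht hx hy).tsum_eq
  have hnorm : Summable fun k => ∫ y in Ioi (0 : ℝ), ‖heatSeriesTerm lam t x k y‖ :=
    (hasSum_integral_heatSeriesTerm hlam ht x).summable.congr fun k =>
      setIntegral_congr_fun measurableSet_Ioi fun y hy =>
        (Real.norm_of_nonneg (heatSeriesTerm_nonneg hlam ht x k hy)).symm
  have hsum := hasSum_integral_of_summable_integral_norm
    (integrableOn_heatSeriesTerm hlam ht x) hnorm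
  rw [setIntegral_congr_fun measurableSet_Ioi htsum] at hsum
  exact hsum.unique (hasSum_integral_heatSeriesTerm hlam ht x)

theorem IsAngularMeasure.integrableOn_heatKernel_mul {m : Measure ℝ} (hm : IsAngularMeasure lam m)
    (hlam : 0 ≤ lam) (ht : 0 < t) (hx : 0 < x) :
    IntegrableOn (fun y => heatKernel lam t x y * y ^ (2 * lam)) (Ioi 0) :=
  .of_integral_ne_zero (by rw [hm.integral_heatKernel hlam ht hx]; exact one_ne_zero)

end HeatSeries

section GammaIntegral

variable {a A : ℝ}

theorem smul_rpow_neg_one_mul_exp_eq (a A : ℝ) {s : ℝ} (hs : 0 < s) :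
    (|(-1 : ℝ)| * s ^ ((-1 : ℝ) - 1)) •
        ((s ^ (-1 : ℝ)) ^ (a - 1) * Real.exp (-(A / 4 * s ^ (-1 : ℝ)))) =
      s ^ (-a - 1) * Real.exp (-A / (4 * s)) := by
  rw [abs_neg, abs_one, one_mul, smul_eq_mul, ← Real.rpow_mul hs.le, ← mul_assoc,
    ← Real.rpow_add hs, Real.rpow_neg_one]
  congr 2
  · ring
  · field_simp

theorem integrableOn_rpow_mul_exp_neg_div (ha : 0 < a) (hA : 0 < A) :
    IntegrableOn (fun s => s ^ (-a - 1) * Real.exp (-A / (4 * s))) (Ioi 0) := by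
  have hint : IntegrableOn (fun r => r ^ (a - 1) * Real.exp (-(A / 4 * r))) (Ioi 0) := by
    simpa only [neg_mul, Real.rpow_one] using integrableOn_rpow_mul_exp_neg_mul_rpow (p := 1)
      (s := a - 1) (b := A / 4) (by linarith) one_pos (by positivity)
  exact ((integrableOn_Ioi_comp_rpow_iff _ (neg_ne_zero.2 one_ne_zero)).2 hint).congr_fun
    (fun s hs => smul_rpow_neg_one_mul_exp_eq a A hs) measurableSet_Ioi

theorem integral_rpow_mul_exp_neg_div (ha : 0 < a) (hA : 0 < A) :
    ∫ s in Ioi (0 : ℝ), s ^ (-a - 1) * Real.exp (-A / (4 * s)) = (4 / A) ^ a * Real.Gamma a := by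
  rw [← setIntegral_congr_fun measurableSet_Ioi
      (fun s hs => smul_rpow_neg_one_mul_exp_eq a A hs),
    integral_comp_rpow_Ioi (fun r => r ^ (a - 1) * Real.exp (-(A / 4 * r)))
      (neg_ne_zero.2 one_ne_zero),
    Real.integral_rpow_mul_exp_neg_mul_Ioi ha (by positivity), one_div_div]

end GammaIntegral

section Subordination

variable {lam t x y s : ℝ}

/-- The density of the subordination formula
`exp (-t √Δ) = ∫₀^∞ poissonSubordinator t s • exp (-s Δ) ds`. -/
noncomputable def poissonSubordinator (t s : ℝ) : ℝ :=
  t / √(4 * Real.pi) * (s ^ (-(1 / 2) - 1 : ℝ) * Real.exp (-t ^ 2 / (4 * s)))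

theorem measurable_poissonSubordinator (t : ℝ) : Measurable (poissonSubordinator t) := by
  unfold poissonSubordinator
  fun_prop

theorem poissonSubordinator_nonneg (ht : 0 < t) (hs : 0 < s) : 0 ≤ poissonSubordinator t s := by
  unfold poissonSubordinator
  positivity

theorem integrableOn_poissonSubordinator (ht : 0 < t) :
    IntegrableOn (poissonSubordinator t) (Ioi 0) :=
  (integrableOn_rpow_mul_exp_neg_div one_half_pos (by positivity)).const_mul _

theorem integral_poissonSubordinator (ht : 0 < t) :
    ∫ s in Ioi (0 : ℝ), poissonSubordinator t s = 1 := by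
  have : 0 < √Real.pi := Real.sqrt_pos.2 Real.pi_pos
  simp only [poissonSubordinator]
  rw [integral_const_mul, integral_rpow_mul_exp_neg_div one_half_pos (by positivity),
    Real.Gamma_one_half_eq, ← Real.sqrt_eq_rpow, Real.sqrt_div' _ (by positivity),
    Real.sqrt_sq ht.le, Real.sqrt_mul four_pos.le]
  field_simp

theorem poissonKernel_eq_integral_poissonSubordinator (lam t x y : ℝ) :
    poissonKernel lam t x y =
      ∫ s in Ioi (0 : ℝ), poissonSubordinator t s * heatKernel lam s x y := by
  rw [poissonKernel, ← integral_const_mul]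
  refine setIntegral_congr_fun measurableSet_Ioi fun s hs => ?_
  simp only [poissonSubordinator]
  rw [show (-(1 / 2) - 1 : ℝ) = -(3 / 2) by norm_num, Real.rpow_neg (mem_Ioi.1 hs).le]
  ring

end Subordination

section PoissonPhase

variable {t x y s : ℝ}

/-- The quantity `t² + x² + y² - 2xys` whose powers the Poisson kernel averages over `s`. -/
def poissonPhase (t x y s : ℝ) : ℝ :=
  t ^ 2 + x ^ 2 + y ^ 2 - 2 * x * y * s

theorem le_poissonPhase (t : ℝ) (hx : 0 < x) (hy : 0 < y) (hs : s ∈ Icc (-1 : ℝ) 1) :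
    t ^ 2 + (y - x) ^ 2 ≤ poissonPhase t x y s := by
  have : 0 < x * y := mul_pos hx hy
  unfold poissonPhase
  nlinarith [hs.2]

theorem poissonPhase_le (t : ℝ) (hx : 0 < x) (hy : 0 < y) (hs : s ∈ Icc (-1 : ℝ) 1) :
    poissonPhase t x y s ≤ t ^ 2 + (x + y) ^ 2 := by
  have : 0 < x * y := mul_pos hx hy
  unfold poissonPhase
  nlinarith [hs.1]

theorem poissonPhase_pos (ht : 0 < t) (hx : 0 < x) (hy : 0 < y) (hs : s ∈ Icc (-1 : ℝ) 1) :
    0 < poissonPhase t x y s :=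
  lt_of_lt_of_le (by positivity) (le_poissonPhase t hx hy hs)

theorem continuousOn_poissonPhase_rpow (a : ℝ) (ht : 0 < t) (hx : 0 < x) (hy : 0 < y) :
    ContinuousOn (fun s : ℝ => poissonPhase t x y s ^ a) (Icc (-1) 1) := by
  refine ContinuousOn.rpow_const ?_ fun s hs => Or.inl (poissonPhase_pos ht hx hy hs).ne'
  unfold poissonPhase
  fun_prop

end PoissonPhase

section PoissonKernel

variable {lam t x y : ℝ} {m : Measure ℝ}

/-- The normalizing constant of the Poisson kernel. -/
noncomputable def poissonConst (lam : ℝ) : ℝ :=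
  heatConst lam * 4 ^ (lam + 1) * Real.Gamma (lam + 1) / √(4 * Real.pi)

theorem poissonConst_pos (hlam : 0 ≤ lam) : 0 < poissonConst lam := by
  have := heatConst_pos hlam
  have := Real.Gamma_pos_of_pos (show 0 < lam + 1 by positivity)
  have := Real.pi_pos
  unfold poissonConst
  positivity

namespace IsAngularMeasure

theorem ae_prod_mem (hm : IsAngularMeasure lam m) :
    ∀ᵐ w : ℝ × ℝ ∂((volume.restrict (Ioi (0 : ℝ))).prod m), 0 < w.1 ∧ w.2 ∈ Icc (-1 : ℝ) 1 := by
  have := hm.prob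
  filter_upwards [Measure.quasiMeasurePreserving_fst.ae (ae_restrict_mem measurableSet_Ioi),
    Measure.quasiMeasurePreserving_snd.ae hm.mem] with w hpos hmem using ⟨hpos, hmem⟩

theorem poissonSubordinator_mul_heatKernel_eq (hm : IsAngularMeasure lam m) (hlam : 0 ≤ lam)
    (t : ℝ) (hx : 0 < x) (hy : 0 < y) {s : ℝ} (hs : 0 < s) :
    poissonSubordinator t s * heatKernel lam s x y = t / √(4 * Real.pi) * heatConst lam *
      ∫ r, s ^ (-(lam + 1) - 1) * Real.exp (-poissonPhase t x y r / (4 * s)) ∂m := by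
  have hpow : s ^ (-(lam + 1) - 1) = s ^ (-lam - 1 / 2) * s ^ (-(1 / 2) - 1 : ℝ) := by
    rw [← Real.rpow_add hs]
    ring_nf
  have hexp : ∀ r, Real.exp (-poissonPhase t x y r / (4 * s)) = Real.exp (-t ^ 2 / (4 * s)) *
      Real.exp (-(x ^ 2 + y ^ 2 - 2 * x * y * r) / (4 * s)) := fun r => by
    rw [← Real.exp_add, poissonPhase]
    ring_nf
  simp_rw [hexp]
  rw [hm.heatKernel_eq hlam hs hx hy, integral_const_mul, integral_const_mul,
    poissonSubordinator, hpow]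
  ring

theorem integrable_rpow_mul_exp_neg_poissonPhase_div (hm : IsAngularMeasure lam m)
    (hlam : 0 ≤ lam) (ht : 0 < t) (hx : 0 < x) (hy : 0 < y) :
    Integrable (Function.uncurry fun s r : ℝ => s ^ (-(lam + 1) - 1) *
      Real.exp (-poissonPhase t x y r / (4 * s))) ((volume.restrict (Ioi (0 : ℝ))).prod m) := by
  have := hm.prob
  have hdom := integrableOn_rpow_mul_exp_neg_div (a := lam + 1) (A := t ^ 2) (by positivity)
    (by positivity)
  refine Integrable.mono' (hdom.comp_fst m) ?_ ?_
  · refine Measurable.aestronglyMeasurable ?_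
    unfold Function.uncurry poissonPhase
    fun_prop
  · filter_upwards [hm.ae_prod_mem] with w ⟨hs, hr⟩
    rw [Function.uncurry, Real.norm_of_nonneg (by positivity)]
    gcongr
    exact (le_add_of_nonneg_right (sq_nonneg _)).trans (le_poissonPhase t hx hy hr)

theorem poissonKernel_eq (hm : IsAngularMeasure lam m) (hlam : 0 ≤ lam)
    (ht : 0 < t) (hx : 0 < x) (hy : 0 < y) :
    poissonKernel lam t x y =
      poissonConst lam * t * ∫ s, poissonPhase t x y s ^ (-lam - 1) ∂m := by
  have := hm.prob
  have hinner : ∀ᵐ r ∂m, ∫ s in Ioi (0 : ℝ), s ^ (-(lam + 1) - 1) *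
      Real.exp (-poissonPhase t x y r / (4 * s)) =
        4 ^ (lam + 1) * Real.Gamma (lam + 1) * poissonPhase t x y r ^ (-lam - 1) := by
    filter_upwards [hm.mem] with r hr
    have hphase := poissonPhase_pos ht hx hy hr
    rw [integral_rpow_mul_exp_neg_div (by positivity) hphase, Real.div_rpow four_pos.le hphase.le,
      show -lam - 1 = -(lam + 1) by ring, Real.rpow_neg hphase.le]
    ring
  rw [poissonKernel_eq_integral_poissonSubordinator, setIntegral_congr_fun measurableSet_Ioi
      fun s hs => hm.poissonSubordinator_mul_heatKernel_eq hlam t hx hy hs,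
    integral_const_mul, integral_integral_swap
      (hm.integrable_rpow_mul_exp_neg_poissonPhase_div hlam ht hx hy),
    integral_congr_ae hinner, integral_const_mul, poissonConst]
  ring

theorem le_poissonKernel (hm : IsAngularMeasure lam m) (hlam : 0 ≤ lam)
    (ht : 0 < t) (hx : 0 < x) (hy : 0 < y) :
    poissonConst lam * t * (t ^ 2 + (x + y) ^ 2) ^ (-lam - 1) ≤ poissonKernel lam t x y := by
  have := hm.prob
  have := poissonConst_pos hlam
  rw [hm.poissonKernel_eq hlam ht hx hy]
  gcongr
  calc (t ^ 2 + (x + y) ^ 2) ^ (-lam - 1) = ∫ _, (t ^ 2 + (x + y) ^ 2) ^ (-lam - 1) ∂m := by simp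
    _ ≤ ∫ s, poissonPhase t x y s ^ (-lam - 1) ∂m := by
        refine integral_mono_ae (integrable_const _)
          (hm.integrable (continuousOn_poissonPhase_rpow _ ht hx hy)) ?_
        filter_upwards [hm.mem] with s hs
        exact Real.rpow_le_rpow_of_nonpos (poissonPhase_pos ht hx hy hs)
          (poissonPhase_le t hx hy hs) (by linarith)

theorem poissonKernel_nonneg (hm : IsAngularMeasure lam m) (hlam : 0 ≤ lam)
    (ht : 0 < t) (hx : 0 < x) (hy : 0 < y) : 0 ≤ poissonKernel lam t x y := by
  have := poissonConst_pos hlam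
  exact le_trans (by positivity) (hm.le_poissonKernel hlam ht hx hy)

theorem poissonKernel_le (hm : IsAngularMeasure lam m) (hlam : 0 ≤ lam)
    (ht : 0 < t) (hx : 0 < x) (hy : 0 < y) :
    poissonKernel lam t x y ≤ poissonConst lam * t * (t ^ 2 + (y - x) ^ 2) ^ (-lam - 1) := by
  have := hm.prob
  have := poissonConst_pos hlam
  rw [hm.poissonKernel_eq hlam ht hx hy]
  gcongr
  calc ∫ s, poissonPhase t x y s ^ (-lam - 1) ∂m
      ≤ ∫ _, (t ^ 2 + (y - x) ^ 2) ^ (-lam - 1) ∂m := by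
        refine integral_mono_ae (hm.integrable (continuousOn_poissonPhase_rpow _ ht hx hy))
          (integrable_const _) ?_
        filter_upwards [hm.mem] with s hs
        exact Real.rpow_le_rpow_of_nonpos (by positivity) (le_poissonPhase t hx hy hs)
          (by linarith)
    _ = (t ^ 2 + (y - x) ^ 2) ^ (-lam - 1) := by simp

theorem exists_poissonKernel_mul_le_poissonProfile (hm : IsAngularMeasure lam m)
    (hlam : 0 ≤ lam) :
    ∃ C, 0 < C ∧ ∀ t x y, 0 < t → 0 < x → 0 < y → y ≤ 2 * x →
      poissonKernel lam t x y * y ^ (2 * lam) ≤ C * poissonProfile t (y - x) := by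
  obtain ⟨C, hC, hle⟩ := hm.exists_heatKernel_mul_le hlam
  refine ⟨C / √(4 * Real.pi) * 4, by positivity, ?_⟩
  intro t x y ht hx hy hyx
  have hA : 0 < t ^ 2 + (y - x) ^ 2 := by positivity
  have hle_subordinated : ∀ s > 0, poissonSubordinator t s * heatKernel lam s x y * y ^ (2 * lam) ≤
      C * t / √(4 * Real.pi) *
        (s ^ (-1 - 1 : ℝ) * Real.exp (-(t ^ 2 + (y - x) ^ 2) / (4 * s))) := by
    intro s hs
    have hpow : s ^ (-1 - 1 : ℝ) = s ^ (-(1 / 2) - 1 : ℝ) * s ^ (-(1 / 2) : ℝ) := by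
      rw [← Real.rpow_add hs]
      norm_num
    have hexp : Real.exp (-(t ^ 2 + (y - x) ^ 2) / (4 * s)) =
        Real.exp (-t ^ 2 / (4 * s)) * Real.exp (-(y - x) ^ 2 / (4 * s)) := by
      rw [← Real.exp_add, neg_add, add_div]
    rw [mul_assoc, hpow, hexp]
    refine (mul_le_mul_of_nonneg_left (hle s x y hs hx hy hyx)
      (poissonSubordinator_nonneg ht hs)).trans_eq ?_
    rw [poissonSubordinator]
    ring
  rw [poissonKernel_eq_integral_poissonSubordinator, ← integral_mul_const]
  calc ∫ s in Ioi (0 : ℝ), poissonSubordinator t s * heatKernel lam s x y * y ^ (2 * lam)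
      ≤ ∫ s in Ioi (0 : ℝ), C * t / √(4 * Real.pi) *
          (s ^ (-1 - 1 : ℝ) * Real.exp (-(t ^ 2 + (y - x) ^ 2) / (4 * s))) := by
        refine integral_mono_of_nonneg ?_
          ((integrableOn_rpow_mul_exp_neg_div one_pos hA).const_mul _) ?_
        all_goals filter_upwards [ae_restrict_mem measurableSet_Ioi] with s (hs : 0 < s)
        · exact mul_nonneg (mul_nonneg (poissonSubordinator_nonneg ht hs)
            (hm.heatKernel_nonneg hlam hs hx hy)) (by positivity)
        · exact hle_subordinated s hs
    _ = C / √(4 * Real.pi) * 4 * poissonProfile t (y - x) := by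
        rw [integral_const_mul, integral_rpow_mul_exp_neg_div one_pos hA, Real.rpow_one,
          Real.Gamma_one, poissonProfile]
        ring

theorem aestronglyMeasurable_heatKernel (hm : IsAngularMeasure lam m) (hlam : 0 ≤ lam)
    (hx : 0 < x) :
    AEStronglyMeasurable (fun w : ℝ × ℝ => heatKernel lam w.1 x w.2)
      ((volume.restrict (Ioi (0 : ℝ))).prod (volume.restrict (Ioi (0 : ℝ)))) := by
  have := hm.prob
  have hmeas : Measurable fun w : ℝ × ℝ =>
      ∫ r, Real.exp (-(x ^ 2 + w.2 ^ 2 - 2 * x * w.2 * r) / (4 * w.1)) ∂m :=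
    (StronglyMeasurable.integral_prod_right' (f := fun w : (ℝ × ℝ) × ℝ =>
      Real.exp (-(x ^ 2 + w.1.2 ^ 2 - 2 * x * w.1.2 * w.2) / (4 * w.1.1)))
      (Measurable.stronglyMeasurable (by fun_prop))).measurable
  have hformula : Measurable fun w : ℝ × ℝ => heatConst lam * w.1 ^ (-lam - 1 / 2) *
      ∫ r, Real.exp (-(x ^ 2 + w.2 ^ 2 - 2 * x * w.2 * r) / (4 * w.1)) ∂m := by fun_prop
  refine hformula.aestronglyMeasurable.congr ?_
  filter_upwards [Measure.quasiMeasurePreserving_fst.ae (ae_restrict_mem measurableSet_Ioi),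
    Measure.quasiMeasurePreserving_snd.ae (ae_restrict_mem measurableSet_Ioi)] with w hs hy
  exact (hm.heatKernel_eq hlam hs hx hy).symm

theorem integrable_poissonSubordinator_mul_heatKernel (hm : IsAngularMeasure lam m)
    (hlam : 0 ≤ lam) (ht : 0 < t) (hx : 0 < x) :
    Integrable (Function.uncurry fun s y : ℝ =>
        poissonSubordinator t s * heatKernel lam s x y * y ^ (2 * lam))
      ((volume.restrict (Ioi (0 : ℝ))).prod (volume.restrict (Ioi (0 : ℝ)))) := by
  have hmeas : AEStronglyMeasurable (fun w : ℝ × ℝ =>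
      poissonSubordinator t w.1 * heatKernel lam w.1 x w.2 * w.2 ^ (2 * lam))
      ((volume.restrict (Ioi (0 : ℝ))).prod (volume.restrict (Ioi (0 : ℝ)))) :=
    (((measurable_poissonSubordinator t).comp measurable_fst).aestronglyMeasurable.mul
      (hm.aestronglyMeasurable_heatKernel hlam hx)).mul
      (measurable_snd.pow_const _).aestronglyMeasurable
  refine (integrable_prod_iff hmeas).2 ⟨?_, (integrableOn_poissonSubordinator ht).congr ?_⟩
  all_goals filter_upwards [ae_restrict_mem measurableSet_Ioi] with s (hs : 0 < s)
  · simp only [mul_assoc]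
    exact (hm.integrableOn_heatKernel_mul hlam hs hx).const_mul _
  · have hnorm : ∀ y ∈ Ioi (0 : ℝ),
        ‖poissonSubordinator t s * heatKernel lam s x y * y ^ (2 * lam)‖ =
          poissonSubordinator t s * (heatKernel lam s x y * y ^ (2 * lam)) := by
      intro y (hy : 0 < y)
      have := hm.heatKernel_nonneg hlam hs hx hy
      have := poissonSubordinator_nonneg ht hs
      rw [Real.norm_of_nonneg (by positivity), mul_assoc]
    rw [setIntegral_congr_fun measurableSet_Ioi hnorm, integral_const_mul,
      hm.integral_heatKernel hlam hs hx, mul_one]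

theorem integral_poissonKernel (hm : IsAngularMeasure lam m) (hlam : 0 ≤ lam)
    (ht : 0 < t) (hx : 0 < x) :
    ∫ y in Ioi (0 : ℝ), poissonKernel lam t x y * y ^ (2 * lam) = 1 := by
  simp_rw [poissonKernel_eq_integral_poissonSubordinator, ← integral_mul_const]
  rw [← integral_integral_swap (hm.integrable_poissonSubordinator_mul_heatKernel hlam ht hx),
    ← integral_poissonSubordinator ht]
  refine setIntegral_congr_fun measurableSet_Ioi fun s hs => ?_
  simp_rw [mul_assoc]
  rw [integral_const_mul, hm.integral_heatKernel hlam hs hx, mul_one]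

end IsAngularMeasure

end PoissonKernel

section TimeInterval

variable {T : EReal}

theorem exists_mem_timeInterval (hT : 0 < T) : ∃ t, t ∈ timeInterval T := by
  obtain ⟨r, hr0, hr⟩ := EReal.lt_iff_exists_real_btwn.1 hT
  exact ⟨r, by exact_mod_cast hr0, hr⟩

theorem exists_gt_mem_timeInterval {t : ℝ} (ht : t ∈ timeInterval T) :
    ∃ t' ∈ timeInterval T, t < t' := by
  obtain ⟨r, hr0, hr⟩ := EReal.lt_iff_exists_real_btwn.1 ht.2
  have htr : t < r := by exact_mod_cast hr0
  exact ⟨r, ⟨ht.1.trans htr, hr⟩, htr⟩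

theorem mem_timeInterval_of_le {s t : ℝ} (ht : t ∈ timeInterval T) (hs : 0 < s) (hst : s ≤ t) :
    s ∈ timeInterval T :=
  ⟨hs, lt_of_le_of_lt (by exact_mod_cast hst) ht.2⟩

theorem isOpen_timeInterval (T : EReal) : IsOpen (timeInterval T) :=
  isOpen_Ioi.inter (isOpen_Iio.preimage continuous_coe_real_ereal)

theorem eventually_mem_timeInterval (hT : 0 < T) : ∀ᶠ t in 𝓝[>] (0 : ℝ), t ∈ timeInterval T := by
  obtain ⟨t, ht⟩ := exists_mem_timeInterval hT
  filter_upwards [Ioc_mem_nhdsGT ht.1] with s hs using mem_timeInterval_of_le ht hs.1 hs.2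

end TimeInterval

theorem hasInitialData_kernelIntegral {lam C : ℝ} {K : ℝ → ℝ → ℝ → ℝ} {f φ τ : ℝ → ℝ}
    (hf : AEStronglyMeasurable f (volume.restrict (Ioi 0)))
    (hφ : ContinuousOn φ (Ioi 0)) (hφ_ne : ∀ y, 0 < y → φ y ≠ 0) (hφ_int : IntegrableOn φ (Ioi 0))
    (hφf : IntegrableOn (fun y => φ y * f y) (Ioi 0)) (hC : 0 < C)
    (hτ : ∀ᶠ t in 𝓝[>] 0, 0 < τ t)
    (hKf : ∀ x, 0 < x → ∀ᶠ t in 𝓝[>] 0,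
      IntegrableOn (fun y => K t x y * f y * y ^ (2 * lam)) (Ioi 0))
    (hK : ∀ x, 0 < x → ∀ᶠ t in 𝓝[>] 0, ∫ y in Ioi (0 : ℝ), K t x y * y ^ (2 * lam) = 1)
    (hnear : ∀ x, 0 < x → ∀ᶠ t in 𝓝[>] 0, ∀ y, 0 < y → y ≤ 2 * x →
      |K t x y * y ^ (2 * lam)| ≤ C * poissonProfile (τ t) (y - x))
    (hfar : ∀ x δ, 0 < x → 0 < δ → ∃ η : ℝ → ℝ, Tendsto η (𝓝[>] 0) (𝓝 0) ∧
      ∀ᶠ t in 𝓝[>] 0, ∀ y, 0 < y → δ < |y - x| → |K t x y * y ^ (2 * lam)| ≤ η t * φ y) :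
    HasInitialData (kernelIntegral lam K f) f := by
  have hf_loc : LocallyIntegrableOn f (Ioi 0) := by
    refine (hφf.locallyIntegrableOn.continuousOn_mul (hφ.inv₀ hφ_ne)
      isOpen_Ioi.isLocallyClosed).congr ?_
    filter_upwards [ae_restrict_mem measurableSet_Ioi] with y hy
    exact inv_mul_cancel_left₀ (hφ_ne y hy) (f y)
  filter_upwards [ae_restrict_isLebesguePoint isOpen_Ioi hf_loc,
    ae_restrict_mem measurableSet_Ioi] with x hfx (hx : 0 < x)
  have hball : Metric.closedBall x (x / 2) ⊆ Ioi 0 := fun y hy => by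
    have := (Real.closedBall_eq_Icc ▸ hy : y ∈ Icc _ _).1
    exact mem_Ioi.2 (by linarith)
  have hswap (t x : ℝ) : (fun y => K t x y * f y * y ^ (2 * lam)) =
      fun y => K t x y * y ^ (2 * lam) * f y := by ext; ring
  simp only [kernelIntegral, hswap] at hKf ⊢
  refine tendsto_setIntegral_mul_of_tendsto_setLIntegral_enorm (hKf x hx) (hK x hx)
    (tendsto_setLIntegral_enorm_mul_sub_of_isLebesguePoint measurableSet_Ioi hf hfx hC (half_pos hx)
      hball hτ ?_ fun δ hδ => ?_)
  · filter_upwards [hnear x hx] with t ht y hy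
    have := (Real.closedBall_eq_Icc ▸ hy : y ∈ Icc _ _).2
    exact ht y (hball hy) (by linarith)
  · obtain ⟨η, hη, hηφ⟩ := hfar x δ hx hδ
    exact ⟨η, φ, hη, hφ_int, hφf, hηφ⟩

/-- A family of functions `Φ (y, s)` on `(0, ∞) × [-1, 1]`, each valued in the partial derivatives
of a smooth function on `U`, which is dominated, locally uniformly on `U`, by the factors `φ ∈ S`
with respect to `y^{2λ}`. The kernels of the heat and Poisson semigroups are averages over `s` of
such families, and the factors are the ones integrability is tested against. -/
structure IsAngularFamily (lam : ℝ) (U : Set (ℝ × ℝ)) (S : Set (ℝ → ℝ))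
    (Φ : ℝ × ℝ → ℕ → ℕ → ℝ × ℝ → ℝ) : Prop where
  isOpen : IsOpen U
  measurable : ∀ j k, ∀ q, Measurable fun w => Φ w j k q
  isPartialDerivFamily : ∀ w : ℝ × ℝ, 0 < w.1 → w.2 ∈ Icc (-1) 1 → IsPartialDerivFamily (Φ w) U
  dominated : ∀ j k, ∀ q ∈ U, ∃ φ ∈ S, ∃ V ∈ 𝓝 q, ∃ C, ∀ w : ℝ × ℝ, 0 < w.1 → w.2 ∈ Icc (-1) 1 →
    ∀ q' ∈ V, |Φ w j k q'| * w.1 ^ (2 * lam) ≤ C * φ w.1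

/-- The integral of an angular family against `f(y) y^{2λ} dy dm(s)`. -/
noncomputable def angularTransform (lam : ℝ) (m : Measure ℝ)
    (Φ : ℝ × ℝ → ℕ → ℕ → ℝ × ℝ → ℝ) (f : ℝ → ℝ) (j k : ℕ) (q : ℝ × ℝ) : ℝ :=
  ∫ w, Φ w j k q * (f w.1 * w.1 ^ (2 * lam)) ∂((volume.restrict (Ioi 0)).prod m)

theorem IsPartialDerivFamily.mul_const {G : ℕ → ℕ → ℝ × ℝ → ℝ} {U : Set (ℝ × ℝ)}
    (hG : IsPartialDerivFamily G U) (c : ℝ) : IsPartialDerivFamily (fun j k q => G j k q * c) U :=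
  fun j k q hq => ((hG j k q hq).mul_const c).congr_fderiv <| by
    simp only [smul_add, smul_smul, mul_comm c]

namespace IsAngularFamily

variable {lam : ℝ} {m : Measure ℝ} {U : Set (ℝ × ℝ)} {S : Set (ℝ → ℝ)}
  {Φ : ℝ × ℝ → ℕ → ℕ → ℝ × ℝ → ℝ} {f : ℝ → ℝ} {q : ℝ × ℝ}

theorem aestronglyMeasurable_mul [SFinite m] (hΦ : IsAngularFamily lam U S Φ)
    (hf : AEStronglyMeasurable f (volume.restrict (Ioi 0))) (j k : ℕ) (q : ℝ × ℝ) :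
    AEStronglyMeasurable (fun w => Φ w j k q * (f w.1 * w.1 ^ (2 * lam)))
      ((volume.restrict (Ioi 0)).prod m) :=
  (hΦ.measurable j k q).aestronglyMeasurable.mul
    (hf.comp_fst.mul (Measurable.aestronglyMeasurable (by fun_prop)))

theorem exists_integrable_bound (hΦ : IsAngularFamily lam U S Φ) (hm : IsAngularMeasure lam m)
    (hfS : ∀ φ ∈ S, IntegrableOn (fun y => φ y * f y) (Ioi 0)) (j k : ℕ) (hq : q ∈ U) :
    ∃ V ∈ 𝓝 q, ∃ bound : ℝ × ℝ → ℝ, Integrable bound ((volume.restrict (Ioi 0)).prod m) ∧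
      ∀ᵐ w ∂((volume.restrict (Ioi 0)).prod m), ∀ q' ∈ V,
        |Φ w j k q' * (f w.1 * w.1 ^ (2 * lam))| ≤ bound w := by
  have := hm.prob
  obtain ⟨φ, hφ, V, hV, C, hle⟩ := hΦ.dominated j k q hq
  refine ⟨V, hV, fun w => |C * (φ w.1 * f w.1)|,
    ((hfS φ hφ).const_mul C).abs.comp_fst m, ?_⟩
  filter_upwards [hm.ae_prod_mem] with w ⟨hy, hs⟩ q' hq'
  calc |Φ w j k q' * (f w.1 * w.1 ^ (2 * lam))|
      = |Φ w j k q'| * w.1 ^ (2 * lam) * |f w.1| := by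
        rw [abs_mul, abs_mul, abs_of_pos (Real.rpow_pos_of_pos hy _)]; ring
    _ ≤ |C * φ w.1| * |f w.1| :=
        mul_le_mul_of_nonneg_right ((hle w hy hs q' hq').trans (le_abs_self _)) (abs_nonneg _)
    _ = |C * (φ w.1 * f w.1)| := by rw [← abs_mul, mul_assoc]

theorem integrable_mul (hΦ : IsAngularFamily lam U S Φ) (hm : IsAngularMeasure lam m)
    (hf : AEStronglyMeasurable f (volume.restrict (Ioi 0)))
    (hfS : ∀ φ ∈ S, IntegrableOn (fun y => φ y * f y) (Ioi 0)) (j k : ℕ) (hq : q ∈ U) :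
    Integrable (fun w => Φ w j k q * (f w.1 * w.1 ^ (2 * lam)))
      ((volume.restrict (Ioi 0)).prod m) := by
  have := hm.prob
  obtain ⟨V, hV, bound, hbound, hle⟩ := hΦ.exists_integrable_bound hm hfS j k hq
  refine hbound.mono' (hΦ.aestronglyMeasurable_mul hf j k q) ?_
  filter_upwards [hle] with w hw using hw q (mem_of_mem_nhds hV)

theorem isPartialDerivFamily_angularTransform (hΦ : IsAngularFamily lam U S Φ)
    (hm : IsAngularMeasure lam m) (hf : AEStronglyMeasurable f (volume.restrict (Ioi 0)))
    (hfS : ∀ φ ∈ S, IntegrableOn (fun y => φ y * f y) (Ioi 0)) :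
    IsPartialDerivFamily (angularTransform lam m Φ f) U := by
  have := hm.prob
  refine isPartialDerivFamily_integral hΦ.isOpen
    (F := fun w j k q => Φ w j k q * (f w.1 * w.1 ^ (2 * lam)))
    (fun j k q _ => hΦ.aestronglyMeasurable_mul hf j k q) ?_
    fun j k q hq => hΦ.exists_integrable_bound hm hfS j k hq
  filter_upwards [hm.ae_prod_mem] with w ⟨hy, hs⟩
  exact (hΦ.isPartialDerivFamily w hy hs).mul_const _

theorem integrableOn_integral_mul (hΦ : IsAngularFamily lam U S Φ) (hm : IsAngularMeasure lam m)
    (hf : AEStronglyMeasurable f (volume.restrict (Ioi 0)))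
    (hfS : ∀ φ ∈ S, IntegrableOn (fun y => φ y * f y) (Ioi 0)) (j k : ℕ) (hq : q ∈ U) :
    IntegrableOn (fun y => (∫ s, Φ (y, s) j k q ∂m) * (f y * y ^ (2 * lam))) (Ioi 0) := by
  have := hm.prob
  simpa only [IntegrableOn, integral_mul_const] using
    (hΦ.integrable_mul hm hf hfS j k hq).integral_prod_left

theorem angularTransform_eq (hΦ : IsAngularFamily lam U S Φ) (hm : IsAngularMeasure lam m)
    (hf : AEStronglyMeasurable f (volume.restrict (Ioi 0)))
    (hfS : ∀ φ ∈ S, IntegrableOn (fun y => φ y * f y) (Ioi 0)) (j k : ℕ) (hq : q ∈ U) :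
    angularTransform lam m Φ f j k q =
      ∫ y in Ioi (0 : ℝ), (∫ s, Φ (y, s) j k q ∂m) * (f y * y ^ (2 * lam)) := by
  have := hm.prob
  simp only [angularTransform, integral_prod _ (hΦ.integrable_mul hm hf hfS j k hq),
    integral_mul_const]

theorem sum_mul_angularTransform_eq_zero {ι : Type*} [Fintype ι] {c : ι → ℝ} {j k : ι → ℕ}
    (hΦ : IsAngularFamily lam U S Φ) (hm : IsAngularMeasure lam m)
    (hf : AEStronglyMeasurable f (volume.restrict (Ioi 0)))
    (hfS : ∀ φ ∈ S, IntegrableOn (fun y => φ y * f y) (Ioi 0)) (hq : q ∈ U)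
    (hc : ∀ y, 0 < y → ∫ s, ∑ i, c i * Φ (y, s) (j i) (k i) q ∂m = 0) :
    ∑ i, c i * angularTransform lam m Φ f (j i) (k i) q = 0 := by
  have := hm.prob
  have hint (i : ι) := (hΦ.integrable_mul hm hf hfS (j i) (k i) hq).const_mul (c i)
  simp only [angularTransform, ← integral_const_mul]
  rw [← integral_finsetSum _ fun i _ => hint i,
    integral_prod _ (integrable_finsetSum _ fun i _ => hint i)]
  refine setIntegral_eq_zero_of_forall_eq_zero fun y hy => ?_
  simp only [← mul_assoc, ← Finset.sum_mul, integral_mul_const]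
  rw [hc y hy, zero_mul, zero_mul]

theorem integrableOn_kernel_mul {K : ℝ → ℝ} {A : ℝ}
    (hΦ : IsAngularFamily lam U S Φ) (hm : IsAngularMeasure lam m)
    (hf : AEStronglyMeasurable f (volume.restrict (Ioi 0)))
    (hfS : ∀ φ ∈ S, IntegrableOn (fun y => φ y * f y) (Ioi 0)) (hq : q ∈ U)
    (hK : ∀ y, 0 < y → K y = A * ∫ s, Φ (y, s) 0 0 q ∂m) :
    IntegrableOn (fun y => K y * f y * y ^ (2 * lam)) (Ioi 0) := by
  refine IntegrableOn.congr_fun ((hΦ.integrableOn_integral_mul hm hf hfS 0 0 hq).const_mul A)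
    (fun y hy => ?_) measurableSet_Ioi
  simp only [hK y hy]
  ring

theorem setIntegral_kernel_mul {K : ℝ → ℝ} {A : ℝ}
    (hΦ : IsAngularFamily lam U S Φ) (hm : IsAngularMeasure lam m)
    (hf : AEStronglyMeasurable f (volume.restrict (Ioi 0)))
    (hfS : ∀ φ ∈ S, IntegrableOn (fun y => φ y * f y) (Ioi 0)) (hq : q ∈ U)
    (hK : ∀ y, 0 < y → K y = A * ∫ s, Φ (y, s) 0 0 q ∂m) :
    ∫ y in Ioi (0 : ℝ), K y * f y * y ^ (2 * lam) = A * angularTransform lam m Φ f 0 0 q := by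
  rw [hΦ.angularTransform_eq hm hf hfS 0 0 hq, ← integral_const_mul]
  refine setIntegral_congr_fun measurableSet_Ioi fun y hy => ?_
  simp only [hK y hy]
  ring

end IsAngularFamily

theorem besselOp_congr {lam x : ℝ} {g h : ℝ → ℝ} (hgh : g =ᶠ[𝓝 x] h) :
    besselOp lam g x = besselOp lam h x := by
  rw [besselOp, besselOp, hgh.deriv.deriv_eq, hgh.deriv_eq]

section HeatFactor

variable {lam t y : ℝ}

theorem heatFactor_eq (hy : 0 < y) :
    heatFactor lam t y = y ^ (2 * lam) * (1 + y) ^ (-lam) * Real.exp (-y ^ 2 / (4 * t)) := by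
  rw [heatFactor, Real.div_rpow hy.le (by positivity), two_mul, Real.rpow_add hy,
    Real.rpow_neg (by positivity), add_comm 1 y]
  ring

theorem heatFactor_pos (hy : 0 < y) : 0 < heatFactor lam t y := by
  rw [heatFactor_eq hy]
  positivity

theorem continuousOn_heatFactor (lam t : ℝ) : ContinuousOn (heatFactor lam t) (Ioi 0) := by
  have hdiv : ContinuousOn (fun y : ℝ => y / (y + 1)) (Ioi 0) :=
    continuousOn_id.div (by fun_prop) fun y (hy : 0 < y) => by positivity
  exact ((continuousOn_id.rpow_const fun y hy => Or.inl (ne_of_gt hy)).mul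
    (hdiv.rpow_const fun y (hy : 0 < y) => Or.inl (by positivity))).mul (by fun_prop)

theorem heatFactor_le (hlam : 0 ≤ lam) (hy : 0 < y) :
    heatFactor lam t y ≤ y ^ (2 * lam) * Real.exp (-y ^ 2 / (4 * t)) := by
  rw [heatFactor_eq hy]
  gcongr
  exact mul_le_of_le_one_right (by positivity)
    (Real.rpow_le_one_of_one_le_of_nonpos (by linarith) (by linarith))

theorem integrableOn_heatFactor (hlam : 0 ≤ lam) (ht : 0 < t) :
    IntegrableOn (heatFactor lam t) (Ioi 0) := by
  refine (integrableOn_rpow_mul_exp_neg_mul_sq (b := 1 / (4 * t)) (by positivity)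
    (s := 2 * lam) (by linarith)).mono'
    ((continuousOn_heatFactor lam t).aestronglyMeasurable measurableSet_Ioi) ?_
  filter_upwards [ae_restrict_mem measurableSet_Ioi] with y (hy : 0 < y)
  rw [Real.norm_of_nonneg (heatFactor_pos hy).le,
    show -(1 / (4 * t)) * y ^ 2 = -y ^ 2 / (4 * t) by ring]
  exact heatFactor_le hlam hy

theorem exp_mul_sub_mul_sq_le {ε : ℝ} (hε : 0 < ε) (B y : ℝ) :
    Real.exp (B * y - ε * y ^ 2) ≤ Real.exp (B ^ 2 / (4 * ε)) := by
  rw [Real.exp_le_exp, le_div_iff₀ (by positivity)]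
  nlinarith [sq_nonneg (2 * ε * y - B)]

theorem exists_gaussian_le_heatFactor (hlam : 0 ≤ lam) {a : ℝ} (ha : 1 / (4 * t) < a)
    (B : ℝ) (n : ℕ) : ∃ C, ∀ y, 0 < y →
      y ^ n * Real.exp (-a * y ^ 2 + B * y) * y ^ (2 * lam) ≤ C * heatFactor lam t y := by
  refine ⟨Real.exp ((n + lam + B) ^ 2 / (4 * (a - 1 / (4 * t)))), fun y hy => ?_⟩
  have hpow : y ^ n ≤ Real.exp (n * y) := by
    rw [Real.exp_nat_mul]
    gcongr
    linarith [Real.add_one_le_exp y]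
  have hrpow : 1 ≤ Real.exp (lam * y) * (1 + y) ^ (-lam) := by
    rw [Real.rpow_neg (by positivity), ← div_eq_mul_inv, one_le_div (by positivity), mul_comm,
      Real.exp_mul]
    refine Real.rpow_le_rpow (by positivity) ?_ hlam
    linarith [Real.add_one_le_exp y]
  have hsquare : Real.exp (n * y) * Real.exp (lam * y) * Real.exp (-a * y ^ 2 + B * y) =
      Real.exp ((n + lam + B) * y - (a - 1 / (4 * t)) * y ^ 2) * Real.exp (-y ^ 2 / (4 * t)) := by
    rw [← Real.exp_add, ← Real.exp_add, ← Real.exp_add]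
    ring_nf
  rw [heatFactor_eq hy]
  calc y ^ n * Real.exp (-a * y ^ 2 + B * y) * y ^ (2 * lam)
      ≤ Real.exp (n * y) * Real.exp (-a * y ^ 2 + B * y) * y ^ (2 * lam) *
        (Real.exp (lam * y) * (1 + y) ^ (-lam)) := by
        refine le_trans ?_ (le_mul_of_one_le_right (by positivity) hrpow)
        gcongr
    _ = Real.exp (n * y) * Real.exp (lam * y) * Real.exp (-a * y ^ 2 + B * y) *
        (y ^ (2 * lam) * (1 + y) ^ (-lam)) := by ring
    _ = Real.exp ((n + lam + B) * y - (a - 1 / (4 * t)) * y ^ 2) *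
        (y ^ (2 * lam) * (1 + y) ^ (-lam) * Real.exp (-y ^ 2 / (4 * t))) := by
        rw [hsquare]
        ring
    _ ≤ _ := by
        gcongr ?_ * _
        exact exp_mul_sub_mul_sq_le (sub_pos.2 ha) _ _

theorem exists_heatFactor_le {m : Measure ℝ} (hm : IsAngularMeasure lam m) (hlam : 0 ≤ lam)
    (ht : 0 < t) :
    ∃ C, ∀ y, 0 < y → heatFactor lam t y ≤ C * (heatKernel lam t 1 y * y ^ (2 * lam)) := by
  have := heatConst_pos hlam
  set A := heatConst lam * t ^ (-lam - 1 / 2) * Real.exp (-1 / (4 * t)) with hA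
  have hA_pos : 0 < A := by positivity
  refine ⟨A⁻¹, fun y hy => (heatFactor_le hlam hy).trans ?_⟩
  have hle := hm.le_heatKernel hlam ht one_pos hy
  rw [show -((1 : ℝ) ^ 2 + y ^ 2) / (4 * t) = -1 / (4 * t) + -y ^ 2 / (4 * t) by ring,
    Real.exp_add, ← mul_assoc, ← hA] at hle
  rw [← div_eq_inv_mul, le_div_iff₀ hA_pos]
  calc y ^ (2 * lam) * Real.exp (-y ^ 2 / (4 * t)) * A
      = A * Real.exp (-y ^ 2 / (4 * t)) * y ^ (2 * lam) := by ring
    _ ≤ heatKernel lam t 1 y * y ^ (2 * lam) := by gcongr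

end HeatFactor

section HeatLift

/-- The open set of `(a, b)` for which `exp (-a y² + b y)` is dominated by `φ_t^λ` for some
`t ∈ (0, T)`. -/
def heatDomain (T : EReal) : Set (ℝ × ℝ) := {q | ∃ t ∈ timeInterval T, 1 / (4 * t) < q.1}

variable {lam c t x : ℝ} {T : EReal} {G : ℕ → ℕ → ℝ × ℝ → ℝ}

theorem isOpen_heatDomain (T : EReal) : IsOpen (heatDomain T) := by
  simp only [heatDomain, ← exists_prop, ofPred_exists]
  exact isOpen_iUnion fun t => isOpen_iUnion fun _ => isOpen_lt continuous_const continuous_fst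

theorem mem_heatDomain (ht : t ∈ timeInterval T) (b : ℝ) : (1 / (4 * t), b) ∈ heatDomain T := by
  obtain ⟨t', ht', htt'⟩ := exists_gt_mem_timeInterval ht
  have := ht.1
  exact ⟨t', ht', one_div_lt_one_div_of_lt (by positivity) (by linarith)⟩

/-- The Gaussian factor `c t^{-λ-1/2} e^{-x²/(4t)}` of the heat extension. -/
noncomputable def heatPrefactor (lam c t x : ℝ) : ℝ :=
  c * t ^ (-lam - 1 / 2) * Real.exp (-x ^ 2 / (4 * t))

/-- The function of `(t, x)` obtained from `G 0 0` through the substitution `a = 1/(4t)`,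
`b = x/(2t)`, which exhibits the heat kernel as a Laplace transform in `(y², s y)`. -/
noncomputable def heatLift (lam c : ℝ) (G : ℕ → ℕ → ℝ × ℝ → ℝ) (t x : ℝ) : ℝ :=
  heatPrefactor lam c t x * G 0 0 (1 / (4 * t), x / (2 * t))

theorem hasDerivAt_const_div (A : ℝ) (ht : t ≠ 0) :
    HasDerivAt (fun t => A / t) (-A / t ^ 2) t :=
  ((hasDerivAt_const t A).div (hasDerivAt_id t) ht).congr_deriv (by simp)

theorem hasDerivAt_heatPrefactor_time (lam c x : ℝ) (ht : 0 < t) :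
    HasDerivAt (fun t => heatPrefactor lam c t x)
      (heatPrefactor lam c t x * ((-lam - 1 / 2) / t + x ^ 2 / (4 * t ^ 2))) t := by
  have hpow := Real.hasDerivAt_rpow_const (p := -lam - 1 / 2) (Or.inl ht.ne')
  have hexp := (hasDerivAt_const_div (-x ^ 2 / 4) ht.ne').exp
  rw [Real.rpow_sub_one ht.ne'] at hpow
  simp only [div_div] at hexp
  refine ((hpow.const_mul c).mul hexp).congr_deriv ?_
  simp only [heatPrefactor]
  ring

theorem hasDerivAt_heatPrefactor_space (lam c t x : ℝ) :
    HasDerivAt (heatPrefactor lam c t) (heatPrefactor lam c t x * -(x / (2 * t))) x := by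
  refine ((((hasDerivAt_pow 2 x).neg.div_const (4 * t)).exp).const_mul _).congr_deriv ?_
  simp only [heatPrefactor, Pi.neg_apply]
  ring

theorem hasDerivAt_heatLift_time (hG : IsPartialDerivFamily G (heatDomain T))
    (ht : t ∈ timeInterval T) (x : ℝ) :
    HasDerivAt (fun t => heatLift lam c G t x)
      (heatPrefactor lam c t x * (((-lam - 1 / 2) / t + x ^ 2 / (4 * t ^ 2)) *
          G 0 0 (1 / (4 * t), x / (2 * t)) - G 1 0 (1 / (4 * t), x / (2 * t)) / (4 * t ^ 2) -
        x / (2 * t ^ 2) * G 0 1 (1 / (4 * t), x / (2 * t)))) t := by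
  have ha := hasDerivAt_const_div (1 / 4) ht.1.ne'
  have hb := hasDerivAt_const_div (x / 2) ht.1.ne'
  simp only [div_div] at ha hb
  refine ((hasDerivAt_heatPrefactor_time lam c x ht.1).mul
    (hG.hasDerivAt_comp 0 0 (mem_heatDomain ht _) ha hb)).congr_deriv ?_
  ring

theorem IsPartialDerivFamily.hasDerivAt_heat_space (hG : IsPartialDerivFamily G (heatDomain T))
    (ht : t ∈ timeInterval T) (k : ℕ) (x : ℝ) :
    HasDerivAt (fun x => G 0 k (1 / (4 * t), x / (2 * t)))
      (G 0 (k + 1) (1 / (4 * t), x / (2 * t)) / (2 * t)) x :=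
  (hG.hasDerivAt_comp 0 k (a := fun _ => 1 / (4 * t)) (b := fun x => x / (2 * t))
    (mem_heatDomain ht _) (hasDerivAt_const x _) ((hasDerivAt_id x).div_const _)).congr_deriv
    (by ring)

theorem hasDerivAt_heatLift_space (hG : IsPartialDerivFamily G (heatDomain T))
    (ht : t ∈ timeInterval T) (x : ℝ) :
    HasDerivAt (heatLift lam c G t) (heatPrefactor lam c t x *
      (-(x / (2 * t)) * G 0 0 (1 / (4 * t), x / (2 * t)) +
        G 0 1 (1 / (4 * t), x / (2 * t)) / (2 * t))) x :=
  ((hasDerivAt_heatPrefactor_space lam c t x).mul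
    (hG.hasDerivAt_heat_space ht 0 x)).congr_deriv (by ring)

theorem deriv_deriv_heatLift_space (hG : IsPartialDerivFamily G (heatDomain T))
    (ht : t ∈ timeInterval T) (x : ℝ) :
    deriv (deriv (heatLift lam c G t)) x = heatPrefactor lam c t x *
      ((x ^ 2 / (4 * t ^ 2) - 1 / (2 * t)) * G 0 0 (1 / (4 * t), x / (2 * t)) -
        x / (2 * t ^ 2) * G 0 1 (1 / (4 * t), x / (2 * t)) +
        G 0 2 (1 / (4 * t), x / (2 * t)) / (4 * t ^ 2)) := by
  rw [funext fun x => (hasDerivAt_heatLift_space (lam := lam) (c := c) hG ht x).deriv]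
  have hlin : HasDerivAt (fun x : ℝ => -(x / (2 * t))) (-(1 / (2 * t))) x :=
    ((hasDerivAt_id x).div_const (2 * t)).neg
  refine (((hasDerivAt_heatPrefactor_space lam c t x).mul
    ((hlin.mul (hG.hasDerivAt_heat_space ht 0 x)).add
      ((hG.hasDerivAt_heat_space ht 1 x).div_const (2 * t)))).congr_deriv ?_).deriv
  simp only [Pi.add_apply, Pi.mul_apply]
  ring

theorem heatEq_heatLift (hG : IsPartialDerivFamily G (heatDomain T))
    (hrel : ∀ q ∈ heatDomain T, q.2 * G 0 2 q + 2 * lam * G 0 1 q + q.2 * G 1 0 q = 0) :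
    HeatEq lam T (heatLift lam c G) := by
  intro t ht x hx
  rw [besselOp, (hasDerivAt_heatLift_time hG ht x).deriv, deriv_deriv_heatLift_space hG ht x,
    (hasDerivAt_heatLift_space hG ht x).deriv]
  have := ht.1
  have hrel := hrel _ (mem_heatDomain ht (x / (2 * t)))
  simp only at hrel
  have hG₁₀ : G 1 0 (1 / (4 * t), x / (2 * t)) = -G 0 2 (1 / (4 * t), x / (2 * t)) -
      4 * lam * t / x * G 0 1 (1 / (4 * t), x / (2 * t)) := by
    field_simp at hrel ⊢
    linarith
  rw [hG₁₀]
  field_simp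
  ring

theorem smoothOn_heatLift (hG : IsPartialDerivFamily G (heatDomain T)) :
    SmoothOn T (heatLift lam c G) := by
  have hne : ∀ q ∈ timeInterval T ×ˢ Ioi (0 : ℝ), q.1 ≠ 0 := fun q hq => hq.1.1.ne'
  have hpoint : ContDiffOn ℝ ∞ (fun q : ℝ × ℝ => (1 / (4 * q.1), q.2 / (2 * q.1)))
      (timeInterval T ×ˢ Ioi (0 : ℝ)) :=
    (contDiffOn_const.div (by fun_prop) fun q hq => mul_ne_zero four_ne_zero (hne q hq)).prodMk
      (contDiffOn_snd.div (by fun_prop) fun q hq => mul_ne_zero two_ne_zero (hne q hq))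
  have hexp : ContDiffOn ℝ ∞ (fun q : ℝ × ℝ => Real.exp (-q.2 ^ 2 / (4 * q.1)))
      (timeInterval T ×ˢ Ioi (0 : ℝ)) :=
    (ContDiffOn.div (by fun_prop) (by fun_prop) fun q hq =>
      mul_ne_zero four_ne_zero (hne q hq)).exp
  exact ((contDiffOn_const.mul (contDiffOn_fst.rpow_const_of_ne hne)).mul hexp).mul
    ((hG.contDiffOn (isOpen_heatDomain T) 0 0).comp hpoint fun q hq => mem_heatDomain hq.1 _)

end HeatLift

section HeatFamily

/-- The partial derivatives in `(a, b)` of `exp (-a y² + b s y)`, at `w = (y, s)`. -/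
noncomputable def heatFamily (w : ℝ × ℝ) (j k : ℕ) (q : ℝ × ℝ) : ℝ :=
  (-w.1 ^ 2) ^ j * (w.2 * w.1) ^ k * Real.exp (-q.1 * w.1 ^ 2 + q.2 * (w.2 * w.1))

variable {lam : ℝ} {m : Measure ℝ} {T : EReal} {f : ℝ → ℝ}

theorem isPartialDerivFamily_heatFamily (w : ℝ × ℝ) (U : Set (ℝ × ℝ)) :
    IsPartialDerivFamily (heatFamily w) U := by
  intro j k q _
  have hlin : HasFDerivAt (fun q : ℝ × ℝ => -q.1 * w.1 ^ 2 + q.2 * (w.2 * w.1))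
      ((-w.1 ^ 2) • ContinuousLinearMap.fst ℝ ℝ ℝ + (w.2 * w.1) • ContinuousLinearMap.snd ℝ ℝ ℝ)
      q := by
    refine ((hasFDerivAt_fst.neg.mul_const _).add (hasFDerivAt_snd.mul_const _)).congr_fderiv ?_
    ext <;> simp
  refine (hlin.exp.const_mul ((-w.1 ^ 2) ^ j * (w.2 * w.1) ^ k)).congr_fderiv ?_
  simp only [heatFamily, smul_add, smul_smul]
  congr 2 <;> ring

theorem abs_heatFamily_le {w q : ℝ × ℝ} {a B : ℝ} (hy : 0 < w.1) (hs : w.2 ∈ Icc (-1) 1)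
    (ha : a ≤ q.1) (hB : |q.2| ≤ B) (j k : ℕ) :
    |heatFamily w j k q| ≤ w.1 ^ (2 * j + k) * Real.exp (-a * w.1 ^ 2 + B * w.1) := by
  have habs : |w.2 * w.1| ≤ w.1 := by
    rw [abs_mul, abs_of_pos hy]
    exact mul_le_of_le_one_left hy.le (abs_le.2 hs)
  have hlin : q.2 * (w.2 * w.1) ≤ B * w.1 :=
    (le_abs_self _).trans <| by
      rw [abs_mul]
      exact mul_le_mul hB habs (abs_nonneg _) ((abs_nonneg _).trans hB)
  rw [heatFamily, abs_mul, Real.abs_exp, abs_mul, abs_pow, abs_pow, abs_neg,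
    abs_of_pos (pow_pos hy 2), pow_add, pow_mul]
  gcongr

theorem isAngularFamily_heatFamily (hlam : 0 ≤ lam) (T : EReal) :
    IsAngularFamily lam (heatDomain T) (heatFactor lam '' timeInterval T) heatFamily where
  isOpen := isOpen_heatDomain T
  measurable j k q := by
    unfold heatFamily
    fun_prop
  isPartialDerivFamily w _ _ := isPartialDerivFamily_heatFamily w _
  dominated j k q hq := by
    obtain ⟨t, ht, hlt⟩ := hq
    obtain ⟨a, hta, haq⟩ := exists_between hlt
    obtain ⟨C, hC⟩ := exists_gaussian_le_heatFactor hlam hta (|q.2| + 1) (2 * j + k)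
    refine ⟨_, mem_image_of_mem _ ht, {q' | a < q'.1 ∧ |q'.2| < |q.2| + 1}, ?_, C, ?_⟩
    · exact ((isOpen_lt continuous_const continuous_fst).inter
        (isOpen_lt continuous_snd.abs continuous_const)).mem_nhds
        ⟨haq, show |q.2| < |q.2| + 1 from lt_add_one _⟩
    · intro w hy hs q' hq'
      refine le_trans ?_ (hC w.1 hy)
      gcongr
      exact abs_heatFamily_le hy hs hq'.1.le hq'.2.le j k

theorem IsAngularMeasure.heatFamily_relation (hm : IsAngularMeasure lam m) (q : ℝ × ℝ) (y : ℝ) :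
    ∫ s, (q.2 * heatFamily (y, s) 0 2 q + 2 * lam * heatFamily (y, s) 0 1 q +
      q.2 * heatFamily (y, s) 1 0 q) ∂m = 0 := by
  have hexp (s : ℝ) : HasDerivAt (fun s : ℝ => heatFamily (y, s) 0 0 q)
      (q.2 * y * heatFamily (y, s) 0 0 q) s := by
    refine ((((hasDerivAt_id s).mul_const y).const_mul q.2).const_add (-q.1 * y ^ 2)).exp.const_mul
      1 |>.congr_deriv ?_ |>.congr_of_eventuallyEq (Eventually.of_forall fun s => ?_)
    · simp only [heatFamily, id]
      ring
    · simp only [heatFamily, id]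
      ring
  have hcont : Continuous fun s : ℝ => heatFamily (y, s) 0 0 q := by
    unfold heatFamily
    fun_prop
  have hibp := hm.ibp _ _ (fun s _ => hexp s) (hcont.const_mul _).continuousOn
  have hsplit (s : ℝ) : q.2 * heatFamily (y, s) 0 2 q + 2 * lam * heatFamily (y, s) 0 1 q +
      q.2 * heatFamily (y, s) 1 0 q = y * (2 * lam * (s * heatFamily (y, s) 0 0 q) -
        (1 - s ^ 2) * (q.2 * y * heatFamily (y, s) 0 0 q)) := by
    simp only [heatFamily]
    ring
  simp only [hsplit]
  rw [integral_const_mul, integral_sub (hm.integrable (by fun_prop)) (hm.integrable (by fun_prop)),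
    integral_const_mul, hibp, sub_self, mul_zero]

theorem IsAngularMeasure.heatKernel_eq_integral_heatFamily (hm : IsAngularMeasure lam m)
    (hlam : 0 ≤ lam) {t x y : ℝ} (ht : 0 < t) (hx : 0 < x) (hy : 0 < y) :
    heatKernel lam t x y = heatPrefactor lam (heatConst lam) t x *
      ∫ s, heatFamily (y, s) 0 0 (1 / (4 * t), x / (2 * t)) ∂m := by
  rw [hm.heatKernel_eq hlam ht hx hy, heatPrefactor, mul_assoc _ (Real.exp _),
    ← integral_const_mul (Real.exp _)]
  congr 2
  ext s
  rw [heatFamily, pow_zero, pow_zero, one_mul, one_mul, ← Real.exp_add]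
  congr 1
  field_simp
  ring

end HeatFamily

section HeatExtension

variable {lam : ℝ} {m : Measure ℝ} {T : EReal} {f : ℝ → ℝ}

theorem kernelIntegral_heatKernel_eq_heatLift (hm : IsAngularMeasure lam m) (hlam : 0 ≤ lam)
    (hf : AEStronglyMeasurable f (volume.restrict (Ioi 0)))
    (hfS : ∀ φ ∈ heatFactor lam '' timeInterval T, IntegrableOn (fun y => φ y * f y) (Ioi 0))
    {t x : ℝ} (ht : t ∈ timeInterval T) (hx : 0 < x) :
    kernelIntegral lam (heatKernel lam) f t x =
      heatLift lam (heatConst lam) (angularTransform lam m heatFamily f) t x :=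
  (isAngularFamily_heatFamily hlam T).setIntegral_kernel_mul hm hf hfS
    (mem_heatDomain ht _) fun _ hy => hm.heatKernel_eq_integral_heatFamily hlam ht.1 hx hy

theorem absConv_heatKernel (hm : IsAngularMeasure lam m) (hlam : 0 ≤ lam)
    (hf : AEStronglyMeasurable f (volume.restrict (Ioi 0)))
    (hfS : ∀ φ ∈ heatFactor lam '' timeInterval T, IntegrableOn (fun y => φ y * f y) (Ioi 0)) :
    AbsConv lam (heatKernel lam) T f := fun _ ht _ hx =>
  (isAngularFamily_heatFamily hlam T).integrableOn_kernel_mul hm hf hfS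
    (mem_heatDomain ht _) fun _ hy => hm.heatKernel_eq_integral_heatFamily hlam ht.1 hx hy

theorem smoothOn_kernelIntegral_heatKernel (hm : IsAngularMeasure lam m) (hlam : 0 ≤ lam)
    (hf : AEStronglyMeasurable f (volume.restrict (Ioi 0)))
    (hfS : ∀ φ ∈ heatFactor lam '' timeInterval T, IntegrableOn (fun y => φ y * f y) (Ioi 0)) :
    SmoothOn T (kernelIntegral lam (heatKernel lam) f) :=
  (smoothOn_heatLift ((isAngularFamily_heatFamily hlam T).isPartialDerivFamily_angularTransform
    hm hf hfS)).congr
    fun _ hq => kernelIntegral_heatKernel_eq_heatLift hm hlam hf hfS hq.1 hq.2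

theorem heatEq_kernelIntegral_heatKernel (hm : IsAngularMeasure lam m) (hlam : 0 ≤ lam)
    (hf : AEStronglyMeasurable f (volume.restrict (Ioi 0)))
    (hfS : ∀ φ ∈ heatFactor lam '' timeInterval T, IntegrableOn (fun y => φ y * f y) (Ioi 0)) :
    HeatEq lam T (kernelIntegral lam (heatKernel lam) f) := by
  have hΦ := isAngularFamily_heatFamily hlam T
  have heq {t x : ℝ} := kernelIntegral_heatKernel_eq_heatLift hm hlam hf hfS (t := t) (x := x)
  intro t ht x hx
  have htime : (fun t => kernelIntegral lam (heatKernel lam) f t x) =ᶠ[𝓝 t]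
      fun t => heatLift lam (heatConst lam) (angularTransform lam m heatFamily f) t x := by
    filter_upwards [(isOpen_timeInterval T).mem_nhds ht] with t ht using heq ht hx
  have hspace : kernelIntegral lam (heatKernel lam) f t =ᶠ[𝓝 x]
      heatLift lam (heatConst lam) (angularTransform lam m heatFamily f) t := by
    filter_upwards [isOpen_Ioi.mem_nhds hx] with x hx using heq ht hx
  rw [htime.deriv_eq, besselOp_congr hspace]
  refine heatEq_heatLift (hΦ.isPartialDerivFamily_angularTransform hm hf hfS)
    (fun q hq => ?_) t ht x hx
  have hsum := hΦ.sum_mul_angularTransform_eq_zero (c := ![q.2, 2 * lam, q.2]) (j := ![0, 0, 1])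
    (k := ![2, 1, 0]) hm hf hfS hq fun y _ => by
      simpa [Fin.sum_univ_three] using hm.heatFamily_relation q y
  simpa [Fin.sum_univ_three] using hsum

theorem exp_neg_sub_sq_div_le {t t₁ δ x y : ℝ} (ht : 0 < t) (htt₁ : t ≤ t₁) (hδ : 0 < δ)
    (hyx : δ < |y - x|) :
    Real.exp (-(y - x) ^ 2 / (4 * t)) ≤ Real.exp (δ ^ 2 / (4 * t₁)) *
      Real.exp (-(δ ^ 2 / 4) / t) * Real.exp (-(1 / (4 * t₁)) * y ^ 2 + x / (2 * t₁) * y) := by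
  have ht₁ : 0 < t₁ := ht.trans_le htt₁
  have hsq : δ ^ 2 ≤ (y - x) ^ 2 := by
    rw [← sq_abs (y - x)]
    gcongr
  have hinv : 0 ≤ 1 / (4 * t) - 1 / (4 * t₁) :=
    sub_nonneg.2 (one_div_le_one_div_of_le (by positivity) (by linarith))
  have hx : 0 ≤ x ^ 2 / (4 * t₁) := by positivity
  rw [← Real.exp_add, ← Real.exp_add, Real.exp_le_exp]
  calc -(y - x) ^ 2 / (4 * t)
      = -((y - x) ^ 2 * (1 / (4 * t) - 1 / (4 * t₁))) - (y - x) ^ 2 / (4 * t₁) := by ring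
    _ ≤ -(δ ^ 2 * (1 / (4 * t) - 1 / (4 * t₁))) - (y - x) ^ 2 / (4 * t₁) + x ^ 2 / (4 * t₁) := by
        linarith [mul_le_mul_of_nonneg_right hsq hinv]
    _ = _ := by ring

theorem tendsto_rpow_mul_exp_neg_div (a : ℝ) {c : ℝ} (hc : 0 < c) :
    Tendsto (fun t : ℝ => t ^ a * Real.exp (-c / t)) (𝓝[>] 0) (𝓝 0) := by
  refine ((tendsto_rpow_mul_exp_neg_mul_atTop_nhds_zero (-a) c hc).comp
    tendsto_inv_nhdsGT_zero).congr' ?_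
  filter_upwards [self_mem_nhdsWithin] with t (ht : 0 < t)
  rw [Function.comp, Real.inv_rpow ht.le, ← Real.rpow_neg ht.le, neg_neg, div_eq_mul_inv]

theorem exists_heatKernel_mul_le_heatFactor (hm : IsAngularMeasure lam m) (hlam : 0 ≤ lam)
    {t₁ t₂ x δ : ℝ} (ht₁ : 0 < t₁) (ht₁₂ : t₁ < t₂) (hx : 0 < x) (hδ : 0 < δ) :
    ∃ η : ℝ → ℝ, Tendsto η (𝓝[>] 0) (𝓝 0) ∧ ∀ t ∈ Ioc 0 t₁, ∀ y, 0 < y → δ < |y - x| →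
      heatKernel lam t x y * y ^ (2 * lam) ≤ η t * heatFactor lam t₂ y := by
  have := heatConst_pos hlam
  obtain ⟨C, hC⟩ := exists_gaussian_le_heatFactor hlam
    (one_div_lt_one_div_of_lt (by positivity) (by linarith : 4 * t₁ < 4 * t₂)) (x / (2 * t₁)) 0
  refine ⟨fun t => heatConst lam * Real.exp (δ ^ 2 / (4 * t₁)) * C *
    (t ^ (-lam - 1 / 2) * Real.exp (-(δ ^ 2 / 4) / t)), ?_, fun t ⟨ht, htt₁⟩ y hy hyx => ?_⟩
  · simpa using (tendsto_rpow_mul_exp_neg_div (-lam - 1 / 2)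
      (by positivity : 0 < δ ^ 2 / 4)).const_mul _
  have hCy := hC y hy
  rw [pow_zero, one_mul] at hCy
  calc heatKernel lam t x y * y ^ (2 * lam)
      ≤ heatConst lam * t ^ (-lam - 1 / 2) * (Real.exp (δ ^ 2 / (4 * t₁)) *
        Real.exp (-(δ ^ 2 / 4) / t) * Real.exp (-(1 / (4 * t₁)) * y ^ 2 + x / (2 * t₁) * y)) *
        y ^ (2 * lam) := by
        refine mul_le_mul_of_nonneg_right ((hm.heatKernel_le hlam ht hx hy).trans ?_)
          (by positivity)
        exact mul_le_mul_of_nonneg_left (exp_neg_sub_sq_div_le ht htt₁ hδ hyx) (by positivity)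
    _ = heatConst lam * t ^ (-lam - 1 / 2) * (Real.exp (δ ^ 2 / (4 * t₁)) *
        Real.exp (-(δ ^ 2 / 4) / t)) *
        (Real.exp (-(1 / (4 * t₁)) * y ^ 2 + x / (2 * t₁) * y) * y ^ (2 * lam)) := by ring
    _ ≤ heatConst lam * t ^ (-lam - 1 / 2) * (Real.exp (δ ^ 2 / (4 * t₁)) *
        Real.exp (-(δ ^ 2 / 4) / t)) * (C * heatFactor lam t₂ y) := by gcongr
    _ = _ := by ring

theorem hasInitialData_heatKernel (hm : IsAngularMeasure lam m) (hlam : 0 ≤ lam) (hT : 0 < T)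
    (hf : AEStronglyMeasurable f (volume.restrict (Ioi 0)))
    (hfS : ∀ φ ∈ heatFactor lam '' timeInterval T, IntegrableOn (fun y => φ y * f y) (Ioi 0)) :
    HasInitialData (kernelIntegral lam (heatKernel lam) f) f := by
  obtain ⟨t₁, ht₁⟩ := exists_mem_timeInterval hT
  obtain ⟨t₂, ht₂, ht₁₂⟩ := exists_gt_mem_timeInterval ht₁
  obtain ⟨C, hC, hnear⟩ := hm.exists_heatKernel_mul_le_poissonProfile hlam
  have hpos : ∀ᶠ t in 𝓝[>] (0 : ℝ), 0 < t := self_mem_nhdsWithin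
  have habs {t x y : ℝ} (ht : 0 < t) (hx : 0 < x) (hy : 0 < y) :
      |heatKernel lam t x y * y ^ (2 * lam)| = heatKernel lam t x y * y ^ (2 * lam) :=
    abs_of_nonneg (mul_nonneg (hm.heatKernel_nonneg hlam ht hx hy) (by positivity))
  refine hasInitialData_kernelIntegral hf (continuousOn_heatFactor lam t₂)
    (fun y hy => (heatFactor_pos hy).ne') (integrableOn_heatFactor hlam ht₂.1)
    (hfS _ (mem_image_of_mem _ ht₂)) hC
    (hpos.mono fun t => Real.sqrt_pos.2) (fun x hx => ?_) (fun x hx => ?_) (fun x hx => ?_)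
    fun x δ hx hδ => ?_
  · filter_upwards [eventually_mem_timeInterval hT] with t ht
      using absConv_heatKernel hm hlam hf hfS t ht x hx
  · filter_upwards [hpos] with t ht using hm.integral_heatKernel hlam ht hx
  · filter_upwards [hpos] with t ht y hy hyx
    exact (habs ht hx hy).trans_le (hnear t x y ht hx hy hyx)
  · obtain ⟨η, hη, hηφ⟩ := exists_heatKernel_mul_le_heatFactor hm hlam ht₁.1 ht₁₂ hx hδ
    refine ⟨η, hη, ?_⟩
    filter_upwards [Ioc_mem_nhdsGT ht₁.1] with t ht y hy hyx
    exact (habs ht.1 hx hy).trans_le (hηφ t ht y hy hyx)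

end HeatExtension

section PoissonFactor

variable {lam y : ℝ}

theorem poissonFactor_eq (lam y : ℝ) :
    poissonFactor lam y = (1 + y ^ 2) ^ (-lam - 1) * y ^ (2 * lam) := by
  rw [poissonFactor, show -lam - 1 = -(lam + 1) by ring, Real.rpow_neg (by positivity),
    add_comm 1 (y ^ 2)]
  ring

theorem poissonFactor_pos (hy : 0 < y) : 0 < poissonFactor lam y := by
  unfold poissonFactor
  positivity

theorem continuousOn_poissonFactor (lam : ℝ) : ContinuousOn (poissonFactor lam) (Ioi 0) := by
  unfold poissonFactor
  refine (continuousOn_id.rpow_const fun y hy => Or.inl (ne_of_gt hy)).div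
    (ContinuousOn.rpow_const (by fun_prop) fun y _ => Or.inl ?_) fun y _ => ?_ <;> positivity

theorem poissonFactor_le_inv_one_add_sq (hlam : 0 ≤ lam) (hy : 0 < y) :
    poissonFactor lam y ≤ (1 + y ^ 2)⁻¹ := by
  have hpow : y ^ (2 * lam) ≤ (1 + y ^ 2) ^ lam := by
    rw [Real.rpow_mul hy.le, Real.rpow_two]
    exact Real.rpow_le_rpow (by positivity) (by linarith) hlam
  calc poissonFactor lam y = (1 + y ^ 2) ^ (-lam - 1) * y ^ (2 * lam) := poissonFactor_eq lam y
    _ ≤ (1 + y ^ 2) ^ (-lam - 1) * (1 + y ^ 2) ^ lam := by gcongr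
    _ = (1 + y ^ 2)⁻¹ := by
      rw [← Real.rpow_add (by positivity), ← Real.rpow_neg_one]
      ring_nf

theorem integrableOn_poissonFactor (hlam : 0 ≤ lam) :
    IntegrableOn (poissonFactor lam) (Ioi 0) := by
  refine integrable_inv_one_add_sq.integrableOn.mono'
    ((continuousOn_poissonFactor lam).aestronglyMeasurable measurableSet_Ioi) ?_
  filter_upwards [ae_restrict_mem measurableSet_Ioi] with y (hy : 0 < y)
  rw [Real.norm_of_nonneg (poissonFactor_pos hy).le]
  exact poissonFactor_le_inv_one_add_sq hlam hy

end PoissonFactor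

section PoissonFamily

/-- The quantity `a + y² - b s y` at `q = (a, b)` and `w = (y, s)`; the phase of the Poisson kernel
is its value at `a = t² + x²`, `b = 2x`. -/
def quadraticPhase (q w : ℝ × ℝ) : ℝ := q.1 + w.1 ^ 2 - q.2 * (w.2 * w.1)

/-- The set of `(a, b)` for which `a + y² - b s y` is positive for all real `y` and `|s| ≤ 1`. -/
def poissonDomain : Set (ℝ × ℝ) := {q | q.2 ^ 2 < 4 * q.1}

/-- The partial derivatives in `(a, b)` of `(a + y² - b s y) ^ (-λ - 1)`, at `w = (y, s)`. -/
noncomputable def poissonFamily (lam : ℝ) (w : ℝ × ℝ) (j k : ℕ) (q : ℝ × ℝ) : ℝ :=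
  (-1) ^ j * (w.2 * w.1) ^ k * (ascPochhammer ℝ (j + k)).eval (lam + 1) *
    quadraticPhase q w ^ (-lam - 1 - (j + k : ℕ))

variable {lam : ℝ} {m : Measure ℝ} {q w : ℝ × ℝ}

theorem isOpen_poissonDomain : IsOpen poissonDomain :=
  isOpen_lt (by fun_prop) (by fun_prop)

theorem mem_poissonDomain {t : ℝ} (ht : 0 < t) (x : ℝ) :
    (t ^ 2 + x ^ 2, 2 * x) ∈ poissonDomain := by
  change (2 * x) ^ 2 < 4 * (t ^ 2 + x ^ 2)
  linarith [sq_pos_of_pos ht]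

theorem mul_one_add_sq_le_quadraticPhase {κ : ℝ} (hκ : κ < 1)
    (hq : q.2 ^ 2 ≤ 4 * (1 - κ) * (q.1 - κ)) (hs : w.2 ∈ Icc (-1) 1) :
    κ * (1 + w.1 ^ 2) ≤ quadraticPhase q w := by
  have hs_sq : w.2 ^ 2 ≤ 1 := sq_le_one_iff_abs_le_one _ |>.2 (abs_le.2 hs)
  have hdisc : (q.2 * w.2) ^ 2 ≤ 4 * (1 - κ) * (q.1 - κ) := by
    rw [mul_pow]
    exact (mul_le_of_le_one_right (sq_nonneg _) hs_sq).trans hq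
  have hmul : 0 ≤ 4 * (1 - κ) * (quadraticPhase q w - κ * (1 + w.1 ^ 2)) := by
    unfold quadraticPhase
    linarith [sq_nonneg (2 * (1 - κ) * w.1 - q.2 * w.2)]
  exact sub_nonneg.1 (nonneg_of_mul_nonneg_right hmul (by linarith))

theorem exists_nhds_le_quadraticPhase (hq : q ∈ poissonDomain) :
    ∃ V ∈ 𝓝 q, ∃ κ, 0 < κ ∧ ∀ q' ∈ V, ∀ w : ℝ × ℝ, w.2 ∈ Icc (-1) 1 →
      κ * (1 + w.1 ^ 2) ≤ quadraticPhase q' w := by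
  have hlim : Tendsto (fun κ => 4 * (1 - κ) * (q.1 - κ)) (𝓝[>] 0) (𝓝 (4 * (1 - 0) * (q.1 - 0))) :=
    (Continuous.tendsto (by fun_prop) 0).mono_left nhdsWithin_le_nhds
  have hlt : q.2 ^ 2 < 4 * (1 - 0) * (q.1 - 0) := by
    rwa [sub_zero, sub_zero, mul_one]
  obtain ⟨κ, hκq, hκ0, hκ1⟩ :=
    ((hlim.eventually_const_lt hlt).and (Ioo_mem_nhdsGT one_pos)).exists
  exact ⟨{q' | q'.2 ^ 2 < 4 * (1 - κ) * (q'.1 - κ)},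
    (isOpen_lt (by fun_prop) (by fun_prop)).mem_nhds hκq, κ, hκ0,
    fun q' hq' w hs => mul_one_add_sq_le_quadraticPhase hκ1 hq'.le hs⟩

theorem quadraticPhase_pos (hq : q ∈ poissonDomain) (hs : w.2 ∈ Icc (-1) 1) :
    0 < quadraticPhase q w := by
  obtain ⟨V, hV, κ, hκ, hle⟩ := exists_nhds_le_quadraticPhase hq
  exact lt_of_lt_of_le (by positivity) (hle q (mem_of_mem_nhds hV) w hs)

theorem hasFDerivAt_quadraticPhase (q w : ℝ × ℝ) :
    HasFDerivAt (fun q => quadraticPhase q w)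
      (ContinuousLinearMap.fst ℝ ℝ ℝ - (w.2 * w.1) • ContinuousLinearMap.snd ℝ ℝ ℝ) q :=
  (hasFDerivAt_fst.add_const _).sub (hasFDerivAt_snd.mul_const _)

theorem isPartialDerivFamily_poissonFamily (lam : ℝ) (hs : w.2 ∈ Icc (-1) 1) :
    IsPartialDerivFamily (poissonFamily lam w) poissonDomain := by
  intro j k q hq
  have hderiv := ((hasFDerivAt_quadraticPhase q w).rpow_const (p := -lam - 1 - (j + k : ℕ))
    (Or.inl (quadraticPhase_pos hq hs).ne')).const_mul
    ((-1) ^ j * (w.2 * w.1) ^ k * (ascPochhammer ℝ (j + k)).eval (lam + 1))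
  refine hderiv.congr_fderiv ?_
  have hexp : -lam - 1 - ((j + k + 1 : ℕ) : ℝ) = -lam - 1 - (j + k : ℕ) - 1 := by
    push_cast
    ring
  simp only [poissonFamily, show j + 1 + k = j + k + 1 by ring, ← add_assoc, hexp,
    ascPochhammer_succ_eval]
  ext <;> simp <;> ring

theorem abs_neg_one_pow_mul_pow_le (hy : 0 < w.1) (hs : w.2 ∈ Icc (-1) 1) (j k : ℕ) :
    |(-1) ^ j * (w.2 * w.1) ^ k| ≤ (1 + w.1 ^ 2) ^ (j + k) := by
  have hbase : |w.2 * w.1| ≤ 1 + w.1 ^ 2 := by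
    rw [abs_mul, abs_of_pos hy]
    nlinarith [sq_nonneg (w.1 - 1), abs_le.2 hs]
  rw [abs_mul, abs_pow, abs_neg, abs_one, one_pow, one_mul, abs_pow]
  calc |w.2 * w.1| ^ k ≤ (1 + w.1 ^ 2) ^ k := by gcongr
    _ ≤ (1 + w.1 ^ 2) ^ (j + k) :=
      pow_le_pow_right₀ (le_add_of_nonneg_right (sq_nonneg _)) (Nat.le_add_left k j)

theorem abs_poissonFamily_le {κ : ℝ} (hlam : 0 ≤ lam) (hκ : 0 < κ) (hy : 0 < w.1)
    (hs : w.2 ∈ Icc (-1) 1) (hle : κ * (1 + w.1 ^ 2) ≤ quadraticPhase q w) (j k : ℕ) :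
    |poissonFamily lam w j k q| ≤ (ascPochhammer ℝ (j + k)).eval (lam + 1) *
      κ ^ (-lam - 1 - (j + k : ℕ)) * (1 + w.1 ^ 2) ^ (-lam - 1) := by
  have hphase : 0 < quadraticPhase q w := lt_of_lt_of_le (by positivity) hle
  have hasc : 0 < (ascPochhammer ℝ (j + k)).eval (lam + 1) := ascPochhammer_pos _ _ (by linarith)
  have hpow : quadraticPhase q w ^ (-lam - 1 - (j + k : ℕ)) ≤
      κ ^ (-lam - 1 - (j + k : ℕ)) * (1 + w.1 ^ 2) ^ (-lam - 1 - (j + k : ℕ)) := by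
    rw [← Real.mul_rpow hκ.le (by positivity)]
    refine Real.rpow_le_rpow_of_nonpos (by positivity) hle ?_
    linarith [(j + k).cast_nonneg (α := ℝ)]
  have hsplit : (1 + w.1 ^ 2) ^ (j + k) * (1 + w.1 ^ 2) ^ (-lam - 1 - (j + k : ℕ)) =
      (1 + w.1 ^ 2) ^ (-lam - 1) := by
    rw [← Real.rpow_natCast, ← Real.rpow_add (by positivity), add_sub_cancel]
  rw [poissonFamily, abs_mul, abs_mul, abs_of_pos hasc, abs_of_pos (Real.rpow_pos_of_pos hphase _)]
  calc _ ≤ (1 + w.1 ^ 2) ^ (j + k) * (ascPochhammer ℝ (j + k)).eval (lam + 1) *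
        (κ ^ (-lam - 1 - (j + k : ℕ)) * (1 + w.1 ^ 2) ^ (-lam - 1 - (j + k : ℕ))) := by
        gcongr
        exact abs_neg_one_pow_mul_pow_le hy hs j k
    _ = _ := by
        rw [← hsplit]
        ring

theorem isAngularFamily_poissonFamily (hlam : 0 ≤ lam) :
    IsAngularFamily lam poissonDomain {poissonFactor lam} (poissonFamily lam) where
  isOpen := isOpen_poissonDomain
  measurable j k q := by
    unfold poissonFamily quadraticPhase
    fun_prop
  isPartialDerivFamily _ _ hs := isPartialDerivFamily_poissonFamily lam hs
  dominated j k q hq := by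
    obtain ⟨V, hV, κ, hκ, hle⟩ := exists_nhds_le_quadraticPhase hq
    refine ⟨_, rfl, V, hV, (ascPochhammer ℝ (j + k)).eval (lam + 1) *
      κ ^ (-lam - 1 - (j + k : ℕ)), fun w hy hs q' hq' => ?_⟩
    rw [poissonFactor_eq, ← mul_assoc]
    exact mul_le_mul_of_nonneg_right
      (abs_poissonFamily_le hlam hκ hy hs (hle q' hq' w hs) j k) (by positivity)

theorem poissonFamily_combination_eq {s : ℝ} (hq : q ∈ poissonDomain) (hs : s ∈ Icc (-1) 1)
    (lam y : ℝ) :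
    q.2 * (2 + lam) * poissonFamily lam (y, s) 1 0 q +
      q.2 * q.1 * poissonFamily lam (y, s) 2 0 q + q.2 ^ 2 * poissonFamily lam (y, s) 1 1 q +
      q.2 * poissonFamily lam (y, s) 0 2 q + 2 * lam * poissonFamily lam (y, s) 0 1 q =
      (lam + 1) * y * (2 * lam * (s * quadraticPhase q (y, s) ^ (-lam - 2)) -
        (1 - s ^ 2) * ((lam + 2) * (q.2 * y) * quadraticPhase q (y, s) ^ (-lam - 2 - 1))) := by
  have hpos : 0 < quadraticPhase q (y, s) := quadraticPhase_pos hq hs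
  have hexp₁ : -lam - 1 - ((1 : ℕ) : ℝ) = -lam - 2 := by norm_num; ring
  have hexp₂ : -lam - 1 - ((2 : ℕ) : ℝ) = -lam - 2 - 1 := by norm_num; ring
  have hmul : quadraticPhase q (y, s) ^ (-lam - 2) =
      quadraticPhase q (y, s) ^ (-lam - 2 - 1) * quadraticPhase q (y, s) := by
    rw [Real.rpow_sub_one hpos.ne', div_mul_cancel₀ _ hpos.ne']
  have hasc₁ : (ascPochhammer ℝ 1).eval (lam + 1) = lam + 1 := by simp
  have hasc₂ : (ascPochhammer ℝ 2).eval (lam + 1) = (lam + 1) * (lam + 2) := by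
    rw [ascPochhammer_succ_eval, hasc₁]
    push_cast
    ring
  simp only [poissonFamily, add_zero, zero_add, Nat.reduceAdd, hexp₁, hexp₂, hmul, hasc₁, hasc₂]
  simp only [quadraticPhase]
  ring

theorem IsAngularMeasure.poissonFamily_relation (hm : IsAngularMeasure lam m)
    (hq : q ∈ poissonDomain) (y : ℝ) :
    ∫ s, (q.2 * (2 + lam) * poissonFamily lam (y, s) 1 0 q +
      q.2 * q.1 * poissonFamily lam (y, s) 2 0 q + q.2 ^ 2 * poissonFamily lam (y, s) 1 1 q +
      q.2 * poissonFamily lam (y, s) 0 2 q + 2 * lam * poissonFamily lam (y, s) 0 1 q) ∂m = 0 := by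
  have hpos : ∀ s ∈ Icc (-1 : ℝ) 1, 0 < quadraticPhase q (y, s) :=
    fun s hs => quadraticPhase_pos hq hs
  have hcont (a : ℝ) : ContinuousOn (fun s => quadraticPhase q (y, s) ^ a) (Icc (-1) 1) := by
    refine ContinuousOn.rpow_const ?_ fun s hs => Or.inl (hpos s hs).ne'
    unfold quadraticPhase
    fun_prop
  have hderiv : ∀ s ∈ Icc (-1 : ℝ) 1,
      HasDerivAt (fun s => quadraticPhase q (y, s) ^ (-lam - 2))
        ((lam + 2) * (q.2 * y) * quadraticPhase q (y, s) ^ (-lam - 2 - 1)) s := fun s hs =>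
    (((((hasDerivAt_id s).mul_const y).const_mul q.2).const_sub (q.1 + y ^ 2)).rpow_const
      (Or.inl (hpos s hs).ne')).congr_deriv (by simp only [quadraticPhase, id]; ring)
  have hibp := hm.ibp _ _ hderiv (by fun_prop)
  rw [integral_congr_ae (hm.mem.mono fun s hs => poissonFamily_combination_eq hq hs lam y),
    integral_const_mul, integral_sub
    ((hm.integrable (by fun_prop)).const_mul _) (hm.integrable (by fun_prop)),
    integral_const_mul, hibp, sub_self, mul_zero]

theorem IsAngularMeasure.poissonKernel_eq_integral_poissonFamily (hm : IsAngularMeasure lam m)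
    (hlam : 0 ≤ lam) {t x y : ℝ} (ht : 0 < t) (hx : 0 < x) (hy : 0 < y) :
    poissonKernel lam t x y = poissonConst lam * t *
      ∫ s, poissonFamily lam (y, s) 0 0 (t ^ 2 + x ^ 2, 2 * x) ∂m := by
  rw [hm.poissonKernel_eq hlam ht hx hy]
  congr with s
  have hphase : quadraticPhase (t ^ 2 + x ^ 2, 2 * x) (y, s) = poissonPhase t x y s := by
    unfold quadraticPhase poissonPhase
    ring
  simp [poissonFamily, hphase]

end PoissonFamily

section PoissonLift

/-- The function of `(t, x)` obtained from `G 0 0` through the substitution `a = t² + x²`,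
`b = 2x`, under which the Poisson kernel is a power of `a + y² - b s y`. -/
noncomputable def poissonLift (c : ℝ) (G : ℕ → ℕ → ℝ × ℝ → ℝ) (t x : ℝ) : ℝ :=
  c * t * G 0 0 (t ^ 2 + x ^ 2, 2 * x)

variable {lam c t : ℝ} {G : ℕ → ℕ → ℝ × ℝ → ℝ}

theorem IsPartialDerivFamily.hasDerivAt_poisson_time (hG : IsPartialDerivFamily G poissonDomain)
    (ht : 0 < t) (j k : ℕ) (x : ℝ) :
    HasDerivAt (fun t => G j k (t ^ 2 + x ^ 2, 2 * x))
      (2 * t * G (j + 1) k (t ^ 2 + x ^ 2, 2 * x)) t :=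
  (hG.hasDerivAt_comp j k (a := fun t => t ^ 2 + x ^ 2) (b := fun _ => 2 * x)
    (mem_poissonDomain ht x) ((hasDerivAt_pow 2 t).add_const _) (hasDerivAt_const t _)).congr_deriv
    (by ring)

theorem IsPartialDerivFamily.hasDerivAt_poisson_space (hG : IsPartialDerivFamily G poissonDomain)
    (ht : 0 < t) (j k : ℕ) (x : ℝ) :
    HasDerivAt (fun x => G j k (t ^ 2 + x ^ 2, 2 * x))
      (2 * x * G (j + 1) k (t ^ 2 + x ^ 2, 2 * x) + 2 * G j (k + 1) (t ^ 2 + x ^ 2, 2 * x)) x :=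
  (hG.hasDerivAt_comp j k (a := fun x => t ^ 2 + x ^ 2) (b := fun x => 2 * x)
    (mem_poissonDomain ht x) ((hasDerivAt_pow 2 x).const_add _)
    ((hasDerivAt_id x).const_mul 2)).congr_deriv (by ring)

theorem hasDerivAt_poissonLift_time (hG : IsPartialDerivFamily G poissonDomain) (ht : 0 < t)
    (x : ℝ) :
    HasDerivAt (fun t => poissonLift c G t x)
      (c * (G 0 0 (t ^ 2 + x ^ 2, 2 * x) + 2 * t ^ 2 * G 1 0 (t ^ 2 + x ^ 2, 2 * x))) t :=
  (((hasDerivAt_id t).const_mul c).mul (hG.hasDerivAt_poisson_time ht 0 0 x)).congr_deriv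
    (by simp only [id]; ring)

theorem deriv_deriv_poissonLift_time (hG : IsPartialDerivFamily G poissonDomain) (ht : 0 < t)
    (x : ℝ) :
    deriv (deriv fun t => poissonLift c G t x) t =
      c * (6 * t * G 1 0 (t ^ 2 + x ^ 2, 2 * x) +
        4 * t ^ 3 * G 2 0 (t ^ 2 + x ^ 2, 2 * x)) := by
  have hfirst : (deriv fun t => poissonLift c G t x) =ᶠ[𝓝 t] fun t =>
      c * (G 0 0 (t ^ 2 + x ^ 2, 2 * x) + 2 * t ^ 2 * G 1 0 (t ^ 2 + x ^ 2, 2 * x)) := by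
    filter_upwards [isOpen_Ioi.mem_nhds ht] with s hs
      using (hasDerivAt_poissonLift_time hG hs x).deriv
  rw [hfirst.deriv_eq]
  refine (((hG.hasDerivAt_poisson_time ht 0 0 x).add (((hasDerivAt_pow 2 t).const_mul 2).mul
    (hG.hasDerivAt_poisson_time ht 1 0 x))).const_mul c).congr_deriv ?_ |>.deriv
  ring

theorem hasDerivAt_poissonLift_space (hG : IsPartialDerivFamily G poissonDomain) (ht : 0 < t)
    (x : ℝ) :
    HasDerivAt (poissonLift c G t)
      (c * t * (2 * x * G 1 0 (t ^ 2 + x ^ 2, 2 * x) + 2 * G 0 1 (t ^ 2 + x ^ 2, 2 * x))) x :=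
  (hG.hasDerivAt_poisson_space ht 0 0 x).const_mul (c * t)

theorem deriv_deriv_poissonLift_space (hG : IsPartialDerivFamily G poissonDomain) (ht : 0 < t)
    (x : ℝ) :
    deriv (deriv (poissonLift c G t)) x = c * t * (2 * G 1 0 (t ^ 2 + x ^ 2, 2 * x) +
      4 * x ^ 2 * G 2 0 (t ^ 2 + x ^ 2, 2 * x) + 8 * x * G 1 1 (t ^ 2 + x ^ 2, 2 * x) +
      4 * G 0 2 (t ^ 2 + x ^ 2, 2 * x)) := by
  rw [funext fun x => (hasDerivAt_poissonLift_space (c := c) hG ht x).deriv]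
  refine (((((hasDerivAt_id x).const_mul 2).mul (hG.hasDerivAt_poisson_space ht 1 0 x)).add
    ((hG.hasDerivAt_poisson_space ht 0 1 x).const_mul 2)).const_mul (c * t)).congr_deriv ?_ |>.deriv
  simp only [id]
  ring

theorem poissonEq_poissonLift (hG : IsPartialDerivFamily G poissonDomain)
    (hrel : ∀ q ∈ poissonDomain, q.2 * (2 + lam) * G 1 0 q + q.2 * q.1 * G 2 0 q +
      q.2 ^ 2 * G 1 1 q + q.2 * G 0 2 q + 2 * lam * G 0 1 q = 0) (T : EReal) :
    PoissonEq lam T (poissonLift c G) := by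
  intro t ⟨ht, _⟩ x hx
  rw [besselOp, deriv_deriv_poissonLift_time hG ht x, deriv_deriv_poissonLift_space hG ht x,
    (hasDerivAt_poissonLift_space hG ht x).deriv]
  have hrel := hrel _ (mem_poissonDomain ht x)
  simp only at hrel
  generalize (t ^ 2 + x ^ 2, 2 * x) = q at hrel ⊢
  have hG₀₂ : G 0 2 q = -((2 + lam) * G 1 0 q) - (t ^ 2 + x ^ 2) * G 2 0 q - 2 * x * G 1 1 q -
      lam / x * G 0 1 q := by
    field_simp
    linarith
  rw [hG₀₂]
  field_simp
  ring

theorem smoothOn_poissonLift (hG : IsPartialDerivFamily G poissonDomain) (T : EReal) :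
    SmoothOn T (poissonLift c G) :=
  ContDiffOn.mul (by fun_prop) <| (hG.contDiffOn isOpen_poissonDomain 0 0).comp
    (f := fun q : ℝ × ℝ => (q.1 ^ 2 + q.2 ^ 2, 2 * q.2)) (by fun_prop)
    fun q hq => mem_poissonDomain hq.1.1 q.2

end PoissonLift

section PoissonExtension

variable {lam : ℝ} {m : Measure ℝ} {f : ℝ → ℝ}

theorem kernelIntegral_poissonKernel_eq_poissonLift (hm : IsAngularMeasure lam m) (hlam : 0 ≤ lam)
    (hf : AEStronglyMeasurable f (volume.restrict (Ioi 0)))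
    (hφf : ∀ φ ∈ ({poissonFactor lam} : Set _), IntegrableOn (fun y => φ y * f y) (Ioi 0))
    {t x : ℝ} (ht : 0 < t) (hx : 0 < x) :
    kernelIntegral lam (poissonKernel lam) f t x =
      poissonLift (poissonConst lam) (angularTransform lam m (poissonFamily lam) f) t x :=
  (isAngularFamily_poissonFamily hlam).setIntegral_kernel_mul hm hf hφf
    (mem_poissonDomain ht x) fun _ hy => hm.poissonKernel_eq_integral_poissonFamily hlam ht hx hy

theorem absConv_poissonKernel (hm : IsAngularMeasure lam m) (hlam : 0 ≤ lam)
    (hf : AEStronglyMeasurable f (volume.restrict (Ioi 0)))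
    (hφf : ∀ φ ∈ ({poissonFactor lam} : Set _), IntegrableOn (fun y => φ y * f y) (Ioi 0))
    (T : EReal) : AbsConv lam (poissonKernel lam) T f := fun _ ht x hx =>
  (isAngularFamily_poissonFamily hlam).integrableOn_kernel_mul hm hf hφf
    (mem_poissonDomain ht.1 x) fun _ hy =>
      hm.poissonKernel_eq_integral_poissonFamily hlam ht.1 hx hy

theorem smoothOn_kernelIntegral_poissonKernel (hm : IsAngularMeasure lam m) (hlam : 0 ≤ lam)
    (hf : AEStronglyMeasurable f (volume.restrict (Ioi 0)))
    (hφf : ∀ φ ∈ ({poissonFactor lam} : Set _), IntegrableOn (fun y => φ y * f y) (Ioi 0))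
    (T : EReal) : SmoothOn T (kernelIntegral lam (poissonKernel lam) f) :=
  (smoothOn_poissonLift ((isAngularFamily_poissonFamily hlam).isPartialDerivFamily_angularTransform
    hm hf hφf) T).congr
    fun _ hq => kernelIntegral_poissonKernel_eq_poissonLift hm hlam hf hφf hq.1.1 hq.2

theorem poissonEq_kernelIntegral_poissonKernel (hm : IsAngularMeasure lam m) (hlam : 0 ≤ lam)
    (hf : AEStronglyMeasurable f (volume.restrict (Ioi 0)))
    (hφf : ∀ φ ∈ ({poissonFactor lam} : Set _), IntegrableOn (fun y => φ y * f y) (Ioi 0))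
    (T : EReal) : PoissonEq lam T (kernelIntegral lam (poissonKernel lam) f) := by
  have hΦ := isAngularFamily_poissonFamily hlam
  have heq {t x : ℝ} := kernelIntegral_poissonKernel_eq_poissonLift hm hlam hf hφf (t := t) (x := x)
  intro t ht x hx
  have htime : (fun t => kernelIntegral lam (poissonKernel lam) f t x) =ᶠ[𝓝 t] fun t =>
      poissonLift (poissonConst lam) (angularTransform lam m (poissonFamily lam) f) t x := by
    filter_upwards [isOpen_Ioi.mem_nhds ht.1] with t ht using heq ht hx
  have hspace : kernelIntegral lam (poissonKernel lam) f t =ᶠ[𝓝 x]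
      poissonLift (poissonConst lam) (angularTransform lam m (poissonFamily lam) f) t := by
    filter_upwards [isOpen_Ioi.mem_nhds hx] with x hx using heq ht.1 hx
  rw [htime.deriv.deriv_eq, besselOp_congr hspace]
  refine poissonEq_poissonLift (hΦ.isPartialDerivFamily_angularTransform hm hf hφf)
    (fun q hq => ?_) T t ht x hx
  have hsum := hΦ.sum_mul_angularTransform_eq_zero
    (c := ![q.2 * (2 + lam), q.2 * q.1, q.2 ^ 2, q.2, 2 * lam]) (j := ![1, 2, 1, 0, 0])
    (k := ![0, 0, 1, 2, 1]) hm hf hφf hq fun y _ => by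
      simpa [Fin.sum_univ_five] using hm.poissonFamily_relation hq y
  simpa [Fin.sum_univ_five] using hsum

theorem one_add_sq_le_mul_sq_sub {x y δ : ℝ} (hx : 0 < x) (hy : 0 < y) (hδ : 0 < δ)
    (hyx : δ < |y - x|) :
    1 + y ^ 2 ≤ (1 / δ ^ 2 + (1 + x / δ) ^ 2) * (y - x) ^ 2 := by
  have hratio : 1 ≤ |y - x| / δ := (one_le_div hδ).2 hyx.le
  have hone : 1 ≤ (|y - x| / δ) ^ 2 := one_le_pow₀ hratio
  have hyle : y ≤ (1 + x / δ) * |y - x| :=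
    calc y ≤ |y - x| + 1 * x := by linarith [le_abs_self (y - x)]
      _ ≤ |y - x| + |y - x| / δ * x := by gcongr
      _ = (1 + x / δ) * |y - x| := by ring
  calc 1 + y ^ 2 ≤ (|y - x| / δ) ^ 2 + ((1 + x / δ) * |y - x|) ^ 2 := by gcongr
    _ = (1 / δ ^ 2 + (1 + x / δ) ^ 2) * |y - x| ^ 2 := by ring
    _ = _ := by rw [sq_abs]

theorem exists_poissonKernel_mul_le_poissonFactor (hm : IsAngularMeasure lam m) (hlam : 0 ≤ lam)
    {x δ : ℝ} (hx : 0 < x) (hδ : 0 < δ) :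
    ∃ C, ∀ t y, 0 < t → 0 < y → δ < |y - x| →
      poissonKernel lam t x y * y ^ (2 * lam) ≤ C * t * poissonFactor lam y := by
  have hc := poissonConst_pos hlam
  set A := 1 / δ ^ 2 + (1 + x / δ) ^ 2
  have hA : 0 < A := by positivity
  refine ⟨poissonConst lam * A⁻¹ ^ (-lam - 1), fun t y ht hy hyx => ?_⟩
  have hbase : A⁻¹ * (1 + y ^ 2) ≤ t ^ 2 + (y - x) ^ 2 := by
    rw [inv_mul_le_iff₀ hA]
    refine (one_add_sq_le_mul_sq_sub hx hy hδ hyx).trans (mul_le_mul_of_nonneg_left ?_ hA.le)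
    exact le_add_of_nonneg_left (sq_nonneg t)
  calc poissonKernel lam t x y * y ^ (2 * lam)
      ≤ poissonConst lam * t * (t ^ 2 + (y - x) ^ 2) ^ (-lam - 1) * y ^ (2 * lam) := by
        gcongr
        exact hm.poissonKernel_le hlam ht hx hy
    _ ≤ poissonConst lam * t * (A⁻¹ * (1 + y ^ 2)) ^ (-lam - 1) * y ^ (2 * lam) := by
        refine mul_le_mul_of_nonneg_right (mul_le_mul_of_nonneg_left ?_ ?_) ?_
        · exact Real.rpow_le_rpow_of_nonpos (by positivity) hbase (by linarith)
        all_goals positivity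
    _ = poissonConst lam * A⁻¹ ^ (-lam - 1) * t * poissonFactor lam y := by
        rw [Real.mul_rpow (by positivity) (by positivity), poissonFactor_eq]
        ring

theorem hasInitialData_poissonKernel (hm : IsAngularMeasure lam m) (hlam : 0 ≤ lam)
    (hf : AEStronglyMeasurable f (volume.restrict (Ioi 0)))
    (hφf : ∀ φ ∈ ({poissonFactor lam} : Set _), IntegrableOn (fun y => φ y * f y) (Ioi 0)) :
    HasInitialData (kernelIntegral lam (poissonKernel lam) f) f := by
  obtain ⟨C, hC, hnear⟩ := hm.exists_poissonKernel_mul_le_poissonProfile hlam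
  have hpos : ∀ᶠ t in 𝓝[>] (0 : ℝ), 0 < t := self_mem_nhdsWithin
  have habs {t x y : ℝ} (ht : 0 < t) (hx : 0 < x) (hy : 0 < y) :
      |poissonKernel lam t x y * y ^ (2 * lam)| = poissonKernel lam t x y * y ^ (2 * lam) :=
    abs_of_nonneg (mul_nonneg (hm.poissonKernel_nonneg hlam ht hx hy) (by positivity))
  refine hasInitialData_kernelIntegral hf (continuousOn_poissonFactor lam)
    (fun y hy => (poissonFactor_pos hy).ne') (integrableOn_poissonFactor hlam) (hφf _ rfl) hC
    hpos (fun x hx => ?_) (fun x hx => ?_) (fun x hx => ?_) fun x δ hx hδ => ?_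
  · filter_upwards [hpos] with t ht
      using absConv_poissonKernel hm hlam hf hφf ⊤ t ⟨ht, EReal.coe_lt_top t⟩ x hx
  · filter_upwards [hpos] with t ht using hm.integral_poissonKernel hlam ht hx
  · filter_upwards [hpos] with t ht y hy hyx
    exact (habs ht hx hy).trans_le (hnear t x y ht hx hy hyx)
  · obtain ⟨D, hD⟩ := exists_poissonKernel_mul_le_poissonFactor hm hlam hx hδ
    refine ⟨fun t => D * t, ?_, ?_⟩
    · exact ((continuous_const_mul D).tendsto' 0 0 (mul_zero D)).mono_left nhdsWithin_le_nhds
    · filter_upwards [hpos] with t ht y hy hyx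
      exact (habs ht hx hy).trans_le (hD t y ht hy hyx)

theorem exists_poissonFactor_le (hm : IsAngularMeasure lam m) (hlam : 0 ≤ lam) {t : ℝ}
    (ht : 0 < t) :
    ∃ C, ∀ y, 0 < y → poissonFactor lam y ≤ C * (poissonKernel lam t 1 y * y ^ (2 * lam)) := by
  have hc := poissonConst_pos hlam
  set A := poissonConst lam * t * (t ^ 2 + 2) ^ (-lam - 1) with hA
  have hA_pos : 0 < A := by positivity
  refine ⟨A⁻¹, fun y hy => ?_⟩
  have hbase : t ^ 2 + (1 + y) ^ 2 ≤ (t ^ 2 + 2) * (1 + y ^ 2) := by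
    linarith [sq_nonneg (1 - y), mul_nonneg (sq_nonneg t) (sq_nonneg y)]
  have hpow := Real.rpow_le_rpow_of_nonpos (z := -lam - 1) (by positivity) hbase (by linarith)
  rw [Real.mul_rpow (by positivity) (by positivity)] at hpow
  rw [← div_eq_inv_mul, le_div_iff₀ hA_pos, poissonFactor_eq]
  calc (1 + y ^ 2) ^ (-lam - 1) * y ^ (2 * lam) * A
      = poissonConst lam * t * ((t ^ 2 + 2) ^ (-lam - 1) * (1 + y ^ 2) ^ (-lam - 1)) *
        y ^ (2 * lam) := by rw [hA]; ring
    _ ≤ poissonConst lam * t * (t ^ 2 + (1 + y) ^ 2) ^ (-lam - 1) * y ^ (2 * lam) := by gcongr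
    _ ≤ poissonKernel lam t 1 y * y ^ (2 * lam) := by
        gcongr
        exact hm.le_poissonKernel hlam ht one_pos hy

end PoissonExtension

section Classes

variable {lam : ℝ} {T : EReal} {p : ℝ≥0∞} {v f : ℝ → ℝ}

theorem integrableOn_mul_of_le_kernel {K φ : ℝ → ℝ} {C : ℝ} (hφ : ContinuousOn φ (Ioi 0))
    (hφ_nonneg : ∀ y, 0 < y → 0 ≤ φ y) (hle : ∀ y, 0 < y → φ y ≤ C * (K y * y ^ (2 * lam)))
    (hf : AEStronglyMeasurable f (volume.restrict (Ioi 0)))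
    (hKf : IntegrableOn (fun y => K y * f y * y ^ (2 * lam)) (Ioi 0)) :
    IntegrableOn (fun y => φ y * f y) (Ioi 0) := by
  refine (hKf.const_mul C).mono ((hφ.aestronglyMeasurable measurableSet_Ioi).mul hf) ?_
  filter_upwards [ae_restrict_mem measurableSet_Ioi] with y (hy : 0 < y)
  rw [show C * (K y * f y * y ^ (2 * lam)) = C * (K y * y ^ (2 * lam)) * f y by ring,
    norm_mul, norm_mul, Real.norm_of_nonneg (hφ_nonneg y hy)]
  exact mul_le_mul_of_nonneg_right ((hle y hy).trans (le_abs_self _)) (norm_nonneg _)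

theorem mem_heatClass_iff (hlam : 0 ≤ lam) (hT : 0 < T) :
    v ∈ heatClass lam T p ↔ IsWeight v ∧ ∀ f : ℝ → ℝ, MemLp f p (weightMeasure v) →
      ∀ t ∈ timeInterval T, IntegrableOn (fun y => heatFactor lam t y * f y) (Ioi 0) := by
  obtain ⟨m, hm⟩ := exists_isAngularMeasure hlam
  refine and_congr_right fun hv => forall₂_congr fun f hf => ?_
  have hfm := (aestronglyMeasurable_weightMeasure_iff hv).1 hf.aestronglyMeasurable
  refine ⟨fun ⟨habs, _⟩ t ht => ?_, fun h => ?_⟩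
  · obtain ⟨C, hC⟩ := exists_heatFactor_le hm hlam ht.1
    exact integrableOn_mul_of_le_kernel (continuousOn_heatFactor lam t)
      (fun y hy => (heatFactor_pos hy).le) hC hfm (habs t ht 1 one_pos)
  · have h : ∀ φ ∈ heatFactor lam '' timeInterval T, IntegrableOn (fun y => φ y * f y) (Ioi 0) :=
      forall_mem_image.2 h
    exact ⟨absConv_heatKernel hm hlam hfm h, smoothOn_kernelIntegral_heatKernel hm hlam hfm h,
      heatEq_kernelIntegral_heatKernel hm hlam hfm h, hasInitialData_heatKernel hm hlam hT hfm h⟩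

theorem mem_poissonClass_iff (hlam : 0 ≤ lam) (hT : 0 < T) :
    v ∈ poissonClass lam T p ↔ IsWeight v ∧ ∀ f : ℝ → ℝ, MemLp f p (weightMeasure v) →
      IntegrableOn (fun y => poissonFactor lam y * f y) (Ioi 0) := by
  obtain ⟨m, hm⟩ := exists_isAngularMeasure hlam
  refine and_congr_right fun hv => forall₂_congr fun f hf => ?_
  have hfm := (aestronglyMeasurable_weightMeasure_iff hv).1 hf.aestronglyMeasurable
  refine ⟨fun ⟨habs, _⟩ => ?_, fun h => ?_⟩
  · obtain ⟨t, ht⟩ := exists_mem_timeInterval hT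
    obtain ⟨C, hC⟩ := exists_poissonFactor_le hm hlam ht.1
    exact integrableOn_mul_of_le_kernel (continuousOn_poissonFactor lam)
      (fun y hy => (poissonFactor_pos hy).le) hC hfm (habs t ht 1 one_pos)
  · have h : ∀ φ ∈ ({poissonFactor lam} : Set _), IntegrableOn (fun y => φ y * f y) (Ioi 0) := by
      rintro _ rfl
      exact h
    exact ⟨absConv_poissonKernel hm hlam hfm h T,
      smoothOn_kernelIntegral_poissonKernel hm hlam hfm h T,
      poissonEq_kernelIntegral_poissonKernel hm hlam hfm h T,
      hasInitialData_poissonKernel hm hlam hfm h⟩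

end Classes

end Bessel

theorem corollary1p2 (lam : ℝ) (hlam : 0 ≤ lam) (p : ℝ≥0∞) (hp1 : 1 ≤ p) (hp : p ≠ ⊤)
    (T : EReal) (hT : 0 < T) (v : ℝ → ℝ) (hv : Bessel.IsWeight v) :
    (v ∈ Bessel.heatClass lam T p ↔
      ∀ t ∈ Bessel.timeInterval T,
        MemLp (fun y => v y ^ (-(1 / p.toReal)) * Bessel.heatFactor lam t y)
          p.conjExponent (volume.restrict (Ioi (0 : ℝ)))) ∧
    (v ∈ Bessel.poissonClass lam T p ↔
      MemLp (fun y => v y ^ (-(1 / p.toReal)) * Bessel.poissonFactor lam y)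
        p.conjExponent (volume.restrict (Ioi (0 : ℝ)))) := by
  have hdual {φ : ℝ → ℝ} (hφ : ContinuousOn φ (Ioi 0)) :=
    Bessel.memLp_weight_rpow_neg_mul_iff hv hp1 hp (hφ.aestronglyMeasurable measurableSet_Ioi)
  constructor
  · simp only [Bessel.mem_heatClass_iff hlam hT, hv, true_and,
      hdual (Bessel.continuousOn_heatFactor lam _)]
    exact ⟨fun h t ht f hf => h f hf t ht, fun h f hf t ht => h t ht f hf⟩
  · simp only [Bessel.mem_poissonClass_iff hlam hT, hv, true_and,
      hdual (Bessel.continuousOn_poissonFactor lam)]
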